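/- **Conventions.** A *$C^*$-precategory* $\mathcal T$ with objects $\mathbb N=\{0,1,2,\dots\}$ consists of complex Banach spaces $\mathcal T(m,n)$ (arrows from $m$ to $n$), an associative bilinear composition $\mathcal T(m,n)\times\mathcal T(l,m)\to\mathcal T(l,n)$ with $\|ab\|\le\|a\|\|b\|$, and antilinear maps ${}^*:\mathcal T(m,n)\to\mathcal T(n,m)$ with $a^{**}=a$, $(ab)^*=b^*a^*$, $\|a^*a\|=\|a\|^2$, and $a^*a\ge 0$ in the $C^*$-algebra $\mathcal T(m,m)$ for $a\in\mathcal T(m,n)$. It is a *right tensor $C^*$-precategory* if it carries linear maps $\mathcal T(m,n)\to\mathcal T(m+1,n+1)$, $a\mapsto a\otimes 1$, compatible with composition and involution; $a\otimes 1^k$ is the $k$-th iterate. An *ideal* $\mathcal K$ in $\mathcal T$ is a family of closed subspaces $\mathcal K(m,n)\subset\mathcal T(m,n)$ stable under composition with arrows of $\mathcal T$ on both sides; inclusions and intersections of ideals are taken componentwise. Put $\otimes1^{-1}(\mathcal K)(m,n)=\{a\in\mathcal T(m,n):a\otimes 1\in\mathcal K(m+1,n+1)\}$ and $J(\mathcal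 K)=\mathcal K\cap\otimes1^{-1}(\mathcal K)$. An ideal $\mathcal N$ is *invariant* if $\mathcal N\otimes 1\subset\mathcal N$; then $\mathcal T/\mathcal N$, with $(\mathcal T/\mathcal N)(m,n)=\mathcal T(m,n)/\mathcal N(m,n)$, is again a right tensor $C^*$-precategory, and for an ideal $\mathcal K$ of $\mathcal T$ we write $\mathcal K/\mathcal N$ for the image of $\mathcal K$ in $\mathcal T/\mathcal N$, which is an ideal. Given an ideal $\mathcal J$, the ideal $\mathcal N$ is *$\mathcal J$-saturated* if $\mathcal J\cap\otimes1^{-1}(\mathcal N)\subset\mathcal N$; the *$\mathcal J$-saturation* $\mathcal S_{\mathcal J}(\mathcal N)$ is the smallest $\mathcal J$-saturated ideal containing $\mathcal N$. A *right tensor representation* $\pi$ of an ideal $\mathcal K$ in a $C^*$-algebra $B$ is a family of linear maps $\pi_{nm}:\mathcal K(m,n)\to B$ with $\pi_{mn}(a^*)=\pi_{nm}(a)^*$ and $\pi_{nm}(a)\,\pi_{m+k,l}(b)=\pi_{n+k,l}((a\otimes 1^k)b)$ for $a\in\mathcal K(m,n)$, $b\in\mathcal K(l,m+k)$, $k\ge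 0$. For an ideal $\mathcal J\subset J(\mathcal K)$, $\pi$ is *coisometric on $\mathcal J$* if $\pi_{nm}(a)=\pi_{n+1,m+1}(a\otimes 1)$ for all $a\in\mathcal J(m,n)$. Let $\mathcal O_{\mathcal T}(\mathcal K,\mathcal J)$, with $i=\{i_{(n,m)}\}$, be the $C^*$-algebra generated by a universal right tensor representation of $\mathcal K$ coisometric on $\mathcal J$: every such representation $\pi$ is $\Psi_\pi\circ i$ for a unique $*$-homomorphism $\Psi_\pi$ on $\mathcal O_{\mathcal T}(\mathcal K,\mathcal J)$. **Structure Theorem.** Let $\mathcal K,\mathcal J,\mathcal N$ be ideals in a right tensor $C^*$-precategory $\mathcal T$ such that $\mathcal J\subset J(\mathcal K)$ and $\mathcal N$ is invariant. The closed linear span $$\mathcal O(\mathcal N)=\overline{\mathrm{span}}\{i_{(n,m)}(a): a\in(\mathcal K\cap\mathcal N)(m,n),\ m,n\in\mathbb N\}\subset\mathcal O_{\mathcal T}(\mathcal K,\mathcal J)$$ is an ideal in $\mathcal O_{\mathcal T}(\mathcal K,\mathcal J)$, and there are natural isomorphisms (matching the generators given by $a$ with those given by $a$, respectively by $a+\mathcal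 N$) $$\mathcal O(\mathcal N)\cong\mathcal O_{\mathcal T}(\mathcal K\cap\mathcal N,\mathcal J\cap\mathcal N),\qquad \mathcal O_{\mathcal T}(\mathcal K,\mathcal J)/\mathcal O(\mathcal N)\cong\mathcal O_{\mathcal T/\mathcal N}(\mathcal K/\mathcal N,\mathcal J/\mathcal N).$$ Moreover $\mathcal K\cap\mathcal S_{\mathcal J}(\mathcal N)=i^{-1}(\mathcal O(\mathcal N))$, that is, $a\in\mathcal K(m,n)$ lies in $\mathcal S_{\mathcal J}(\mathcal N)(m,n)$ if and only if $i_{(n,m)}(a)\in\mathcal O(\mathcal N)$. The ideal $\mathcal S_{\mathcal J}(\mathcal N)$ is invariant and $\mathcal J$-saturated, $\mathcal O(\mathcal S_{\mathcal J}(\mathcal N))=\mathcal O(\mathcal N)$, and on the right-hand sides of both isomorphisms $\mathcal N$ may be replaced by $\mathcal S_{\mathcal J}(\mathcal N)$: $$\mathcal O(\mathcal N)\cong\mathcal O_{\mathcal T}(\mathcal K\cap\mathcal S_{\mathcal J}(\mathcal N),\mathcal J\cap\mathcal S_{\mathcal J}(\mathcal N)),\qquad \mathcal O_{\mathcal T}(\mathcal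 K,\mathcal J)/\mathcal O(\mathcal N)\cong\mathcal O_{\mathcal T/\mathcal S_{\mathcal J}(\mathcal N)}(\mathcal K/\mathcal S_{\mathcal J}(\mathcal N),\mathcal J/\mathcal S_{\mathcal J}(\mathcal N)).$$ -/

import Mathlib

universe u

open Unitization in
/-- In a `C*`-algebra, the self-adjoint elements `e = h g`, with `g` in the `C*`-algebra generated by
`h`, approximate a unit for `h`, and compression by `1 - e` is contractive. -/
theorem NonUnitalCStarAlgebra.exists_cutoff {A : Type*} [NonUnitalCStarAlgebra A] (h : A) (hh : IsSelfAdjoint h)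
    {ε : ℝ} (hε : 0 < ε) :
    ∃ g : A, star (h * g) = h * g ∧
      ‖h - h * (h * g) - (h * g) * h + (h * g) * h * (h * g)‖ ≤ ε ∧
      ∀ z : A, ‖z - z * (h * g) - (h * g) * z + (h * g) * z * (h * g)‖ ≤ ‖z‖ := by
  have hε2 : (0 : ℝ) < ε ^ 2 := by positivity
  have hpos : ∀ t : ℝ, 0 < t ^ 2 + ε ^ 2 := fun t => by positivity
  have hne : ∀ t : ℝ, t ^ 2 + ε ^ 2 ≠ 0 := fun t => (hpos t).ne'
  let g : A := cfcₙ (fun t : ℝ => t / (t ^ 2 + ε ^ 2)) h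
  let f : ℝ → ℝ := fun t => t * (t / (t ^ 2 + ε ^ 2))
  have hcg : Continuous (fun t : ℝ => t / (t ^ 2 + ε ^ 2)) := by
    fun_prop (disch := exact hne _)
  have hcf : Continuous f := continuous_id.mul hcg
  have he : h * g = cfcₙ f h := by
    simp only [g, f]
    rw [cfcₙ_mul (fun t : ℝ => t) (fun t : ℝ => t / (t ^ 2 + ε ^ 2)) h, cfcₙ_id' ℝ h]
  have hsa : IsSelfAdjoint (h * g) := by rw [he]; exact cfcₙ_predicate f h
  have hu : ((h * g : A) : Unitization ℂ A) = cfc f (h : Unitization ℂ A) := by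
    rw [he]; exact Unitization.real_cfcₙ_eq_cfc_inr h f
  have hsu : IsSelfAdjoint (h : Unitization ℂ A) := isSelfAdjoint_inr.2 hh
  have h1 : (1 : Unitization ℂ A) - ((h * g : A) : Unitization ℂ A) = cfc (fun t => 1 - f t) (h : Unitization ℂ A) := by
    rw [hu, cfc_sub (fun _ : ℝ => (1 : ℝ)) f (h : Unitization ℂ A), cfc_const_one ℝ (h : Unitization ℂ A)]
  have h1f : ∀ t, 1 - f t = ε ^ 2 / (t ^ 2 + ε ^ 2) := by
    intro t; simp only [f]; field_simp [hne t]; ring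
  have hn1 : ‖(1 : Unitization ℂ A) - ((h * g : A) : Unitization ℂ A)‖ ≤ 1 := by
    rw [h1]
    refine norm_cfc_le zero_le_one fun t _ => ?_
    rw [h1f, Real.norm_eq_abs, abs_of_nonneg (by positivity), div_le_one (hpos t)]
    nlinarith [sq_nonneg t]
  have hfac : ∀ z : A, ((z - z * (h * g) - (h * g) * z + (h * g) * z * (h * g) : A) : Unitization ℂ A)
      = (1 - ((h * g : A) : Unitization ℂ A)) * (z : Unitization ℂ A) * (1 - ((h * g : A) : Unitization ℂ A)) := by
    intro z
    simp only [inr_add, inr_sub, inr_mul]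
    noncomm_ring
  refine ⟨g, hsa.star_eq, ?_, ?_⟩
  · rw [← Unitization.norm_inr (𝕜 := ℂ), hfac, h1]
    have : (h : Unitization ℂ A) = cfc (fun t : ℝ => t) (h : Unitization ℂ A) := (cfc_id' ℝ (h : Unitization ℂ A)).symm
    rw [this, cfc_id' ℝ (h : Unitization ℂ A)]
    have hc1 : Continuous fun t => 1 - f t := continuous_const.sub hcf
    have e1 : cfc (fun t => 1 - f t) (h : Unitization ℂ A) * (h : Unitization ℂ A) * cfc (fun t => 1 - f t) (h : Unitization ℂ A)
        = cfc (fun t => (1 - f t) * t * (1 - f t)) (h : Unitization ℂ A) := by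
      rw [cfc_mul (fun t => (1 - f t) * t) (fun t => 1 - f t) (h : Unitization ℂ A)
        (hc1.mul continuous_id).continuousOn hc1.continuousOn,
        cfc_mul (fun t => (1 - f t)) (fun t => t) (h : Unitization ℂ A) hc1.continuousOn continuousOn_id,
        cfc_id' ℝ (h : Unitization ℂ A)]
    rw [e1]
    refine norm_cfc_le hε.le fun t _ => ?_
    rw [h1f, Real.norm_eq_abs]
    have hr0 : 0 ≤ ε ^ 2 / (t ^ 2 + ε ^ 2) := by positivity
    have hr1 : ε ^ 2 / (t ^ 2 + ε ^ 2) ≤ 1 := by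
      rw [div_le_one (hpos t)]; nlinarith [sq_nonneg t]
    rw [abs_mul, abs_mul, abs_of_nonneg hr0]
    have h2 : ε ^ 2 / (t ^ 2 + ε ^ 2) * |t| ≤ ε := by
      rw [div_mul_eq_mul_div, div_le_iff₀ (hpos t)]
      have := sq_abs t
      nlinarith [sq_nonneg (|t| - ε), abs_nonneg t]
    calc _ ≤ ε * 1 := mul_le_mul h2 hr1 hr0 hε.le
      _ = ε := mul_one _
  · intro z
    rw [← Unitization.norm_inr (𝕜 := ℂ), hfac, ← Unitization.norm_inr (𝕜 := ℂ) (a := z)]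
    calc _ ≤ ‖(1 : Unitization ℂ A) - ((h * g : A) : Unitization ℂ A)‖ * ‖(z : Unitization ℂ A)‖ * ‖(1 : Unitization ℂ A) - ((h * g : A) : Unitization ℂ A)‖ :=
          norm_mul₃_le
      _ ≤ 1 * ‖(z : Unitization ℂ A)‖ * 1 := by gcongr
      _ = _ := by ring

/-- A right tensor `C*`-precategory: a `C*`-precategory with objects `0, 1, 2, …`, where `Hom m n`
is the Banach space of arrows from `m` to `n`, together with an endomorphism `ten` (right tensoring,
`a ↦ a ⊗ 1`) which is `n ↦ n + 1` on objects. -/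
structure RightTensorCStarPrecategory : Type (u + 1) where
  Hom : ℕ → ℕ → Type u
  [normedAddCommGroup : ∀ m n, NormedAddCommGroup (Hom m n)]
  [normedSpace : ∀ m n, NormedSpace ℂ (Hom m n)]
  [completeSpace : ∀ m n, CompleteSpace (Hom m n)]
  /-- composition of arrows -/
  comp : ∀ {l m n : ℕ}, Hom m n → Hom l m → Hom l n
  comp_assoc : ∀ {k l m n : ℕ} (a : Hom m n) (b : Hom l m) (c : Hom k l),
    comp (comp a b) c = comp a (comp b c)
  add_comp : ∀ {l m n : ℕ} (a a' : Hom m n) (b : Hom l m),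
    comp (a + a') b = comp a b + comp a' b
  comp_add : ∀ {l m n : ℕ} (a : Hom m n) (b b' : Hom l m),
    comp a (b + b') = comp a b + comp a b'
  smul_comp : ∀ {l m n : ℕ} (z : ℂ) (a : Hom m n) (b : Hom l m),
    comp (z • a) b = z • comp a b
  comp_smul : ∀ {l m n : ℕ} (z : ℂ) (a : Hom m n) (b : Hom l m),
    comp a (z • b) = z • comp a b
  norm_comp_le : ∀ {l m n : ℕ} (a : Hom m n) (b : Hom l m), ‖comp a b‖ ≤ ‖a‖ * ‖b‖
  /-- the involution `a ↦ a*` -/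
  adj : ∀ {m n : ℕ}, Hom m n → Hom n m
  adj_adj : ∀ {m n : ℕ} (a : Hom m n), adj (adj a) = a
  adj_add : ∀ {m n : ℕ} (a b : Hom m n), adj (a + b) = adj a + adj b
  adj_smul : ∀ {m n : ℕ} (z : ℂ) (a : Hom m n), adj (z • a) = star z • adj a
  adj_comp : ∀ {l m n : ℕ} (a : Hom m n) (b : Hom l m), adj (comp a b) = comp (adj b) (adj a)
  norm_adj_comp_self : ∀ {m n : ℕ} (a : Hom m n), ‖comp (adj a) a‖ = ‖a‖ ^ 2
  /-- `a* a` is a positive element of the `C*`-algebra `Hom m m` -/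
  adj_comp_self_pos : ∀ {m n : ℕ} (a : Hom m n), ∃ b : Hom m m, comp (adj a) a = comp (adj b) b
  /-- right tensoring, `a ↦ a ⊗ 1` -/
  ten : ∀ {m n : ℕ}, Hom m n →ₗ[ℂ] Hom (m + 1) (n + 1)
  ten_comp : ∀ {l m n : ℕ} (a : Hom m n) (b : Hom l m), ten (comp a b) = comp (ten a) (ten b)
  ten_adj : ∀ {m n : ℕ} (a : Hom m n), ten (adj a) = adj (ten a)

namespace RightTensorCStarPrecategory

attribute [instance] normedAddCommGroup normedSpace completeSpace

noncomputable section

variable (T : RightTensorCStarPrecategory.{u})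

/-- The `k`-fold right tensoring `a ↦ a ⊗ 1^k`. -/
def tenPow {m n : ℕ} : (k : ℕ) → T.Hom m n → T.Hom (m + k) (n + k)
  | 0, a => a
  | k + 1, a => T.ten (tenPow k a)

variable {T}

/-- Composition as a bilinear map. -/
def compₗ {l m n : ℕ} : T.Hom m n →ₗ[ℂ] T.Hom l m →ₗ[ℂ] T.Hom l n :=
  LinearMap.mk₂ ℂ T.comp T.add_comp T.smul_comp T.comp_add T.comp_smul

theorem comp_sub {l m n : ℕ} (a : T.Hom m n) (b b' : T.Hom l m) :
    T.comp a (b - b') = T.comp a b - T.comp a b' := map_sub (compₗ a) b b'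

theorem sub_comp {l m n : ℕ} (a a' : T.Hom m n) (b : T.Hom l m) :
    T.comp (a - a') b = T.comp a b - T.comp a' b := LinearMap.map_sub₂ compₗ a a' b

theorem comp_zero {l m n : ℕ} (a : T.Hom m n) : T.comp a (0 : T.Hom l m) = 0 :=
  map_zero (compₗ a)

theorem zero_comp {l m n : ℕ} (b : T.Hom l m) : T.comp (0 : T.Hom m n) b = 0 :=
  LinearMap.map_zero₂ compₗ b

theorem adj_sub {m n : ℕ} (a b : T.Hom m n) : T.adj (a - b) = T.adj a - T.adj b :=
  map_sub (AddMonoidHom.mk' T.adj T.adj_add) a b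

theorem norm_adj {m n : ℕ} (a : T.Hom m n) : ‖T.adj a‖ = ‖a‖ := by
  have key : ∀ {m n : ℕ} (a : T.Hom m n), ‖a‖ ≤ ‖T.adj a‖ := by
    intro m n a
    have h := T.norm_comp_le (T.adj a) a
    rw [T.norm_adj_comp_self] at h
    rcases (norm_nonneg a).eq_or_lt with h0 | h0
    · rw [← h0]; exact norm_nonneg _
    · nlinarith
  refine le_antisymm ?_ (key a)
  have := key (T.adj a)
  rwa [T.adj_adj] at this

theorem continuous_comp_left {l m n : ℕ} (a : T.Hom m n) :
    Continuous (fun b : T.Hom l m => T.comp a b) :=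
  ((compₗ (l := l) a).mkContinuous ‖a‖ (T.norm_comp_le a)).continuous

theorem continuous_comp_right {l m n : ℕ} (b : T.Hom l m) :
    Continuous (fun a : T.Hom m n => T.comp a b) :=
  (((compₗ (T := T) (n := n)).flip b).mkContinuous ‖b‖
    (fun a => (T.norm_comp_le a b).trans_eq (mul_comm _ _))).continuous

/-- The endomorphism space `T(m, m)`, regarded as a `C*`-algebra. -/
def Diag (T : RightTensorCStarPrecategory.{u}) (m : ℕ) : Type u := T.Hom m m

instance (m : ℕ) : NormedAddCommGroup (T.Diag m) := inferInstanceAs (NormedAddCommGroup (T.Hom m m))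

instance (m : ℕ) : NormedSpace ℂ (T.Diag m) := inferInstanceAs (NormedSpace ℂ (T.Hom m m))

instance (m : ℕ) : CompleteSpace (T.Diag m) := inferInstanceAs (CompleteSpace (T.Hom m m))

instance (m : ℕ) : NonUnitalNormedRing (T.Diag m) where
  mul := T.comp (l := m) (m := m) (n := m)
  left_distrib := T.comp_add
  right_distrib := T.add_comp
  zero_mul := zero_comp
  mul_zero := comp_zero
  mul_assoc := T.comp_assoc
  dist_eq := NormedAddCommGroup.dist_eq
  norm_mul_le := T.norm_comp_le

instance (m : ℕ) : StarRing (T.Diag m) where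
  star := T.adj (m := m) (n := m)
  star_involutive := T.adj_adj
  star_mul := T.adj_comp
  star_add := T.adj_add

instance (m : ℕ) : NonUnitalCStarAlgebra (T.Diag m) where
  norm_mul_self_le a := by
    have := T.norm_adj_comp_self (m := m) (n := m) a
    rw [pow_two] at this
    exact this.ge
  smul_assoc z a b := T.smul_comp z a b
  smul_comm z a b := (T.comp_smul z a b).symm
  star_smul z a := T.adj_smul z a

/-- Right tensoring on the endomorphism `C*`-algebras. -/
def tenDiag (T : RightTensorCStarPrecategory.{u}) (m : ℕ) : T.Diag m →⋆ₙₐ[ℂ] T.Diag (m + 1) where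
  toFun := T.ten (m := m) (n := m)
  map_smul' := map_smul (T.ten (m := m) (n := m))
  map_zero' := map_zero (T.ten (m := m) (n := m))
  map_add' := map_add (T.ten (m := m) (n := m))
  map_mul' := T.ten_comp
  map_star' := T.ten_adj

theorem norm_ten_le {m n : ℕ} (a : T.Hom m n) : ‖T.ten a‖ ≤ ‖a‖ := by
  have h : ‖T.ten (T.comp (T.adj a) a)‖ ≤ ‖T.comp (T.adj a) a‖ :=
    NonUnitalStarAlgHom.norm_apply_le (T.tenDiag m) (show T.Diag m from T.comp (T.adj a) a)
  rw [T.ten_comp, T.ten_adj, T.norm_adj_comp_self, T.norm_adj_comp_self] at h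
  exact (sq_le_sq₀ (norm_nonneg _) (norm_nonneg _)).1 h

theorem continuous_ten {m n : ℕ} : Continuous (T.ten (m := m) (n := n)) :=
  ((T.ten (m := m) (n := n)).mkContinuous 1 (fun a => by simpa using norm_ten_le a)).continuous

/-- A closed two-sided ideal in a `C*`-precategory. -/
structure ClosedIdeal (T : RightTensorCStarPrecategory.{u}) : Type u where
  carrier : ∀ m n : ℕ, Submodule ℂ (T.Hom m n)
  isClosed : ∀ m n : ℕ, IsClosed (carrier m n : Set (T.Hom m n))
  comp_mem_left : ∀ {l m n : ℕ} (a : T.Hom m n) {b : T.Hom l m},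
    b ∈ carrier l m → T.comp a b ∈ carrier l n
  comp_mem_right : ∀ {l m n : ℕ} {a : T.Hom m n} (b : T.Hom l m),
    a ∈ carrier m n → T.comp a b ∈ carrier l n


/-- Approximate units on arrows. -/
theorem exists_cutoff {m n : ℕ} (y : T.Hom m n) {ε : ℝ} (hε : 0 < ε) :
    ∃ g : T.Hom m m,
      T.adj (T.comp (T.comp (T.adj y) y) g) = T.comp (T.comp (T.adj y) y) g ∧
      ‖y - T.comp y (T.comp (T.comp (T.adj y) y) g)‖ ≤ ε ∧
      (∀ {k : ℕ} (x : T.Hom m k), ‖x - T.comp x (T.comp (T.comp (T.adj y) y) g)‖ ≤ ‖x‖) ∧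
      (∀ {k : ℕ} (x : T.Hom k m), ‖x - T.comp (T.comp (T.comp (T.adj y) y) g) x‖ ≤ ‖x‖) := by
  have hsa : IsSelfAdjoint (show T.Diag m from T.comp (T.adj y) y) := by
    change T.adj (T.comp (T.adj y) y) = _
    rw [T.adj_comp, T.adj_adj]
  obtain ⟨g, h1, h2, h3⟩ :=
    NonUnitalCStarAlgebra.exists_cutoff _ hsa (show (0 : ℝ) < ε ^ 2 by positivity)
  let g' : T.Hom m m := g
  let e : T.Hom m m := T.comp (T.comp (T.adj y) y) g'
  have he : T.adj e = e := h1
  have key : ∀ {k : ℕ} (x : T.Hom m k), T.comp (T.adj (x - T.comp x e)) (x - T.comp x e) =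
      T.comp (T.adj x) x - T.comp (T.comp (T.adj x) x) e - T.comp e (T.comp (T.adj x) x)
        + T.comp (T.comp e (T.comp (T.adj x) x)) e := by
    intro k x
    rw [adj_sub, T.adj_comp, he]
    simp only [comp_sub, sub_comp, T.comp_assoc]
    abel
  have hr : ∀ {k : ℕ} (x : T.Hom m k), ‖x - T.comp x e‖ ≤ ‖x‖ := by
    intro k x
    refine (sq_le_sq₀ (norm_nonneg _) (norm_nonneg _)).1 ?_
    rw [← T.norm_adj_comp_self, ← T.norm_adj_comp_self, key]
    exact h3 (show T.Diag m from T.comp (T.adj x) x)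
  refine ⟨g', he, ?_, hr, ?_⟩
  · change ‖y - T.comp y e‖ ≤ ε
    refine (sq_le_sq₀ (norm_nonneg _) hε.le).1 ?_
    rw [← T.norm_adj_comp_self, key]
    exact h2
  · intro k x
    have := hr (T.adj x)
    rw [← norm_adj, adj_sub, T.adj_comp, T.adj_adj, he, norm_adj] at this
    exact this

namespace ClosedIdeal

theorem cutoff_mem (N : T.ClosedIdeal) {m n : ℕ} {y : T.Hom m n} (hy : y ∈ N.carrier m n)
    (g : T.Hom m m) : T.comp (T.comp (T.adj y) y) g ∈ N.carrier m m :=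
  N.comp_mem_right g (N.comp_mem_left (T.adj y) hy)

/-- Closed ideals are self-adjoint. -/
theorem adj_mem (K : T.ClosedIdeal) {m n : ℕ} {a : T.Hom m n} (ha : a ∈ K.carrier m n) :
    T.adj a ∈ K.carrier n m := by
  have : T.adj a ∈ closure (K.carrier n m : Set (T.Hom n m)) := by
    rw [Metric.mem_closure_iff]
    intro ε hε
    obtain ⟨g, -, hg, -⟩ := exists_cutoff (T.adj a) (half_pos hε)
    have ha' : T.adj (T.adj a) ∈ K.carrier m n := by rwa [T.adj_adj]
    refine ⟨_, K.comp_mem_left (T.adj a) (K.comp_mem_right g (K.comp_mem_right (T.adj a) ha')), ?_⟩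
    rw [dist_eq_norm]
    exact hg.trans_lt (half_lt_self hε)
  rwa [(K.isClosed n m).closure_eq] at this

instance : LE T.ClosedIdeal := ⟨fun K L => ∀ m n : ℕ, K.carrier m n ≤ L.carrier m n⟩

/-- The intersection `K ∩ L`. -/
instance : Min T.ClosedIdeal :=
  ⟨fun K L =>
    { carrier := fun m n => K.carrier m n ⊓ L.carrier m n
      isClosed := fun m n => (K.isClosed m n).inter (L.isClosed m n)
      comp_mem_left := fun a _ hb => ⟨K.comp_mem_left a hb.1, L.comp_mem_left a hb.2⟩
      comp_mem_right := fun b ha => ⟨K.comp_mem_right b ha.1, L.comp_mem_right b ha.2⟩ }⟩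

/-- The preimage `⊗1⁻¹(K)`. -/
def tenPreimage (K : T.ClosedIdeal) : T.ClosedIdeal where
  carrier m n := (K.carrier (m + 1) (n + 1)).comap T.ten
  isClosed m n := (K.isClosed (m + 1) (n + 1)).preimage continuous_ten
  comp_mem_left a b hb := by
    rw [Submodule.mem_comap, T.ten_comp]
    exact K.comp_mem_left _ hb
  comp_mem_right b ha := by
    rw [Submodule.mem_comap, T.ten_comp]
    exact K.comp_mem_right _ ha

/-- The ideal `J(K) = ⊗1⁻¹(K) ∩ K`. -/
def tenCore (K : T.ClosedIdeal) : T.ClosedIdeal := K.tenPreimage ⊓ K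

/-- `N` is invariant if `N ⊗ 1 ⊆ N`. -/
def IsInvariant (N : T.ClosedIdeal) : Prop :=
  ∀ (m n : ℕ), ∀ a ∈ N.carrier m n, T.ten a ∈ N.carrier (m + 1) (n + 1)

/-- `N` is `J`-saturated if `J ∩ ⊗1⁻¹(N) ⊆ N`. -/
def IsSaturated (J N : T.ClosedIdeal) : Prop := J ⊓ N.tenPreimage ≤ N

/-- The `J`-saturation of `N`: the smallest `J`-saturated ideal containing `N`. -/
def saturation (J N : T.ClosedIdeal) : T.ClosedIdeal where
  carrier m n := ⨅ M : {M : T.ClosedIdeal // N ≤ M ∧ J.IsSaturated M}, M.1.carrier m n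
  isClosed m n := by
    rw [Submodule.coe_iInf]
    exact isClosed_iInter fun M => M.1.isClosed m n
  comp_mem_left a b hb := by
    rw [Submodule.mem_iInf] at hb ⊢
    exact fun M => M.1.comp_mem_left a (hb M)
  comp_mem_right b ha := by
    rw [Submodule.mem_iInf] at ha ⊢
    exact fun M => M.1.comp_mem_right b (ha M)

theorem le_saturation (J N : T.ClosedIdeal) : N ≤ J.saturation N := by
  intro m n a ha
  exact (Submodule.mem_iInf _).2 fun M => M.2.1 m n ha

theorem saturation_le {J N M : T.ClosedIdeal} (hM : N ≤ M) (hM' : J.IsSaturated M) :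
    J.saturation N ≤ M :=
  fun _ _ _ ha => (Submodule.mem_iInf _).1 ha ⟨M, hM, hM'⟩

theorem isSaturated_saturation (J N : T.ClosedIdeal) : J.IsSaturated (J.saturation N) := by
  intro m n a ha
  exact (Submodule.mem_iInf _).2 fun M =>
    M.2.2 m n ⟨ha.1, saturation_le M.2.1 M.2.2 _ _ ha.2⟩

theorem IsInvariant.saturation {N : T.ClosedIdeal} (hN : N.IsInvariant) (J : T.ClosedIdeal) :
    (J.saturation N).IsInvariant := by
  have h : J.saturation N ≤ J.saturation N ⊓ (J.saturation N).tenPreimage := by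
    refine saturation_le (fun m n a ha => ⟨le_saturation J N m n ha,
      le_saturation J N _ _ (hN m n a ha)⟩) fun m n a ha => ?_
    have h1 : T.ten a ∈ (J.saturation N).carrier (m + 1) (n + 1) := ha.2.1
    exact ⟨isSaturated_saturation J N m n ⟨ha.1, h1⟩, h1⟩
  exact fun m n a ha => (h m n ha).2

theorem inf_le_tenCore {K J N : T.ClosedIdeal} (hJ : J ≤ K.tenCore) (hN : N.IsInvariant) :
    J ⊓ N ≤ (K ⊓ N).tenCore :=
  fun m n a ha => ⟨⟨(hJ m n ha.1).1, hN m n a ha.2⟩, ⟨(hJ m n ha.1).2, ha.2⟩⟩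

end ClosedIdeal

/-! ### Quotients -/

section quotient

variable (N : T.ClosedIdeal)

/-- Composition in the quotient. -/
def quotComp {l m n : ℕ} (x : T.Hom m n ⧸ N.carrier m n) (y : T.Hom l m ⧸ N.carrier l m) :
    T.Hom l n ⧸ N.carrier l n :=
  Quotient.liftOn₂' x y (fun a b => Submodule.Quotient.mk (T.comp a b)) (by
    intro a b a' b' ha hb
    rw [Submodule.quotientRel_def] at ha hb
    rw [Submodule.Quotient.eq]
    have : T.comp a b - T.comp a' b' = T.comp (a - a') b + T.comp a' (b - b') := by
      rw [sub_comp, comp_sub]; abel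
    rw [this]
    exact add_mem (N.comp_mem_right b ha) (N.comp_mem_left a' hb))

/-- The involution of the quotient. -/
def quotAdj {m n : ℕ} (x : T.Hom m n ⧸ N.carrier m n) : T.Hom n m ⧸ N.carrier n m :=
  Quotient.liftOn' x (fun a => Submodule.Quotient.mk (T.adj a)) (by
    intro a a' ha
    rw [Submodule.quotientRel_def] at ha
    rw [Submodule.Quotient.eq, ← adj_sub]
    exact N.adj_mem ha)

theorem exists_comp_sub_le {m n : ℕ} (a : T.Hom m n) {b : T.Hom m n} (hb : b ∈ N.carrier m n)
    {ε : ℝ} (hε : 0 < ε) : ∃ e ∈ N.carrier m m, ‖a - T.comp a e‖ ≤ ‖a - b‖ + ε := by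
  obtain ⟨g, -, h1, h2, -⟩ := exists_cutoff b hε
  refine ⟨_, N.cutoff_mem hb g, ?_⟩
  set e := T.comp (T.comp (T.adj b) b) g
  have : a - T.comp a e = ((a - b) - T.comp (a - b) e) + (b - T.comp b e) := by
    rw [sub_comp]; abel
  rw [this]
  exact (norm_add_le _ _).trans (add_le_add (h2 _) h1)

theorem norm_quotComp_le {l m n : ℕ} (x : T.Hom m n ⧸ N.carrier m n)
    (y : T.Hom l m ⧸ N.carrier l m) : ‖quotComp N x y‖ ≤ ‖x‖ * ‖y‖ := by
  have hlim : Filter.Tendsto (fun ε : ℝ => (‖x‖ + ε) * (‖y‖ + ε)) (nhdsWithin 0 (Set.Ioi 0))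
      (nhds (‖x‖ * ‖y‖)) := by
    have : Continuous (fun ε : ℝ => (‖x‖ + ε) * (‖y‖ + ε)) := by fun_prop
    simpa using (this.tendsto 0).mono_left nhdsWithin_le_nhds
  refine ge_of_tendsto hlim ?_
  filter_upwards [self_mem_nhdsWithin] with ε hε
  obtain ⟨a, rfl, ha⟩ := Submodule.Quotient.norm_mk_lt x hε
  obtain ⟨b, rfl, hb⟩ := Submodule.Quotient.norm_mk_lt y hε
  calc ‖quotComp N (Submodule.Quotient.mk a) (Submodule.Quotient.mk b)‖
      ≤ ‖T.comp a b‖ := Submodule.Quotient.norm_mk_le _ _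
    _ ≤ ‖a‖ * ‖b‖ := T.norm_comp_le a b
    _ ≤ _ := mul_le_mul ha.le hb.le (norm_nonneg _) ((norm_nonneg _).trans ha.le)

theorem norm_quotAdj_le {m n : ℕ} (x : T.Hom m n ⧸ N.carrier m n) : ‖quotAdj N x‖ ≤ ‖x‖ := by
  refine le_of_forall_pos_le_add fun ε hε => ?_
  obtain ⟨a, rfl, ha⟩ := Submodule.Quotient.norm_mk_lt x hε
  exact ((Submodule.Quotient.norm_mk_le _ (T.adj a)).trans (norm_adj a).le).trans ha.le

theorem norm_quotAdj_comp_self {m n : ℕ} (x : T.Hom m n ⧸ N.carrier m n) :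
    ‖quotComp N (quotAdj N x) x‖ = ‖x‖ ^ 2 := by
  refine le_antisymm ?_ ?_
  · refine (norm_quotComp_le N _ _).trans ?_
    rw [pow_two]
    exact mul_le_mul_of_nonneg_right (norm_quotAdj_le N x) (norm_nonneg _)
  · obtain ⟨a, rfl⟩ := Submodule.Quotient.mk_surjective _ x
    refine le_of_forall_pos_le_add fun ε hε => ?_
    have hε2 := half_pos hε
    obtain ⟨z, hz, hz'⟩ := Submodule.Quotient.norm_mk_lt
      (quotComp N (quotAdj N (Submodule.Quotient.mk a)) (Submodule.Quotient.mk a)) hε2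
    have hy : T.comp (T.adj a) a - z ∈ N.carrier m m := by
      rw [← Submodule.Quotient.eq, hz]; rfl
    set y := T.comp (T.adj a) a - z with hydef
    obtain ⟨g, h0, h1, h2, h3⟩ := exists_cutoff y hε2
    have heN := N.cutoff_mem hy g
    set e := T.comp (T.comp (T.adj y) y) g
    have hle : ‖(Submodule.Quotient.mk a : T.Hom m n ⧸ N.carrier m n)‖ ≤ ‖a - T.comp a e‖ := by
      have : (Submodule.Quotient.mk a : T.Hom m n ⧸ N.carrier m n) =
          Submodule.Quotient.mk (a - T.comp a e) := by
        rw [Submodule.Quotient.eq]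
        simpa using N.comp_mem_left a heN
      rw [this]
      exact Submodule.Quotient.norm_mk_le _ _
    have h4 : ‖a - T.comp a e‖ ^ 2 ≤ ‖z‖ + ε / 2 := by
      rw [← T.norm_adj_comp_self]
      have hsplit : T.comp (T.adj (a - T.comp a e)) (a - T.comp a e) =
          ((z - T.comp z e) + (y - T.comp y e)) -
            T.comp e ((z - T.comp z e) + (y - T.comp y e)) := by
        rw [adj_sub, T.adj_comp, h0, hydef]
        simp only [comp_sub, sub_comp, T.comp_add, T.comp_assoc]
        abel
      rw [hsplit]
      exact (h3 _).trans ((norm_add_le _ _).trans (add_le_add (h2 z) h1))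
    calc _ ≤ ‖a - T.comp a e‖ ^ 2 := by gcongr
      _ ≤ ‖z‖ + ε / 2 := h4
      _ ≤ _ := by linarith

/-- The quotient `T / N` by an invariant ideal, with `(a + N) ⊗ 1 = a ⊗ 1 + N`. -/
def quotient (hN : N.IsInvariant) : RightTensorCStarPrecategory.{u} where
  Hom m n := T.Hom m n ⧸ N.carrier m n
  normedAddCommGroup m n :=
    Submodule.Quotient.normedAddCommGroup (N.carrier m n) (hS := N.isClosed m n)
  normedSpace m n := Submodule.Quotient.normedSpace (N.carrier m n) ℂ
  completeSpace m n := Submodule.Quotient.completeSpace (N.carrier m n)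
  comp x y := quotComp N x y
  comp_assoc := by
    rintro _ _ _ _ ⟨a⟩ ⟨b⟩ ⟨c⟩
    exact congrArg Submodule.Quotient.mk (T.comp_assoc a b c)
  add_comp := by
    rintro _ _ _ ⟨a⟩ ⟨b⟩ ⟨c⟩
    exact congrArg Submodule.Quotient.mk (T.add_comp a b c)
  comp_add := by
    rintro _ _ _ ⟨a⟩ ⟨b⟩ ⟨c⟩
    exact congrArg Submodule.Quotient.mk (T.comp_add a b c)
  smul_comp := by
    rintro _ _ _ z ⟨a⟩ ⟨b⟩
    exact congrArg Submodule.Quotient.mk (T.smul_comp z a b)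
  comp_smul := by
    rintro _ _ _ z ⟨a⟩ ⟨b⟩
    exact congrArg Submodule.Quotient.mk (T.comp_smul z a b)
  norm_comp_le x y := norm_quotComp_le N x y
  adj x := quotAdj N x
  adj_adj := by
    rintro _ _ ⟨a⟩
    exact congrArg Submodule.Quotient.mk (T.adj_adj a)
  adj_add := by
    rintro _ _ ⟨a⟩ ⟨b⟩
    exact congrArg Submodule.Quotient.mk (T.adj_add a b)
  adj_smul := by
    rintro _ _ z ⟨a⟩
    exact congrArg Submodule.Quotient.mk (T.adj_smul z a)
  adj_comp := by
    rintro _ _ _ ⟨a⟩ ⟨b⟩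
    exact congrArg Submodule.Quotient.mk (T.adj_comp a b)
  norm_adj_comp_self x := norm_quotAdj_comp_self N x
  adj_comp_self_pos := by
    rintro _ _ ⟨a⟩
    obtain ⟨b, hb⟩ := T.adj_comp_self_pos a
    exact ⟨Submodule.Quotient.mk b, congrArg Submodule.Quotient.mk hb⟩
  ten {m n} := Submodule.mapQ (N.carrier m n) (N.carrier (m + 1) (n + 1)) T.ten (hN m n)
  ten_comp := by
    rintro _ _ _ ⟨a⟩ ⟨b⟩
    exact congrArg Submodule.Quotient.mk (T.ten_comp a b)
  ten_adj := by
    rintro _ _ ⟨a⟩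
    exact congrArg Submodule.Quotient.mk (T.ten_adj a)

variable {N}

/-- The quotient map `T → T / N` on arrows. -/
def quotMk (hN : N.IsInvariant) {m n : ℕ} (a : T.Hom m n) : (quotient N hN).Hom m n :=
  Submodule.Quotient.mk (p := N.carrier m n) a

theorem isClosed_map_mkQ (N K : T.ClosedIdeal) (m n : ℕ) :
    IsClosed ((K.carrier m n).map (N.carrier m n).mkQ : Set (T.Hom m n ⧸ N.carrier m n)) := by
  have := N.isClosed m n
  let P : Submodule ℂ (K.carrier m n) := (N.carrier m n).comap (K.carrier m n).subtype
  have : CompleteSpace (K.carrier m n) := (K.isClosed m n).completeSpace_coe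
  have hP : IsClosed (P : Set (K.carrier m n)) :=
    (N.isClosed m n).preimage continuous_subtype_val
  let f : (K.carrier m n ⧸ P) →ₗ[ℂ] (T.Hom m n ⧸ N.carrier m n) :=
    P.mapQ (N.carrier m n) (K.carrier m n).subtype le_rfl
  have hf : ∀ x, ‖f x‖ = ‖x‖ := by
    intro x
    obtain ⟨a, rfl⟩ := Submodule.Quotient.mk_surjective _ x
    refine le_antisymm ?_ ?_
    · refine le_of_forall_pos_le_add fun ε hε => ?_
      obtain ⟨b, hb, hb'⟩ := Submodule.Quotient.norm_mk_lt (Submodule.Quotient.mk a : _ ⧸ P) hε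
      rw [← hb] at hb' ⊢
      exact (Submodule.Quotient.norm_mk_le _ (b : T.Hom m n)).trans hb'.le
    · refine le_of_forall_pos_le_add fun ε hε => ?_
      have hε2 := half_pos hε
      obtain ⟨c, hc, hc'⟩ := Submodule.Quotient.norm_mk_lt (f (Submodule.Quotient.mk a)) hε2
      have hac : (a : T.Hom m n) - c ∈ N.carrier m n := by
        rw [← Submodule.Quotient.eq, hc]; rfl
      obtain ⟨e, he, hle⟩ := exists_comp_sub_le N (a : T.Hom m n) hac hε2
      have hmem : (a : T.Hom m n) - T.comp (a : T.Hom m n) e ∈ K.carrier m n :=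
        sub_mem a.2 (K.comp_mem_right e a.2)
      have heq : (Submodule.Quotient.mk a : _ ⧸ P) = Submodule.Quotient.mk ⟨_, hmem⟩ := by
        rw [Submodule.Quotient.eq]
        change (a : T.Hom m n) - (a - T.comp (a : T.Hom m n) e) ∈ N.carrier m n
        rw [sub_sub_cancel]
        exact N.comp_mem_left _ he
      rw [heq]
      refine (Submodule.Quotient.norm_mk_le P _).trans ?_
      rw [sub_sub_cancel] at hle
      change ‖(a : T.Hom m n) - T.comp (a : T.Hom m n) e‖ ≤ _
      rw [← heq]
      linarith
  have hcl : IsClosed (Set.range f) :=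
    (AddMonoidHomClass.isometry_of_norm f hf).isClosedEmbedding.isClosed_range
  convert hcl using 1
  ext x
  constructor
  · rintro ⟨a, ha, rfl⟩
    exact ⟨Submodule.Quotient.mk ⟨a, ha⟩, rfl⟩
  · rintro ⟨y, rfl⟩
    obtain ⟨a, rfl⟩ := Submodule.Quotient.mk_surjective _ y
    exact ⟨a, a.2, rfl⟩

/-- The ideal `K / N` of `T / N`: the image of `K` under the quotient map. -/
def ClosedIdeal.quot (K : T.ClosedIdeal) {N : T.ClosedIdeal} (hN : N.IsInvariant) :
    (quotient N hN).ClosedIdeal where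
  carrier m n := (K.carrier m n).map (N.carrier m n).mkQ
  isClosed m n := isClosed_map_mkQ N K m n
  comp_mem_left := by
    rintro _ _ _ ⟨a⟩ _ ⟨b, hb, rfl⟩
    exact ⟨T.comp a b, K.comp_mem_left a hb, rfl⟩
  comp_mem_right := by
    rintro _ _ _ _ ⟨b⟩ ⟨a, ha, rfl⟩
    exact ⟨T.comp a b, K.comp_mem_right b ha, rfl⟩

theorem ClosedIdeal.quot_le_tenCore (hN : N.IsInvariant) {K J : T.ClosedIdeal}
    (hJ : J ≤ K.tenCore) : J.quot hN ≤ (K.quot hN).tenCore := by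
  rintro m n _ ⟨a, ha, rfl⟩
  exact ⟨⟨T.ten a, (hJ m n ha).1, rfl⟩, ⟨a, (hJ m n ha).2, rfl⟩⟩

theorem ClosedIdeal.quotMk_mem_quot (hN : N.IsInvariant) {K : T.ClosedIdeal} {m n : ℕ}
    {a : T.Hom m n} (ha : a ∈ K.carrier m n) : quotMk hN a ∈ (K.quot hN).carrier m n :=
  ⟨a, ha, rfl⟩

end quotient

/-! ### Right tensor representations -/

/-- A right tensor representation of the ideal `K` in the `C*`-algebra `B`: a representation of the
`C*`-precategory `K` with `π(a) π(b) = π((a ⊗ 1^k) b)` for `a : m → n`, `b : l → m + k` in `K`. -/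
structure TensorRep (K : T.ClosedIdeal) (B : Type u) [NonUnitalCStarAlgebra B] where
  toFun : ∀ m n : ℕ, K.carrier m n →ₗ[ℂ] B
  map_adj : ∀ {m n : ℕ} (a : K.carrier m n),
    toFun n m ⟨T.adj (a : T.Hom m n), K.adj_mem a.2⟩ = star (toFun m n a)
  map_comp : ∀ {l m n : ℕ} (a : K.carrier m n) (b : K.carrier l m),
    toFun l n ⟨T.comp (a : T.Hom m n) (b : T.Hom l m), K.comp_mem_left (a : T.Hom m n) b.2⟩ = toFun m n a * toFun l m b
  map_tenPow_comp : ∀ {l m n k : ℕ} (a : K.carrier m n) (b : K.carrier l (m + k)),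
    toFun m n a * toFun l (m + k) b =
      toFun l (n + k)
        ⟨T.comp (T.tenPow k (a : T.Hom m n)) (b : T.Hom l (m + k)),
          K.comp_mem_left (T.tenPow k (a : T.Hom m n)) b.2⟩

namespace TensorRep

variable {K : T.ClosedIdeal} {B : Type u} [NonUnitalCStarAlgebra B]

/-- `π` is coisometric on the ideal `J ⊆ J(K)` if `π(a) = π(a ⊗ 1)` for all `a` in `J`. -/
def IsCoisometric (π : TensorRep K B) {J : T.ClosedIdeal} (hJ : J ≤ K.tenCore) : Prop :=
  ∀ (m n : ℕ) (a : T.Hom m n) (ha : a ∈ J.carrier m n),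
    π.toFun m n ⟨a, (hJ m n ha).2⟩ = π.toFun (m + 1) (n + 1) ⟨T.ten a, (hJ m n ha).1⟩

/-- The `C*`-algebra `K(m, m)`. -/
def diagSub (K : T.ClosedIdeal) (m : ℕ) : NonUnitalStarSubalgebra ℂ (T.Diag m) where
  carrier := (K.carrier m m : Set (T.Hom m m))
  add_mem' := (K.carrier m m).add_mem
  zero_mem' := (K.carrier m m).zero_mem
  smul_mem' z _ ha := (K.carrier m m).smul_mem z ha
  mul_mem' {a _} _ hb := K.comp_mem_left (show T.Hom m m from a) hb
  star_mem' ha := K.adj_mem ha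

/-- The `*`-homomorphism `π : K(m, m) → B`. -/
def diagHom (π : TensorRep K B) (m : ℕ) : diagSub K m →⋆ₙₐ[ℂ] B where
  toFun a := π.toFun m m ⟨a.1, a.2⟩
  map_smul' z a := map_smul (π.toFun m m) z ⟨a.1, a.2⟩
  map_zero' := map_zero (π.toFun m m)
  map_add' a b := map_add (π.toFun m m) ⟨a.1, a.2⟩ ⟨b.1, b.2⟩
  map_mul' a b := π.map_comp (m := m) (n := m) (l := m) ⟨a.1, a.2⟩ ⟨b.1, b.2⟩
  map_star' a := π.map_adj (m := m) (n := m) ⟨a.1, a.2⟩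

theorem norm_toFun_le (π : TensorRep K B) {m n : ℕ} (a : K.carrier m n) :
    ‖π.toFun m n a‖ ≤ ‖a‖ := by
  have : IsClosed (diagSub K m : Set (T.Diag m)) := K.isClosed m m
  have hmem : T.comp (T.adj (a : T.Hom m n)) a ∈ K.carrier m m := K.comp_mem_left _ a.2
  have h : ‖π.toFun m m ⟨_, hmem⟩‖ ≤ ‖T.comp (T.adj (a : T.Hom m n)) (a : T.Hom m n)‖ :=
    NonUnitalStarAlgHom.norm_apply_le (π.diagHom m) (⟨show T.Diag m from _, hmem⟩ : diagSub K m)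
  have h2 : π.toFun m m ⟨_, hmem⟩ = star (π.toFun m n a) * π.toFun m n a := by
    rw [← π.map_adj, ← π.map_comp]
  rw [h2, CStarRing.norm_star_mul_self, T.norm_adj_comp_self, ← pow_two] at h
  exact (sq_le_sq₀ (norm_nonneg _) (norm_nonneg _)).1 h

/-- Formal polynomials in the elements of `K`. -/
abbrev Poly (K : T.ClosedIdeal) : Type u :=
  FreeNonUnitalNonAssocAlgebra ℂ (Σ p : ℕ × ℕ, K.carrier p.1 p.2)

/-- Evaluation of formal polynomials in a representation. -/
def eval (π : TensorRep K B) : Poly K →ₙₐ[ℂ] B :=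
  FreeNonUnitalNonAssocAlgebra.lift ℂ (fun g => π.toFun g.1.1 g.1.2 g.2)

theorem eval_of (π : TensorRep K B) (g : Σ p : ℕ × ℕ, K.carrier p.1 p.2) :
    π.eval (FreeNonUnitalNonAssocAlgebra.of ℂ g) = π.toFun g.1.1 g.1.2 g.2 :=
  FreeNonUnitalNonAssocAlgebra.lift_of_apply ℂ _ g

end TensorRep

/-! ### The universal algebra

`OAlg K J hJ` is the `C*`-algebra generated by the direct sum of all right tensor representations of
`K` which are coisometric on `J`. So that the sum is indexed by a set, one representation is taken
for each function `p` which arises as the norm of polynomials in the elements of `K` evaluated in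
some such representation. -/

section universal

variable (K J : T.ClosedIdeal) (hJ : J ≤ K.tenCore)

/-- The index set of the direct sum. -/
def RepIndex : Type u :=
  {p : TensorRep.Poly K → ℝ // ∃ (B : Type u) (_ : NonUnitalCStarAlgebra B) (π : TensorRep K B),
    π.IsCoisometric hJ ∧ ∀ x, ‖π.eval x‖ = p x}

variable {K J hJ}

/-- The `C*`-algebra of the chosen representation. -/
def RepIndex.Alg (i : RepIndex K J hJ) : Type u := i.2.choose

instance (i : RepIndex K J hJ) : NonUnitalCStarAlgebra i.Alg := i.2.choose_spec.choose

/-- The chosen representation. -/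
def RepIndex.rep (i : RepIndex K J hJ) : TensorRep K i.Alg := i.2.choose_spec.choose_spec.choose

theorem RepIndex.rep_isCoisometric (i : RepIndex K J hJ) : i.rep.IsCoisometric hJ :=
  i.2.choose_spec.choose_spec.choose_spec.1

theorem RepIndex.norm_eval (i : RepIndex K J hJ) (x : TensorRep.Poly K) :
    ‖i.rep.eval x‖ = i.1 x :=
  i.2.choose_spec.choose_spec.choose_spec.2 x

variable (K J hJ)

open scoped ENNReal in
/-- The direct sum of all right tensor representations of `K` coisometric on `J`. -/
def sumRep : TensorRep K (lp (fun i : RepIndex K J hJ => i.Alg) ∞) where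
  toFun m n :=
    { toFun := fun a => ⟨fun i => i.rep.toFun m n a,
        memℓp_infty ⟨‖a‖, by rintro _ ⟨i, rfl⟩; exact i.rep.norm_toFun_le a⟩⟩
      map_add' := fun a b => by ext i; exact map_add (i.rep.toFun m n) a b
      map_smul' := fun z a => by ext i; exact map_smul (i.rep.toFun m n) z a }
  map_adj a := by ext i; exact i.rep.map_adj a
  map_comp a b := by ext i; exact i.rep.map_comp a b
  map_tenPow_comp a b := by ext i; exact i.rep.map_tenPow_comp a b

open scoped ENNReal in
/-- The `C*`-subalgebra generated by the image of the direct sum representation. -/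
def sumAlg : NonUnitalStarSubalgebra ℂ (lp (fun i : RepIndex K J hJ => i.Alg) ∞) :=
  (NonUnitalStarAlgebra.adjoin ℂ
    {x | ∃ (m n : ℕ) (a : K.carrier m n), (sumRep K J hJ).toFun m n a = x}).topologicalClosure

/-- The `C*`-algebra `𝒪_T(K, J)`. -/
def OAlg : Type u := sumAlg K J hJ

instance : NonUnitalCStarAlgebra (OAlg K J hJ) :=
  NonUnitalStarSubalgebra.nonUnitalCStarAlgebra (sumAlg K J hJ)
    (h_closed := NonUnitalStarSubalgebra.isClosed_topologicalClosure _)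

theorem sumRep_mem (m n : ℕ) (a : K.carrier m n) :
    (sumRep K J hJ).toFun m n a ∈ sumAlg K J hJ :=
  NonUnitalStarSubalgebra.le_topologicalClosure _
    (NonUnitalStarAlgebra.subset_adjoin ℂ _ ⟨m, n, a, rfl⟩)

/-- The universal representation of `K` in `𝒪_T(K, J)`. -/
def univRep : TensorRep K (OAlg K J hJ) where
  toFun m n := (sumRep K J hJ).toFun m n |>.codRestrict
    (sumAlg K J hJ).toNonUnitalSubalgebra.toSubmodule (sumRep_mem K J hJ m n)
  map_adj a := Subtype.ext ((sumRep K J hJ).map_adj a)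
  map_comp a b := Subtype.ext ((sumRep K J hJ).map_comp a b)
  map_tenPow_comp a b := Subtype.ext ((sumRep K J hJ).map_tenPow_comp a b)

theorem univRep_isCoisometric : (univRep K J hJ).IsCoisometric hJ := by
  intro m n a ha
  refine Subtype.ext ?_
  ext i
  exact i.rep_isCoisometric m n a ha

theorem norm_eval_le {B : Type u} [NonUnitalCStarAlgebra B] (π : TensorRep K B)
    (hπ : π.IsCoisometric hJ) (x : TensorRep.Poly K) :
    ‖π.eval x‖ ≤ ‖(univRep K J hJ).eval x‖ := by
  let i : RepIndex K J hJ := ⟨fun x => ‖π.eval x‖, B, inferInstance, π, hπ, fun _ => rfl⟩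
  have h1 : ‖i.rep.eval x‖ = ‖π.eval x‖ := i.norm_eval x
  let ev : OAlg K J hJ →ₙₐ[ℂ] i.Alg :=
    { toFun := fun y => y.1 i
      map_smul' := fun _ _ => rfl
      map_zero' := rfl
      map_add' := fun _ _ => rfl
      map_mul' := fun _ _ => rfl }
  have h2 : ev.comp (univRep K J hJ).eval = i.rep.eval := by
    refine FreeNonUnitalNonAssocAlgebra.hom_ext ℂ fun g => ?_
    rw [NonUnitalAlgHom.comp_apply, TensorRep.eval_of, TensorRep.eval_of]
    rfl
  have h3 : ev ((univRep K J hJ).eval x) = i.rep.eval x := DFunLike.congr_fun h2 x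
  rw [← h1, ← h3]
  exact lp.norm_apply_le_norm ENNReal.top_ne_zero ((univRep K J hJ).eval x).1 i

/-- The image of the universal representation. -/
def univImage : Set (OAlg K J hJ) :=
  {x | ∃ (m n : ℕ) (a : K.carrier m n), (univRep K J hJ).toFun m n a = x}

theorem eval_mem_adjoin (x : TensorRep.Poly K) :
    (univRep K J hJ).eval x ∈ NonUnitalAlgebra.adjoin ℂ (univImage K J hJ) := by
  let f : TensorRep.Poly K →ₙₐ[ℂ] NonUnitalAlgebra.adjoin ℂ (univImage K J hJ) :=
    FreeNonUnitalNonAssocAlgebra.lift ℂ (fun g =>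
      ⟨(univRep K J hJ).toFun g.1.1 g.1.2 g.2,
        NonUnitalAlgebra.subset_adjoin ℂ ⟨g.1.1, g.1.2, g.2, rfl⟩⟩)
  have : (NonUnitalSubalgebraClass.subtype _).comp f = (univRep K J hJ).eval := by
    refine FreeNonUnitalNonAssocAlgebra.hom_ext ℂ fun g => ?_
    rw [NonUnitalAlgHom.comp_apply, TensorRep.eval_of]
    exact congrArg Subtype.val (FreeNonUnitalNonAssocAlgebra.lift_of_apply ℂ _ g)
  rw [← this]
  exact (f x).2

theorem denseRange_eval : DenseRange (univRep K J hJ).eval := by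
  let S := {x | ∃ (m n : ℕ) (a : K.carrier m n), (sumRep K J hJ).toFun m n a = x}
  let ι : OAlg K J hJ →ₙₐ[ℂ] lp (fun i : RepIndex K J hJ => i.Alg) ⊤ :=
    { toFun := fun y => y.1
      map_smul' := fun _ _ => rfl
      map_zero' := rfl
      map_add' := fun _ _ => rfl
      map_mul' := fun _ _ => rfl }
  have h1 : ι.comp (univRep K J hJ).eval = (sumRep K J hJ).eval := by
    refine FreeNonUnitalNonAssocAlgebra.hom_ext ℂ fun g => ?_
    rw [NonUnitalAlgHom.comp_apply, TensorRep.eval_of, TensorRep.eval_of]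
    rfl
  have hstar : star S ⊆ S := by
    rintro x ⟨m, n, a, ha⟩
    refine ⟨n, m, ⟨T.adj (a : T.Hom m n), K.adj_mem a.2⟩, ?_⟩
    rw [(sumRep K J hJ).map_adj, ha, star_star]
  have h3 : ∀ y ∈ NonUnitalStarAlgebra.adjoin ℂ S, ∃ x, (sumRep K J hJ).eval x = y := by
    intro y hy
    have hy' : y ∈ NonUnitalAlgebra.adjoin ℂ (S ∪ star S) := hy
    rw [Set.union_eq_self_of_subset_right hstar] at hy'
    have hle : NonUnitalAlgebra.adjoin ℂ S ≤ NonUnitalAlgHom.range (sumRep K J hJ).eval := by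
      rw [NonUnitalAlgebra.adjoin_le_iff]
      rintro _ ⟨m, n, a, rfl⟩
      exact ⟨FreeNonUnitalNonAssocAlgebra.of ℂ ⟨(m, n), a⟩, TensorRep.eval_of _ _⟩
    exact hle hy'
  intro y
  rw [Metric.mem_closure_iff]
  intro ε hε
  have hy : (y.1 : lp (fun i : RepIndex K J hJ => i.Alg) ⊤) ∈
      closure (NonUnitalStarAlgebra.adjoin ℂ S : Set _) := y.2
  obtain ⟨z, hz, hz'⟩ := Metric.mem_closure_iff.1 hy ε hε
  obtain ⟨x, rfl⟩ := h3 z hz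
  refine ⟨_, ⟨x, rfl⟩, ?_⟩
  rw [← h1] at hz'
  exact hz'

/-- The universal property of `𝒪_T(K, J)`. -/
theorem existsUnique_lift {B : Type u} [NonUnitalCStarAlgebra B] (π : TensorRep K B)
    (hπ : π.IsCoisometric hJ) :
    ∃! Ψ : OAlg K J hJ →⋆ₙₐ[ℂ] B, ∀ (m n : ℕ) (a : K.carrier m n),
      Ψ ((univRep K J hJ).toFun m n a) = π.toFun m n a := by
  let e := (univRep K J hJ).eval
  have hd : DenseRange e := denseRange_eval K J hJ
  let L : OAlg K J hJ →L[ℂ] B :=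
    (π.eval : TensorRep.Poly K →ₗ[ℂ] B).extendOfNorm (e : TensorRep.Poly K →ₗ[ℂ] OAlg K J hJ)
  have hL : ∀ x, L (e x) = π.eval x := fun x =>
    LinearMap.extendOfNorm_eq (f := (π.eval : TensorRep.Poly K →ₗ[ℂ] B))
      (e := (e : TensorRep.Poly K →ₗ[ℂ] OAlg K J hJ)) hd
      ⟨1, fun x => by rw [one_mul]; exact norm_eval_le K J hJ π hπ x⟩ x
  have hgen : ∀ (m n : ℕ) (a : K.carrier m n),
      L ((univRep K J hJ).toFun m n a) = π.toFun m n a := by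
    intro m n a
    have := hL (FreeNonUnitalNonAssocAlgebra.of ℂ ⟨(m, n), a⟩)
    rw [TensorRep.eval_of, TensorRep.eval_of] at this
    exact this
  have hmul : ∀ x y, L (x * y) = L x * L y := by
    intro x y
    refine hd.induction_on₂ (p := fun x y => L (x * y) = L x * L y) ?_ ?_ x y
    · exact isClosed_eq (by fun_prop) (by fun_prop)
    · intro p q
      rw [← map_mul, hL, hL, hL, map_mul]
  have hstar' : ∀ z ∈ NonUnitalAlgebra.adjoin ℂ (univImage K J hJ), L (star z) = star (L z) := by
    intro z hz
    induction hz using NonUnitalAlgebra.adjoin_induction with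
    | mem z hz =>
      obtain ⟨m, n, a, rfl⟩ := hz
      rw [← (univRep K J hJ).map_adj, hgen, hgen, π.map_adj]
    | zero => simp
    | add x y _ _ hx hy => simp [hx, hy]
    | mul x y _ _ hx hy => rw [star_mul, hmul, hmul, star_mul, hx, hy]
    | smul r x _ hx => simp [hx]
  have hstar : ∀ z, L (star z) = star (L z) := by
    intro z
    refine hd.induction_on (p := fun z => L (star z) = star (L z)) z ?_ ?_
    · exact isClosed_eq (by fun_prop) (by fun_prop)
    · exact fun p => hstar' _ (eval_mem_adjoin K J hJ p)
  refine ⟨{ toFun := L, map_smul' := map_smul L, map_zero' := map_zero L, map_add' := map_add L,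
            map_mul' := hmul, map_star' := hstar }, hgen, ?_⟩
  intro Ψ hΨ
  have h1 : (Ψ : OAlg K J hJ →ₙₐ[ℂ] B).comp (univRep K J hJ).eval = π.eval := by
    refine FreeNonUnitalNonAssocAlgebra.hom_ext ℂ fun g => ?_
    rw [NonUnitalAlgHom.comp_apply, TensorRep.eval_of, TensorRep.eval_of]
    exact hΨ g.1.1 g.1.2 g.2
  have hc : Continuous Ψ :=
    AddMonoidHomClass.continuous_of_bound Ψ 1
      (fun x => by rw [one_mul]; exact NonUnitalStarAlgHom.norm_apply_le Ψ x)
  ext z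
  refine hd.induction_on (p := fun z => Ψ z = L z) z ?_ ?_
  · exact isClosed_eq hc L.continuous
  · intro p
    rw [hL, ← h1]
    rfl

/-- The closed linear span `𝒪(N)` in `𝒪_T(K, J)` of the image of `K ∩ N`. -/
def idealSpan (N : T.ClosedIdeal) : Submodule ℂ (OAlg K J hJ) :=
  (Submodule.span ℂ {x | ∃ (m n : ℕ) (a : T.Hom m n) (ha : a ∈ (K ⊓ N).carrier m n),
    (univRep K J hJ).toFun m n ⟨a, ha.1⟩ = x}).topologicalClosure

variable {K J hJ}

/-- The closed subspace `I` of `𝒪_T(K, J)` is a `C*`-algebra naturally isomorphic to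
`𝒪_T(K ∩ M, J ∩ M)`: the isomorphism `Φ` is an isometric `*`-isomorphism onto `I` which sends
generators to generators. -/
def IsNaturallyIsoInf (I : Submodule ℂ (OAlg K J hJ)) {M : T.ClosedIdeal}
    (hM : M.IsInvariant) : Prop :=
  ∃ Φ : OAlg (K ⊓ M) (J ⊓ M) (ClosedIdeal.inf_le_tenCore hJ hM) ≃ₗᵢ[ℂ] I,
    (∀ x y, (Φ (x * y) : OAlg K J hJ) = Φ x * Φ y) ∧
    (∀ x, (Φ (star x) : OAlg K J hJ) = star (Φ x : OAlg K J hJ)) ∧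
    ∀ (m n : ℕ) (a : T.Hom m n) (ha : a ∈ (K ⊓ M).carrier m n),
      (Φ ((univRep (K ⊓ M) (J ⊓ M) (ClosedIdeal.inf_le_tenCore hJ hM)).toFun m n ⟨a, ha⟩) :
        OAlg K J hJ) = (univRep K J hJ).toFun m n ⟨a, ha.1⟩

/-- The quotient `𝒪_T(K, J) / I` is naturally isomorphic to `𝒪_{T/M}(K/M, J/M)`: the isomorphism
`Φ` is isometric, respects the product `[x] [y] = [x y]` and the involution `[x]* = [x*]`, and sends
the class of the generator given by `a` to the generator given by `a + M`. -/
def IsNaturallyIsoQuot (I : Submodule ℂ (OAlg K J hJ)) {M : T.ClosedIdeal}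
    (hM : M.IsInvariant) : Prop :=
  ∃ Φ : (OAlg K J hJ ⧸ I) ≃ₗᵢ[ℂ]
      OAlg (K.quot hM) (J.quot hM) (ClosedIdeal.quot_le_tenCore hM hJ),
    (∀ x y : OAlg K J hJ, Φ (Submodule.Quotient.mk (x * y)) =
      Φ (Submodule.Quotient.mk x) * Φ (Submodule.Quotient.mk y)) ∧
    (∀ x : OAlg K J hJ, Φ (Submodule.Quotient.mk (star x)) = star (Φ (Submodule.Quotient.mk x))) ∧
    ∀ (m n : ℕ) (a : T.Hom m n) (ha : a ∈ K.carrier m n),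
      Φ (Submodule.Quotient.mk ((univRep K J hJ).toFun m n ⟨a, ha⟩)) =
        (univRep (K.quot hM) (J.quot hM) (ClosedIdeal.quot_le_tenCore hM hJ)).toFun m n
          ⟨quotMk hM a, ClosedIdeal.quotMk_mem_quot hM ha⟩

end universal

end

end RightTensorCStarPrecategory

open RightTensorCStarPrecategory

/-! Write `i` for the universal representation. A product of two generators is again a single
generator: the arrow that is too short is tensored until the two compose. Hence the generators span
a dense subspace, and since `N` is invariant, products with generators from `K ∩ N` stay in `K ∩ N`.
So `𝒪(N)` is an ideal.

The quotient isomorphism compares universal properties. A representation of `K/N` pulls back to one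
of `K` that kills `K ∩ N`, and a representation of `K` that kills `K ∩ N` descends to `K/N`;
coisometry is preserved both ways (`isNaturallyIsoQuot_idealSpan`).

For the ideal, the canonical map `Θ : 𝒪(K ∩ N, J ∩ N) → 𝒪(K, J)` must be injective. Let `σ` be the
universal representation of `K ∩ N`. It extends to a representation of `K` by multipliers, with
`π(a) σ(b) = σ((a ⊗ 1^k) b)` when `b` has the larger target. This extension is coisometric on `J`,
and the homomorphism it induces, composed with `Θ`, is the inclusion of an algebra in its
multipliers. To define `π(a)` on sums of `σ(b)`, the sums are lifted to the Fock algebra `FockAlg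
T`, which is universal for all of `T` with no coisometry. There the images of the arrow spaces are
linearly independent (`IsFockFaithful.exists_linearMap`), so `σ` becomes a linear map `s`; the bound
`‖s(ρ(a) x)‖ ≤ ‖a‖ ‖s x‖` (`norm_arrow_mul_le`) makes `π(a)` well defined and continuous.

For the saturation, one inclusion holds because a coisometric representation that kills `K ∩ N`
kills `K ∩ S_J(N)`: the ideal of all `a` with `a K ⊆ ker π` contains `N` and is `J`-saturated. The
converse is `univRep_injective`, applied in `T/S` with `S = S_J(N)`. Saturation says that `⊗1` is
injective on `J/S`, and then the universal representation is injective. Indeed, an arrow `a` in its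
kernel has `ρ(a)` in the ideal of the Fock algebra generated by all `ρ(b) - ρ(b ⊗ 1)`, `b ∈ J`. The
corners of such elements tend to zero in norm as the degree grows, while those of `ρ(a)` show that
every `a ⊗ 1^k` lies in `J` and so has norm `‖a‖`. Hence `a = 0`. -/

/-- A closed span is a two-sided ideal as soon as it absorbs products of generators. -/
theorem mul_mem_closedSpan {A : Type*} [NonUnitalCStarAlgebra A] {S R : Set A}
    (hS : (Submodule.span ℂ S).topologicalClosure = ⊤)
    (h : ∀ s ∈ S, ∀ r ∈ R, s * r ∈ (Submodule.span ℂ R).topologicalClosure ∧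
      r * s ∈ (Submodule.span ℂ R).topologicalClosure) (x y : A)
    (hy : y ∈ (Submodule.span ℂ R).topologicalClosure) :
    x * y ∈ (Submodule.span ℂ R).topologicalClosure ∧
      y * x ∈ (Submodule.span ℂ R).topologicalClosure := by
  set I := (Submodule.span ℂ R).topologicalClosure with hI
  have hIc : IsClosed (I : Set A) := Submodule.isClosed_topologicalClosure _
  -- Two passes of linearity and continuity: first in `y` with the generator `s` fixed, then in `x`
  -- with `y` fixed.
  have h1 : ∀ s ∈ S, ∀ y ∈ I, s * y ∈ I ∧ y * s ∈ I := by
    intro s hs y hy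
    have hle : I ≤ (I.comap (LinearMap.mulLeft ℂ s) ⊓ I.comap (LinearMap.mulRight ℂ s)) := by
      refine Submodule.topologicalClosure_minimal _ (Submodule.span_le.2 fun r hr => h s hs r hr) ?_
      exact (hIc.preimage (continuous_const_mul s)).inter (hIc.preimage (continuous_mul_const s))
    exact hle hy
  have hle : (Submodule.span ℂ S).topologicalClosure ≤
      (I.comap (LinearMap.mulRight ℂ y) ⊓ I.comap (LinearMap.mulLeft ℂ y)) := by
    refine Submodule.topologicalClosure_minimal _
      (Submodule.span_le.2 fun s hs => h1 s hs y hy) ?_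
    exact (hIc.preimage (continuous_mul_const y)).inter (hIc.preimage (continuous_const_mul y))
  rw [hS] at hle
  exact hle (Submodule.mem_top (x := x))

/-! ### Products of generators, and `𝒪(N)` as an ideal -/

namespace RightTensorCStarPrecategory

variable {T : RightTensorCStarPrecategory.{u}}

theorem adj_tenPow {m n : ℕ} (k : ℕ) (a : T.Hom m n) :
    T.adj (T.tenPow k a) = T.tenPow k (T.adj a) := by
  induction k with
  | zero => rfl
  | succ k ih => exact (T.ten_adj _).symm.trans (congrArg T.ten ih)

theorem norm_tenPow_le {m n : ℕ} (k : ℕ) (a : T.Hom m n) : ‖T.tenPow k a‖ ≤ ‖a‖ := by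
  induction k with
  | zero => exact le_rfl
  | succ k ih => exact (norm_ten_le _).trans ih

/-- Iterated tensoring produces objects such as `m + 1 + k` and `m + (k + 1)`, which are equal but
not by definition. Such arrows are compared by heterogeneous equality. -/
theorem ten_heq {m n m' n' : ℕ} (hm : m = m') (hn : n = n') {a : T.Hom m n} {a' : T.Hom m' n'}
    (h : HEq a a') : HEq (T.ten a) (T.ten a') := by
  subst hm hn
  rw [eq_of_heq h]

theorem tenPow_ten_heq {m n : ℕ} (k : ℕ) (a : T.Hom m n) :
    HEq (T.tenPow k (T.ten a)) (T.tenPow (k + 1) a) := by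
  induction k with
  | zero => rfl
  | succ k ih => exact ten_heq (Nat.add_right_comm m 1 k) (Nat.add_right_comm n 1 k) ih

theorem tenPow_tenPow_heq {m n : ℕ} (j k : ℕ) (a : T.Hom m n) :
    HEq (T.tenPow k (T.tenPow j a)) (T.tenPow (j + k) a) := by
  induction k with
  | zero => rfl
  | succ k ih => exact ten_heq (Nat.add_assoc m j k) (Nat.add_assoc n j k) ih

theorem tenPow_add' {m n : ℕ} (k : ℕ) (a b : T.Hom m n) :
    T.tenPow k (a + b) = T.tenPow k a + T.tenPow k b := by
  induction k with
  | zero => rfl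
  | succ k ih => exact (congrArg T.ten ih).trans (map_add T.ten _ _)

theorem tenPow_smul {m n : ℕ} (k : ℕ) (z : ℂ) (a : T.Hom m n) :
    T.tenPow k (z • a) = z • T.tenPow k a := by
  induction k with
  | zero => rfl
  | succ k ih => exact (congrArg T.ten ih).trans (map_smul T.ten _ _)

theorem tenPow_comp {l m n : ℕ} (k : ℕ) (a : T.Hom m n) (b : T.Hom l m) :
    T.tenPow k (T.comp a b) = T.comp (T.tenPow k a) (T.tenPow k b) := by
  induction k with
  | zero => rfl
  | succ k ih => exact (congrArg T.ten ih).trans (T.ten_comp _ _)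

namespace ClosedIdeal

theorem IsInvariant.tenPow_mem {N : T.ClosedIdeal} (hN : N.IsInvariant) {m n : ℕ} (k : ℕ)
    {a : T.Hom m n} (ha : a ∈ N.carrier m n) : T.tenPow k a ∈ N.carrier (m + k) (n + k) := by
  induction k with
  | zero => exact ha
  | succ k ih => exact hN _ _ _ ih

/-- The pair `⊤`, `⊥` gives the universal algebra of all of `T` with a vacuous coisometry condition;
`⊤` is also the trivial invariant ideal. -/
instance : Top T.ClosedIdeal :=
  ⟨{ carrier := fun _ _ => ⊤
     isClosed := fun _ _ => isClosed_univ
     comp_mem_left := fun _ _ _ => Submodule.mem_top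
     comp_mem_right := fun _ _ => Submodule.mem_top }⟩

instance : Bot T.ClosedIdeal :=
  ⟨{ carrier := fun _ _ => ⊥
     isClosed := fun _ _ => isClosed_singleton
     comp_mem_left := fun a b hb => by
       rw [Submodule.mem_bot] at hb ⊢; rw [hb, comp_zero]
     comp_mem_right := fun b ha => by
       rw [Submodule.mem_bot] at ha ⊢; rw [ha, zero_comp] }⟩

theorem isInvariant_top : (⊤ : T.ClosedIdeal).IsInvariant := fun _ _ _ _ => Submodule.mem_top

theorem bot_le_tenCore (K : T.ClosedIdeal) : ⊥ ≤ K.tenCore := by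
  intro m n a ha
  rw [show a = 0 from (Submodule.mem_bot ℂ).1 ha]
  exact zero_mem _

end ClosedIdeal

namespace TensorRep

variable {K : T.ClosedIdeal} {B C : Type u} [NonUnitalCStarAlgebra B] [NonUnitalCStarAlgebra C]

/-- Composition of a right tensor representation with a `*`-homomorphism. -/
def map (π : TensorRep K B) (f : B →⋆ₙₐ[ℂ] C) : TensorRep K C where
  toFun m n := (f : B →ₗ[ℂ] C) ∘ₗ π.toFun m n
  map_adj a := (congrArg f (π.map_adj a)).trans (map_star f _)
  map_comp a b := (congrArg f (π.map_comp a b)).trans (map_mul f _ _)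
  map_tenPow_comp a b := (map_mul f _ _).symm.trans (congrArg f (π.map_tenPow_comp a b))

/-- Restriction of a right tensor representation to a smaller ideal. -/
def restrict (π : TensorRep K B) {L : T.ClosedIdeal} (h : L ≤ K) : TensorRep L B where
  toFun m n := π.toFun m n ∘ₗ Submodule.inclusion (h m n)
  map_adj a := π.map_adj (Submodule.inclusion (h _ _) a)
  map_comp a b := π.map_comp (Submodule.inclusion (h _ _) a) (Submodule.inclusion (h _ _) b)
  map_tenPow_comp a b :=
    π.map_tenPow_comp (Submodule.inclusion (h _ _) a) (Submodule.inclusion (h _ _) b)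

/-- The adjoint of `map_tenPow_comp`. It covers the products in which the right factor is the one
that must be tensored. -/
theorem map_comp_tenPow (π : TensorRep K B) {l m n k : ℕ} (a : K.carrier (m + k) n)
    (b : K.carrier l m) :
    π.toFun (m + k) n a * π.toFun l m b =
      π.toFun (l + k) n ⟨T.comp (a : T.Hom (m + k) n) (T.tenPow k (b : T.Hom l m)),
        K.comp_mem_right _ a.2⟩ := by
  rw [← star_star (π.toFun (m + k) n a * π.toFun l m b), star_mul, ← π.map_adj, ← π.map_adj,
    π.map_tenPow_comp, ← π.map_adj]
  refine congrArg _ (Subtype.ext ?_)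
  change T.adj (T.comp (T.tenPow k (T.adj (b : T.Hom l m))) (T.adj (a : T.Hom (m + k) n))) = _
  rw [T.adj_comp, T.adj_adj, adj_tenPow, T.adj_adj]

/-- Tensor whichever factor is too short. Invariance of `N` is needed exactly when that factor is
the one known to lie in `N`. -/
theorem exists_toFun_mul (π : TensorRep K B) {N : T.ClosedIdeal} (hN : N.IsInvariant)
    {l m n p : ℕ} (a : K.carrier m n) (b : K.carrier l p)
    (h : (a : T.Hom m n) ∈ N.carrier m n ∨ (b : T.Hom l p) ∈ N.carrier l p) :
    ∃ (q r : ℕ) (c : T.Hom q r) (hc : c ∈ (K ⊓ N).carrier q r),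
      π.toFun m n a * π.toFun l p b = π.toFun q r ⟨c, hc.1⟩ := by
  rcases le_total m p with hmp | hmp
  · obtain ⟨k, rfl⟩ := Nat.exists_eq_add_of_le hmp
    refine ⟨_, _, T.comp (T.tenPow k (a : T.Hom m n)) (b : T.Hom l (m + k)),
      ⟨K.comp_mem_left _ b.2, ?_⟩, π.map_tenPow_comp a b⟩
    exact h.elim (fun h => N.comp_mem_right _ (hN.tenPow_mem k h)) (fun h => N.comp_mem_left _ h)
  · obtain ⟨k, rfl⟩ := Nat.exists_eq_add_of_le hmp
    refine ⟨_, _, T.comp (a : T.Hom (p + k) n) (T.tenPow k (b : T.Hom l p)),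
      ⟨K.comp_mem_right _ a.2, ?_⟩, π.map_comp_tenPow a b⟩
    exact h.elim (fun h => N.comp_mem_right _ h) (fun h => N.comp_mem_left _ (hN.tenPow_mem k h))

end TensorRep

section universal

variable {K J : T.ClosedIdeal} {hJ : J ≤ K.tenCore}

theorem OAlg.hom_ext {B : Type u} [NonUnitalCStarAlgebra B] {f g : OAlg K J hJ →⋆ₙₐ[ℂ] B}
    (h : ∀ (m n : ℕ) (a : K.carrier m n),
      f ((univRep K J hJ).toFun m n a) = g ((univRep K J hJ).toFun m n a)) : f = g := by
  have hc : ((univRep K J hJ).map g).IsCoisometric hJ := fun m n a ha =>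
    congrArg g (univRep_isCoisometric K J hJ m n a ha)
  exact (existsUnique_lift K J hJ _ hc).unique h fun _ _ _ => rfl

theorem exists_lift {B : Type u} [NonUnitalCStarAlgebra B] (π : TensorRep K B)
    (hπ : π.IsCoisometric hJ) :
    ∃ Ψ : OAlg K J hJ →⋆ₙₐ[ℂ] B, ∀ (m n : ℕ) (a : K.carrier m n),
      Ψ ((univRep K J hJ).toFun m n a) = π.toFun m n a :=
  (existsUnique_lift K J hJ π hπ).exists

variable (K J hJ)

/-- The generators are closed under multiplication, so their span is already the algebra they
generate, which contains the dense range of `eval`. -/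
theorem span_univImage_topologicalClosure :
    (Submodule.span ℂ (univImage K J hJ)).topologicalClosure = ⊤ := by
  have hmul : ∀ x ∈ Submodule.span ℂ (univImage K J hJ), ∀ y ∈ Submodule.span ℂ (univImage K J hJ),
      x * y ∈ Submodule.span ℂ (univImage K J hJ) := by
    intro x hx y hy
    induction hx, hy using Submodule.span_induction₂ with
    | mem_mem x y hx hy =>
      obtain ⟨m, n, a, rfl⟩ := hx
      obtain ⟨l, p, b, rfl⟩ := hy
      obtain ⟨q, r, c, hc, h⟩ := (univRep K J hJ).exists_toFun_mul ClosedIdeal.isInvariant_top a b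
        (Or.inl Submodule.mem_top)
      exact Submodule.subset_span ⟨q, r, ⟨c, hc.1⟩, h.symm⟩
    | zero_left y hy => rw [zero_mul]; exact zero_mem _
    | zero_right x hx => rw [mul_zero]; exact zero_mem _
    | add_left x y z _ _ _ hx hy => rw [add_mul]; exact add_mem hx hy
    | add_right x y z _ _ _ hx hy => rw [mul_add]; exact add_mem hx hy
    | smul_left r x y _ _ h => rw [smul_mul_assoc]; exact Submodule.smul_mem _ r h
    | smul_right r x y _ _ h => rw [mul_smul_comm]; exact Submodule.smul_mem _ r h
  have hle : ∀ x ∈ NonUnitalAlgebra.adjoin ℂ (univImage K J hJ),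
      x ∈ Submodule.span ℂ (univImage K J hJ) := by
    intro x hx
    induction hx using NonUnitalAlgebra.adjoin_induction with
    | mem x hx => exact Submodule.subset_span hx
    | zero => exact zero_mem _
    | add x y _ _ hx hy => exact add_mem hx hy
    | mul x y _ _ hx hy => exact hmul x hx y hy
    | smul r x _ hx => exact Submodule.smul_mem _ r hx
  refine (Submodule.eq_top_iff').2 fun x => ?_
  refine closure_mono ?_ (denseRange_eval K J hJ x)
  rintro _ ⟨p, rfl⟩
  exact hle _ (eval_mem_adjoin K J hJ p)

theorem mul_mem_idealSpan {N : T.ClosedIdeal} (hN : N.IsInvariant) (x y : OAlg K J hJ)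
    (hy : y ∈ idealSpan K J hJ N) : x * y ∈ idealSpan K J hJ N ∧ y * x ∈ idealSpan K J hJ N := by
  refine mul_mem_closedSpan (span_univImage_topologicalClosure K J hJ) ?_ x y hy
  rintro _ ⟨m, n, a, rfl⟩ _ ⟨l, p, b, hb, rfl⟩
  constructor
  · obtain ⟨q, r, c, hc, h⟩ := (univRep K J hJ).exists_toFun_mul hN a ⟨b, hb.1⟩ (Or.inr hb.2)
    exact Submodule.le_topologicalClosure _ (Submodule.subset_span ⟨q, r, c, hc, h.symm⟩)
  · obtain ⟨q, r, c, hc, h⟩ := (univRep K J hJ).exists_toFun_mul hN ⟨b, hb.1⟩ a (Or.inl hb.2)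
    exact Submodule.le_topologicalClosure _ (Submodule.subset_span ⟨q, r, c, hc, h.symm⟩)

end universal

end RightTensorCStarPrecategory

/-! ### Quotients -/

namespace RightTensorCStarPrecategory

variable {T : RightTensorCStarPrecategory.{u}}

/-- A `C*`-algebra as a right tensor `C*`-precategory with all arrow spaces equal to it. -/
def ofAlgebra (A : Type u) [NonUnitalCStarAlgebra A] : RightTensorCStarPrecategory.{u} where
  Hom _ _ := A
  comp a b := a * b
  comp_assoc := mul_assoc
  add_comp := add_mul
  comp_add := mul_add
  smul_comp := smul_mul_assoc
  comp_smul z a b := mul_smul_comm z a b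
  norm_comp_le := norm_mul_le
  adj a := star a
  adj_adj := star_star
  adj_add := star_add
  adj_smul := star_smul
  adj_comp := star_mul
  norm_adj_comp_self a := (CStarRing.norm_star_mul_self).trans (pow_two ‖a‖).symm
  adj_comp_self_pos a := ⟨a, rfl⟩
  ten := LinearMap.id
  ten_comp _ _ := rfl
  ten_adj _ := rfl

/-- A closed two-sided ideal of a `C*`-algebra as an ideal of the associated precategory. -/
def ofAlgebraIdeal {A : Type u} [NonUnitalCStarAlgebra A] (I : Submodule ℂ A)
    (hI : IsClosed (I : Set A)) (h : ∀ x, ∀ y ∈ I, x * y ∈ I ∧ y * x ∈ I) :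
    (ofAlgebra A).ClosedIdeal where
  carrier _ _ := I
  isClosed _ _ := hI
  comp_mem_left a _ hb := (h a _ hb).1
  comp_mem_right b ha := (h b _ ha).2

/-- Quotients of `C*`-algebras by closed two-sided ideals. -/
theorem exists_quotientHom {A : Type u} [NonUnitalCStarAlgebra A] (I : Submodule ℂ A)
    (hI : IsClosed (I : Set A)) (h : ∀ x, ∀ y ∈ I, x * y ∈ I ∧ y * x ∈ I) :
    ∃ (Q : Type u) (_ : NonUnitalCStarAlgebra Q) (q : A →⋆ₙₐ[ℂ] Q),
      (∀ x, q x = 0 ↔ x ∈ I) ∧ ∀ x, ‖q x‖ = ‖(Submodule.Quotient.mk x : A ⧸ I)‖ := by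
  -- With `ten` the identity every ideal is invariant, so `A ⧸ I` is an endomorphism algebra of a
  -- quotient precategory and inherits its `C*`-identity.
  let N := ofAlgebraIdeal I hI h
  have hN : N.IsInvariant := fun _ _ _ ha => ha
  refine ⟨(quotient N hN).Diag 0, inferInstance,
    { toFun := fun x => (Submodule.Quotient.mk x : A ⧸ I)
      map_smul' := fun _ _ => rfl
      map_zero' := rfl
      map_add' := fun _ _ => rfl
      map_mul' := fun _ _ => rfl
      map_star' := fun _ => rfl }, fun x => Submodule.Quotient.mk_eq_zero I, fun x => rfl⟩

theorem tenPow_quotMk {N : T.ClosedIdeal} (hN : N.IsInvariant) {m n : ℕ} (k : ℕ) (a : T.Hom m n) :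
    (quotient N hN).tenPow k (quotMk hN a) = quotMk hN (T.tenPow k a) := by
  induction k with
  | zero => rfl
  | succ k ih => exact congrArg (quotient N hN).ten ih

theorem quotMk_eq_iff {N : T.ClosedIdeal} (hN : N.IsInvariant) {m n : ℕ} {a b : T.Hom m n} :
    quotMk hN a = quotMk hN b ↔ a - b ∈ N.carrier m n :=
  Submodule.Quotient.eq _

theorem quotMk_eq_zero_iff {N : T.ClosedIdeal} (hN : N.IsInvariant) {m n : ℕ} {a : T.Hom m n} :
    quotMk hN a = 0 ↔ a ∈ N.carrier m n :=
  Submodule.Quotient.mk_eq_zero _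

namespace TensorRep

variable {K : T.ClosedIdeal} {B : Type u} [NonUnitalCStarAlgebra B]

/-- A representation of `K / N` pulls back to `K`. -/
noncomputable def comapQuot {N : T.ClosedIdeal} {hN : N.IsInvariant} (π : TensorRep (K.quot hN) B) :
    TensorRep K B where
  toFun m n :=
    { toFun := fun a => π.toFun m n ⟨quotMk hN (a : T.Hom m n), ClosedIdeal.quotMk_mem_quot hN a.2⟩
      map_add' := fun a b => map_add (π.toFun m n)
        ⟨quotMk hN (a : T.Hom m n), ClosedIdeal.quotMk_mem_quot hN a.2⟩
        ⟨quotMk hN (b : T.Hom m n), ClosedIdeal.quotMk_mem_quot hN b.2⟩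
      map_smul' := fun z a => map_smul (π.toFun m n) z
        ⟨quotMk hN (a : T.Hom m n), ClosedIdeal.quotMk_mem_quot hN a.2⟩ }
  map_adj {m n} a :=
    π.map_adj ⟨quotMk hN (a : T.Hom m n), ClosedIdeal.quotMk_mem_quot hN a.2⟩
  map_comp {l m n} a b :=
    π.map_comp ⟨quotMk hN (a : T.Hom m n), ClosedIdeal.quotMk_mem_quot hN a.2⟩
      ⟨quotMk hN (b : T.Hom l m), ClosedIdeal.quotMk_mem_quot hN b.2⟩
  map_tenPow_comp {l m n k} a b := by
    refine (π.map_tenPow_comp ⟨quotMk hN (a : T.Hom m n), ClosedIdeal.quotMk_mem_quot hN a.2⟩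
      ⟨quotMk hN (b : T.Hom l (m + k)), ClosedIdeal.quotMk_mem_quot hN b.2⟩).trans ?_
    refine congrArg _ (Subtype.ext ?_)
    change (quotient N hN).comp ((quotient N hN).tenPow k (quotMk hN (a : T.Hom m n))) _ = _
    rw [tenPow_quotMk]
    rfl

theorem comapQuot_toFun {N : T.ClosedIdeal} {hN : N.IsInvariant} (π : TensorRep (K.quot hN) B)
    {m n : ℕ} {a : T.Hom m n} (ha : a ∈ K.carrier m n) :
    π.comapQuot.toFun m n ⟨a, ha⟩ =
      π.toFun m n ⟨quotMk hN a, ClosedIdeal.quotMk_mem_quot hN ha⟩ := rfl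

theorem comapQuot_isCoisometric {N J : T.ClosedIdeal} {hN : N.IsInvariant} {hJ : J ≤ K.tenCore}
    {π : TensorRep (K.quot hN) B} (hπ : π.IsCoisometric (ClosedIdeal.quot_le_tenCore hN hJ)) :
    π.comapQuot.IsCoisometric hJ :=
  fun m n _ ha => hπ m n _ (ClosedIdeal.quotMk_mem_quot hN ha)

/-- A representation of `K` which vanishes on `K ∩ N` descends to `K / N`. -/
theorem exists_descend {N : T.ClosedIdeal} (hN : N.IsInvariant) (π : TensorRep K B)
    (h : ∀ (m n : ℕ) (a : T.Hom m n) (ha : a ∈ (K ⊓ N).carrier m n),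
      π.toFun m n ⟨a, ha.1⟩ = 0) :
    ∃ π' : TensorRep (K.quot hN) B, ∀ (m n : ℕ) (a : T.Hom m n) (ha : a ∈ K.carrier m n),
      π'.toFun m n ⟨quotMk hN a, ClosedIdeal.quotMk_mem_quot hN ha⟩ = π.toFun m n ⟨a, ha⟩ := by
  have hrep : ∀ {m n : ℕ} (x : (K.quot hN).carrier m n), ∃ a : K.carrier m n,
      (⟨quotMk hN (a : T.Hom m n), ClosedIdeal.quotMk_mem_quot hN a.2⟩ :
        (K.quot hN).carrier m n) = x := by
    rintro m n ⟨_, a, ha, rfl⟩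
    exact ⟨⟨a, ha⟩, rfl⟩
  -- Evaluate `π` at any lift in `K`. Two such lifts differ by an element of `K ∩ N`, where `π`
  -- vanishes, so every axiom can be checked on lifts.
  let f : ∀ {m n : ℕ}, (K.quot hN).carrier m n → B :=
    fun {m n} x => π.toFun m n (hrep x).choose
  have hf : ∀ {m n : ℕ} (a : K.carrier m n),
      f ⟨quotMk hN (a : T.Hom m n), ClosedIdeal.quotMk_mem_quot hN a.2⟩ = π.toFun m n a := by
    intro m n a
    have h1 := (hrep ⟨quotMk hN (a : T.Hom m n), ClosedIdeal.quotMk_mem_quot hN a.2⟩).choose_spec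
    set b := (hrep ⟨quotMk hN (a : T.Hom m n), ClosedIdeal.quotMk_mem_quot hN a.2⟩).choose with hb
    have h2 : (b : T.Hom m n) - a ∈ N.carrier m n :=
      (quotMk_eq_iff hN).1 (congrArg Subtype.val h1)
    have h3 := h m n (b - a : K.carrier m n) ⟨(b - a).2, h2⟩
    rw [show (⟨((b - a : K.carrier m n) : T.Hom m n), (b - a).2⟩ : K.carrier m n) = b - a from rfl,
      map_sub, sub_eq_zero] at h3
    exact h3
  refine ⟨{ toFun := fun m n =>
              { toFun := f
                map_add' := ?_
                map_smul' := ?_ }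
            map_adj := ?_
            map_comp := ?_
            map_tenPow_comp := ?_ }, fun m n a ha => hf ⟨a, ha⟩⟩
  · intro x y
    obtain ⟨a, rfl⟩ := hrep x
    obtain ⟨b, rfl⟩ := hrep y
    rw [hf, hf, ← map_add]
    exact hf (a + b)
  · intro z x
    obtain ⟨a, rfl⟩ := hrep x
    rw [hf, RingHom.id_apply, ← map_smul]
    exact hf (z • a)
  · intro m n x
    obtain ⟨a, rfl⟩ := hrep x
    change f _ = star (f _)
    rw [hf, ← π.map_adj]
    exact hf ⟨T.adj (a : T.Hom m n), K.adj_mem a.2⟩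
  · intro l m n x y
    obtain ⟨a, rfl⟩ := hrep x
    obtain ⟨b, rfl⟩ := hrep y
    change f _ = f _ * f _
    rw [hf, hf, ← π.map_comp]
    exact hf ⟨T.comp (a : T.Hom m n) (b : T.Hom l m), K.comp_mem_left (a : T.Hom m n) b.2⟩
  · intro l m n k x y
    obtain ⟨a, rfl⟩ := hrep x
    obtain ⟨b, rfl⟩ := hrep y
    change f _ * f _ = f _
    rw [hf, hf, π.map_tenPow_comp,
      ← hf ⟨T.comp (T.tenPow k (a : T.Hom m n)) (b : T.Hom l (m + k)), K.comp_mem_left _ b.2⟩]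
    refine congrArg f (Subtype.ext ?_)
    change _ = (quotient N hN).comp ((quotient N hN).tenPow k (quotMk hN (a : T.Hom m n))) _
    rw [tenPow_quotMk]
    rfl

end TensorRep

section universal

variable {K J : T.ClosedIdeal} {hJ : J ≤ K.tenCore}

/-- A continuous linear map with closed range containing the generators is surjective. -/
theorem OAlg.mem_range_of_isClosed {V : Type*} [AddCommGroup V] [Module ℂ V]
    (f : V →ₗ[ℂ] OAlg K J hJ) (hf : IsClosed (Set.range f))
    (h : ∀ (m n : ℕ) (a : K.carrier m n), (univRep K J hJ).toFun m n a ∈ Set.range f)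
    (x : OAlg K J hJ) : x ∈ Set.range f := by
  have hle : (Submodule.span ℂ (univImage K J hJ)).topologicalClosure ≤ LinearMap.range f := by
    refine Submodule.topologicalClosure_minimal _ (Submodule.span_le.2 ?_) hf
    rintro _ ⟨m, n, a, rfl⟩
    exact h m n a
  rw [span_univImage_topologicalClosure] at hle
  exact hle (Submodule.mem_top (x := x))

/-- Universality gives `f` into the algebra of `K/M` and `g` back into `𝒪(K, J)/𝒪(M)`. Since `g ∘ f`
is the quotient map and both are contractive, `f` induces an isometry on the quotient; its closed
range contains the generators. -/
theorem isNaturallyIsoQuot_idealSpan {M : T.ClosedIdeal} (hM : M.IsInvariant) :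
    IsNaturallyIsoQuot (idealSpan K J hJ M) hM := by
  let I := idealSpan K J hJ M
  have hIc : IsClosed (I : Set (OAlg K J hJ)) := Submodule.isClosed_topologicalClosure _
  obtain ⟨Q, _, q, hq0, hqn⟩ := exists_quotientHom I hIc (mul_mem_idealSpan K J hJ hM)
  have hJ' := ClosedIdeal.quot_le_tenCore hM hJ
  obtain ⟨f, hf⟩ := exists_lift (univRep (K.quot hM) (J.quot hM) hJ').comapQuot
    (TensorRep.comapQuot_isCoisometric (hJ := hJ)
      (univRep_isCoisometric (K.quot hM) (J.quot hM) hJ'))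
  have hmem : ∀ (m n : ℕ) (a : T.Hom m n) (ha : a ∈ (K ⊓ M).carrier m n),
      (univRep K J hJ).toFun m n ⟨a, ha.1⟩ ∈ I := fun m n a ha =>
    Submodule.le_topologicalClosure _ (Submodule.subset_span ⟨m, n, a, ha, rfl⟩)
  obtain ⟨π', hπ'⟩ := ((univRep K J hJ).map q).exists_descend hM
    (fun m n a ha => (hq0 _).2 (hmem m n a ha))
  have hco : π'.IsCoisometric hJ' := by
    rintro m n _ ⟨a, ha, rfl⟩
    refine (hπ' m n a (hJ m n ha).2).trans (Eq.trans ?_ (hπ' _ _ (T.ten a) (hJ m n ha).1).symm)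
    exact congrArg q (univRep_isCoisometric K J hJ m n a ha)
  obtain ⟨g, hg⟩ := exists_lift π' hco
  have hgf : g.comp f = q := by
    refine OAlg.hom_ext fun m n a => ?_
    rw [NonUnitalStarAlgHom.comp_apply, hf]
    exact (hg _ _ _).trans (hπ' m n a a.2)
  have hfI : I ≤ LinearMap.ker (f : OAlg K J hJ →ₗ[ℂ] OAlg (K.quot hM) (J.quot hM) hJ') := by
    refine Submodule.topologicalClosure_minimal _ (Submodule.span_le.2 ?_) ?_
    · rintro _ ⟨m, n, a, ha, rfl⟩
      refine (hf m n ⟨a, ha.1⟩).trans ?_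
      rw [TensorRep.comapQuot_toFun]
      refine (congrArg _ (Subtype.ext ?_)).trans (map_zero _)
      exact (quotMk_eq_zero_iff hM).2 ha.2
    · have hc : Continuous f := AddMonoidHomClass.continuous_of_bound f 1
        (fun x => by rw [one_mul]; exact NonUnitalStarAlgHom.norm_apply_le f x)
      exact isClosed_singleton.preimage hc
  let F : (OAlg K J hJ ⧸ I) →ₗ[ℂ] OAlg (K.quot hM) (J.quot hM) hJ' :=
    I.liftQ (f : OAlg K J hJ →ₗ[ℂ] OAlg (K.quot hM) (J.quot hM) hJ') hfI
  have hF : ∀ x, F (Submodule.Quotient.mk x) = f x := fun x => rfl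
  have hFn : ∀ x, ‖F x‖ = ‖x‖ := by
    intro x
    refine le_antisymm ?_ ?_
    · refine le_of_forall_pos_le_add fun ε hε => ?_
      obtain ⟨y, rfl, hy⟩ := Submodule.Quotient.norm_mk_lt x hε
      rw [hF]
      exact (NonUnitalStarAlgHom.norm_apply_le f y).trans hy.le
    · obtain ⟨y, rfl⟩ := Submodule.Quotient.mk_surjective _ x
      rw [hF, ← hqn, ← hgf]
      exact NonUnitalStarAlgHom.norm_apply_le g (f y)
  have hFr : IsClosed (Set.range F) :=
    (AddMonoidHomClass.isometry_of_norm F hFn).isClosedEmbedding.isClosed_range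
  have hFs : Function.Surjective F := by
    refine OAlg.mem_range_of_isClosed F hFr ?_
    rintro m n ⟨_, a, ha, rfl⟩
    exact ⟨Submodule.Quotient.mk ((univRep K J hJ).toFun m n ⟨a, ha⟩), hf m n ⟨a, ha⟩⟩
  refine ⟨LinearIsometryEquiv.ofSurjective ⟨F, hFn⟩ hFs, fun x y => map_mul f x y,
    fun x => map_star f x, fun m n a ha => hf m n ⟨a, ha⟩⟩

end universal

end RightTensorCStarPrecategory

/-! ### A self-improving norm bound, and positive functionals -/

/-- A map on a `C*`-algebra which is bounded and satisfies `‖F c‖² ≤ t ‖F (c* c)‖` is bounded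
by `t`. -/
theorem norm_le_of_sq_norm_le {A V : Type*} [NonUnitalCStarAlgebra A] [SeminormedAddCommGroup V]
    (F : A → V) {C t : ℝ} (ht : 0 ≤ t) (h1 : ∀ c, ‖F c‖ ≤ C * ‖c‖)
    (h2 : ∀ c, ‖F c‖ ^ 2 ≤ t * ‖F (star c * c)‖) (c : A) : ‖F c‖ ≤ t * ‖c‖ := by
  -- The best constant `D = sInf S` satisfies `‖F c‖² ≤ t D ‖c* c‖ = t D ‖c‖²`, so `D ≤ √(t D)` and
  -- therefore `D ≤ t`.
  let S : Set ℝ := {D | 0 ≤ D ∧ ∀ c, ‖F c‖ ≤ D * ‖c‖}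
  have hSne : S.Nonempty := ⟨|C|, abs_nonneg C, fun c =>
    (h1 c).trans (mul_le_mul_of_nonneg_right (le_abs_self C) (norm_nonneg c))⟩
  have hSb : BddBelow S := ⟨0, fun D hD => hD.1⟩
  have hD0 : 0 ≤ sInf S := Real.sInf_nonneg fun D hD => hD.1
  have hmem : ∀ c, ‖F c‖ ≤ sInf S * ‖c‖ := by
    intro c
    rcases (norm_nonneg c).eq_or_lt with h0 | h0
    · have := h1 c
      rw [← h0, mul_zero] at this ⊢
      exact this
    · rw [← div_le_iff₀ h0]
      exact le_csInf hSne fun D hD => (div_le_iff₀ h0).2 (hD.2 c)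
  have hsq : √(t * sInf S) ∈ S := by
    refine ⟨Real.sqrt_nonneg _, fun c => ?_⟩
    refine (sq_le_sq₀ (norm_nonneg _) (by positivity)).1 ?_
    rw [mul_pow, Real.sq_sqrt (by positivity)]
    calc _ ≤ t * ‖F (star c * c)‖ := h2 c
      _ ≤ t * (sInf S * ‖star c * c‖) := mul_le_mul_of_nonneg_left (hmem _) ht
      _ = _ := by rw [CStarRing.norm_star_mul_self]; ring
  have hle : sInf S ≤ √(t * sInf S) := csInf_le hSb hsq
  have hle' : sInf S ≤ t := by
    rcases hD0.eq_or_lt with h0 | h0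
    · rw [← h0]; exact ht
    · have := (Real.le_sqrt hD0 (by positivity)).1 hle
      nlinarith
  exact (hmem c).trans (mul_le_mul_of_nonneg_right hle' (norm_nonneg c))

open scoped ComplexOrder in
/-- Positive functionals separate positive elements from zero. -/
theorem NonUnitalCStarAlgebra.exists_positive_functional {A : Type*} [NonUnitalCStarAlgebra A]
    {a : A} (ha : a ≠ 0) :
    ∃ φ : A →L[ℂ] ℂ, (∀ b, φ (star b) = star (φ b)) ∧ (∀ b, 0 ≤ (φ (star b * b)).re) ∧
      φ (star a * a) ≠ 0 := by
  let _ := CStarAlgebra.spectralOrder A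
  have := CStarAlgebra.spectralOrderedRing A
  -- The closed convex cone of elements with positive real part. It contains every skew-adjoint
  -- element together with its negative, which will make a functional that is nonnegative on it
  -- hermitian. Hahn–Banach separates it from `-(a* a)`.
  let t : Set A := {y | 0 ≤ y + star y}
  have htc : IsClosed t :=
    CStarAlgebra.isClosed_nonneg.preimage (continuous_id.add continuous_star)
  have htconv : Convex ℝ t := by
    intro x hx y hy r s hr hs _
    have hx' : 0 ≤ x + star x := hx
    have hy' : 0 ≤ y + star y := hy
    change 0 ≤ r • x + s • y + star (r • x + s • y)
    have : r • x + s • y + star (r • x + s • y) = r • (x + star x) + s • (y + star y) := by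
      simp only [star_add, star_smul, star_trivial, smul_add]; abel
    rw [this]
    exact add_nonneg (smul_nonneg hr hx') (smul_nonneg hs hy')
  have hnot : -(star a * a) ∉ t := by
    intro h
    have h' : 0 ≤ -(star a * a) + star (-(star a * a)) := h
    rw [star_neg, star_mul, star_star] at h'
    have hp : 0 ≤ star a * a := star_mul_self_nonneg a
    have h0 : star a * a = 0 := by
      refine le_antisymm ?_ hp
      have : star a * a + star a * a ≤ 0 := by
        rw [← neg_nonneg, neg_add]; exact h'
      exact (le_add_of_nonneg_right hp).trans this
    exact ha (CStarRing.star_mul_self_eq_zero_iff a |>.1 h0)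
  obtain ⟨φ, u, hu1, hu2⟩ := RCLike.geometric_hahn_banach_point_closed (𝕜 := ℂ) htconv htc hnot
  have hu0 : u < 0 := by
    have := hu2 0 (by simp [t])
    simpa using this
  -- A functional bounded below on a cone is nonnegative there: a negative value could be rescaled
  -- to be exactly the bound `u`.
  have hnn : ∀ y ∈ t, 0 ≤ (φ y).re := by
    intro y hy
    by_contra! hneg
    have hmem : ((u / (φ y).re) : ℝ) • y ∈ t := by
      have hy' : 0 ≤ y + star y := hy
      rw [Set.mem_ofPred_eq, star_smul, star_trivial, ← smul_add]
      exact smul_nonneg (div_nonneg_of_nonpos hu0.le hneg.le) hy'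
    have := hu2 _ hmem
    rw [← Complex.coe_smul, map_smul, smul_eq_mul] at this
    simp [hneg.ne] at this
  have hre : ∀ y, (φ y).re = (φ (star y)).re := by
    intro y
    have h1 := hnn (y - star y) (by simp [t])
    have h2 := hnn (star y - y) (by simp [t])
    rw [map_sub, Complex.sub_re] at h1 h2
    linarith
  refine ⟨φ, fun b => ?_, fun b => hnn _ ?_, fun h => ?_⟩
  · refine Complex.ext ?_ ?_
    · rw [← hre]; simp
    -- The imaginary part of `φ b` is, up to sign, the real part of `φ (i b)`.
    · have := hre (Complex.I • b)
      rw [star_smul] at this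
      simp at this
      simp [this]
  · rw [Set.mem_ofPred_eq, star_mul, star_star]
    exact add_nonneg (star_mul_self_nonneg b) (star_mul_self_nonneg b)
  · rw [map_neg, h] at hu1
    simp at hu1
    linarith

/-! ### The Fock representation -/

namespace RightTensorCStarPrecategory

variable {T : RightTensorCStarPrecategory.{u}}

/-- A positive functional on the `C*`-algebra of endomorphisms of an object. -/
structure PositiveFunctional (T : RightTensorCStarPrecategory.{u}) (m : ℕ) where
  toFun : T.Hom m m →L[ℂ] ℂ
  map_adj : ∀ a, toFun (T.adj a) = star (toFun a)
  nonneg : ∀ {n : ℕ} (a : T.Hom m n), 0 ≤ (toFun (T.comp (T.adj a) a)).re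

/-- A positive functional on `T(m, m)` is nonnegative on `a* a` for every arrow `a` out of `m`,
because `a* a` is positive in `T(m, m)`. -/
theorem exists_positiveFunctional {m : ℕ} {a : T.Hom m m} (ha : a ≠ 0) :
    ∃ φ : T.PositiveFunctional m, φ.toFun (T.comp (T.adj a) a) ≠ 0 := by
  obtain ⟨φ, h1, h2, h3⟩ := NonUnitalCStarAlgebra.exists_positive_functional
    (A := T.Diag m) (a := a) ha
  refine ⟨⟨φ, h1, fun a => ?_⟩, h3⟩
  obtain ⟨b, hb⟩ := T.adj_comp_self_pos a
  rw [hb]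
  exact h2 b

noncomputable section

/-- The algebraic direct sum of all arrow spaces with a fixed source. -/
def Fock {m : ℕ} (_ : T.PositiveFunctional m) : Type u := Π₀ p, T.Hom m p

namespace Fock

variable {m : ℕ} (φ : T.PositiveFunctional m)

instance : AddCommGroup (Fock φ) := inferInstanceAs (AddCommGroup (Π₀ p, T.Hom m p))

instance : Module ℂ (Fock φ) := inferInstanceAs (Module ℂ (Π₀ p, T.Hom m p))

/-- The component inclusions. -/
def single (p : ℕ) : T.Hom m p →ₗ[ℂ] Fock φ := DFinsupp.lsingle p

/-- The component projections. -/
def coord (p : ℕ) : Fock φ →ₗ[ℂ] T.Hom m p := DFinsupp.lapply p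

variable {φ}

theorem coord_single_same (p : ℕ) (x : T.Hom m p) : coord φ p (single φ p x) = x :=
  DFinsupp.single_eq_same

theorem coord_single_of_ne {p q : ℕ} (h : p ≠ q) (x : T.Hom m p) :
    coord φ q (single φ p x) = 0 :=
  DFinsupp.single_eq_of_ne h.symm

theorem induction {P : Fock φ → Prop} (h0 : P 0) (h1 : ∀ p x, P (single φ p x))
    (h2 : ∀ ξ η, P ξ → P η → P (ξ + η)) (ξ : Fock φ) : P ξ :=
  DFinsupp.induction ξ h0 fun p x _ _ _ h => h2 _ _ (h1 p x) h

theorem hom_ext {V : Type*} [AddCommGroup V] [Module ℂ V] {f g : Fock φ →ₗ[ℂ] V}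
    (h : ∀ p x, f (single φ p x) = g (single φ p x)) : f = g := by
  ext ξ
  induction ξ using induction with
  | h0 => rw [map_zero, map_zero]
  | h1 p x => exact h p x
  | h2 ξ η hξ hη => rw [map_add, map_add, hξ, hη]

/-- A linear map on the direct sum defined by its components. -/
def lift {V : Type*} [AddCommGroup V] [Module ℂ V] (f : ∀ p, T.Hom m p →ₗ[ℂ] V) :
    Fock φ →ₗ[ℂ] V := DFinsupp.lsum ℕ f

theorem lift_single {V : Type*} [AddCommGroup V] [Module ℂ V] (f : ∀ p, T.Hom m p →ₗ[ℂ] V)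
    (p : ℕ) (x : T.Hom m p) : lift (φ := φ) f (single φ p x) = f p x :=
  DFinsupp.lsum_single ℕ f p x

/-- The linear functional `η ↦ ⟨ξ, η⟩`. -/
def innerRight (ξ : Fock φ) : Fock φ →ₗ[ℂ] ℂ :=
  lift fun p => (φ.toFun : T.Hom m m →ₗ[ℂ] ℂ) ∘ₗ compₗ (T.adj (coord φ p ξ))

theorem innerRight_single (ξ : Fock φ) (p : ℕ) (x : T.Hom m p) :
    innerRight ξ (single φ p x) = φ.toFun (T.comp (T.adj (coord φ p ξ)) x) :=
  lift_single _ p x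

theorem innerRight_add (ξ ξ' η : Fock φ) :
    innerRight (ξ + ξ') η = innerRight ξ η + innerRight ξ' η := by
  induction η using induction with
  | h0 => simp
  | h1 p x => rw [innerRight_single, innerRight_single, innerRight_single, map_add, T.adj_add,
      T.add_comp, map_add]
  | h2 η η' h h' => rw [map_add, map_add, map_add, h, h']; ring

theorem innerRight_smul (z : ℂ) (ξ η : Fock φ) :
    innerRight (z • ξ) η = star z * innerRight ξ η := by
  induction η using induction with
  | h0 => simp
  | h1 p x => rw [innerRight_single, innerRight_single, map_smul, T.adj_smul, T.smul_comp,
      map_smul, smul_eq_mul]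
  | h2 η η' h h' => rw [map_add, map_add, h, h']; ring

theorem innerRight_star (ξ η : Fock φ) : star (innerRight η ξ) = innerRight ξ η := by
  have h0 : ∀ η : Fock φ, innerRight (0 : Fock φ) η = 0 := fun η => by
    have := innerRight_smul 0 (0 : Fock φ) η
    simpa using this
  induction ξ using induction generalizing η with
  | h0 => rw [map_zero, h0, star_zero]
  | h1 p x =>
    induction η using induction with
    | h0 => rw [map_zero, h0, star_zero]
    | h1 q y =>
      rw [innerRight_single, innerRight_single]
      by_cases hpq : p = q
      · subst hpq
        rw [coord_single_same, coord_single_same, ← φ.map_adj, T.adj_comp, T.adj_adj]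
      · rw [coord_single_of_ne hpq, coord_single_of_ne (Ne.symm hpq)]
        have hz : ∀ r s, T.adj (0 : T.Hom r s) = 0 := fun r s => by
          have := T.adj_smul 0 (0 : T.Hom r s)
          simpa using this
        rw [hz, hz, zero_comp, zero_comp, map_zero, star_zero]
    | h2 η η' h h' => rw [innerRight_add, star_add, h, h', map_add]
  | h2 ξ ξ' h h' => rw [map_add, star_add, h, h', innerRight_add]

open scoped Classical in
theorem innerRight_self_re (ξ : Fock φ) : 0 ≤ (innerRight ξ ξ).re := by
  have : innerRight ξ ξ = (ξ : Π₀ p, T.Hom m p).sum fun p x => φ.toFun (T.comp (T.adj x) x) :=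
    DFinsupp.sumAddHom_apply _ _
  rw [this]
  refine (Complex.re_sum _ _).symm ▸ ?_
  exact Finset.sum_nonneg fun p _ => φ.nonneg _

variable (φ) in
/-- The semi-inner product `⟨ξ, η⟩ = ∑ φ(ξ_p* η_p)`. -/
abbrev core : PreInnerProductSpace.Core ℂ (Fock φ) where
  inner ξ η := innerRight ξ η
  conj_inner_symm ξ η := innerRight_star ξ η
  re_inner_nonneg ξ := innerRight_self_re ξ
  add_left ξ ξ' η := innerRight_add ξ ξ' η
  smul_left ξ η z := innerRight_smul z ξ η

/-- Only a seminorm: vectors of length zero disappear in the Hausdorff completion `Space`. -/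
instance : SeminormedAddCommGroup (Fock φ) :=
  InnerProductSpace.Core.toSeminormedAddCommGroup (c := core φ)

instance : InnerProductSpace ℂ (Fock φ) := InnerProductSpace.ofCore (core φ)

theorem inner_single (ξ : Fock φ) (p : ℕ) (x : T.Hom m p) :
    inner ℂ ξ (single φ p x) = φ.toFun (T.comp (T.adj (coord φ p ξ)) x) :=
  innerRight_single ξ p x

theorem norm_single_le (p : ℕ) (x : T.Hom m p) :
    ‖single φ p x‖ ≤ √‖φ.toFun‖ * ‖x‖ := by
  refine (sq_le_sq₀ (norm_nonneg _) (by positivity)).1 ?_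
  rw [mul_pow, Real.sq_sqrt (norm_nonneg _), ← inner_self_eq_norm_sq (𝕜 := ℂ), inner_single,
    coord_single_same, ← T.norm_adj_comp_self]
  exact (RCLike.re_le_norm _).trans (φ.toFun.le_opNorm _)

/-- The component of the operator of left multiplication by `a ⊗ 1^k`, for all `k`. -/
def shiftComponent {n r : ℕ} (a : T.Hom n r) (k : ℕ) : T.Hom m (n + k) →ₗ[ℂ] Fock φ :=
  single φ (r + k) ∘ₗ compₗ (T.tenPow k a)

open scoped Classical in
/-- The operator of left multiplication by all `a ⊗ 1^k`. -/
def shift {n r : ℕ} (a : T.Hom n r) : Fock φ →ₗ[ℂ] Fock φ :=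
  -- On degree `p = n + k` this is `x ↦ (a ⊗ 1^k) x`, and on degrees below `n` it is zero. The
  -- exponent is determined by `p`, so the choice is harmless.
  lift fun p => if h : ∃ k, n + k = p then h.choose_spec ▸ shiftComponent a h.choose else 0

theorem shift_single {n r : ℕ} (a : T.Hom n r) (k : ℕ) (x : T.Hom m (n + k)) :
    shift a (single φ (n + k) x) = single φ (r + k) (T.comp (T.tenPow k a) x) := by
  rw [shift, lift_single]
  have h : ∃ j, n + j = n + k := ⟨k, rfl⟩
  rw [dif_pos h]
  have key : ∀ (j : ℕ) (hj : n + j = n + k),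
      (hj ▸ (shiftComponent a j : T.Hom m (n + j) →ₗ[ℂ] Fock φ)) = shiftComponent a k := by
    intro j hj
    obtain rfl := Nat.add_left_cancel hj
    rfl
  rw [key]
  rfl

theorem shift_single_of_heq {n r : ℕ} (a : T.Hom n r) (k : ℕ) {p q : ℕ} (hp : p = n + k)
    (hq : q = r + k) (c : T.Hom p q) (hc : HEq c (T.tenPow k a)) (x : T.Hom m p) :
    shift a (single φ p x) = single φ q (T.comp c x) := by
  subst hp hq
  obtain rfl := eq_of_heq hc
  exact shift_single a k x

theorem shift_single_of_lt {n r p : ℕ} (a : T.Hom n r) (h : p < n) (x : T.Hom m p) :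
    shift a (single φ p x) = 0 := by
  rw [shift, lift_single, dif_neg]
  · rfl
  · rintro ⟨k, rfl⟩
    omega

theorem shift_add {n r : ℕ} (a b : T.Hom n r) :
    (shift (a + b) : Fock φ →ₗ[ℂ] Fock φ) = shift a + shift b := by
  refine hom_ext fun p x => ?_
  rw [LinearMap.add_apply]
  rcases lt_or_ge p n with h | h
  · simp only [shift_single_of_lt _ h, add_zero]
  · obtain ⟨k, rfl⟩ := Nat.exists_eq_add_of_le h
    simp only [shift_single, tenPow_add', T.add_comp, map_add]

theorem shift_smul {n r : ℕ} (z : ℂ) (a : T.Hom n r) :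
    (shift (z • a) : Fock φ →ₗ[ℂ] Fock φ) = z • shift a := by
  refine hom_ext fun p x => ?_
  rw [LinearMap.smul_apply]
  rcases lt_or_ge p n with h | h
  · simp only [shift_single_of_lt _ h, smul_zero]
  · obtain ⟨k, rfl⟩ := Nat.exists_eq_add_of_le h
    simp only [shift_single, tenPow_smul, T.smul_comp, map_smul]

/-- The defining relation of a right tensor representation. It reduces to `(a ⊗ 1^k) ⊗ 1^j = a ⊗
1^(k + j)`. -/
theorem shift_shift {l n r k : ℕ} (a : T.Hom n r) (b : T.Hom l (n + k)) :
    (shift (T.comp (T.tenPow k a) b) : Fock φ →ₗ[ℂ] Fock φ) = shift a ∘ₗ shift b := by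
  refine hom_ext fun p x => ?_
  rw [LinearMap.comp_apply]
  rcases lt_or_ge p l with h | h
  · simp only [shift_single_of_lt _ h, map_zero]
  · obtain ⟨j, rfl⟩ := Nat.exists_eq_add_of_le h
    rw [shift_single, shift_single, shift_single_of_heq a (k + j) (Nat.add_assoc n k j)
      (Nat.add_assoc r k j) _ (tenPow_tenPow_heq k j a), tenPow_comp, T.comp_assoc]

theorem inner_shift {n r : ℕ} (a : T.Hom n r) (ξ η : Fock φ) :
    inner ℂ (shift a ξ) η = inner ℂ ξ (shift (T.adj a) η) := by
  have hz : ∀ r s, T.adj (0 : T.Hom r s) = 0 := fun r s => by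
    have := T.adj_smul 0 (0 : T.Hom r s)
    simpa using this
  induction ξ using induction with
  | h0 => rw [map_zero, inner_zero_left, inner_zero_left]
  | h2 ξ ξ' h h' => rw [map_add, inner_add_left, inner_add_left, h, h']
  | h1 p x =>
  induction η using induction with
  | h0 => rw [map_zero, inner_zero_right, inner_zero_right]
  | h2 ξ ξ' h h' => rw [map_add, inner_add_right, inner_add_right, h, h']
  | h1 q y =>
  rw [inner_single]
  -- Different degrees are orthogonal, so for `p = n + k` and `q = r + j` both sides vanish unless
  -- `k = j`. If `p < n` or `q < r`, one side is killed by its operator and the other is zero for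
  -- the same reason or by mismatched degrees.
  rcases lt_or_ge p n with h | h <;> rcases lt_or_ge q r with h' | h'
  · rw [shift_single_of_lt _ h, shift_single_of_lt _ h', inner_zero_right, map_zero, hz, zero_comp,
      map_zero]
  · obtain ⟨k, rfl⟩ := Nat.exists_eq_add_of_le h'
    rw [shift_single_of_lt _ h, shift_single, inner_single, coord_single_of_ne (by omega), map_zero,
      hz, hz, zero_comp, zero_comp, map_zero]
  · obtain ⟨k, rfl⟩ := Nat.exists_eq_add_of_le h
    rw [shift_single_of_lt _ h', shift_single, coord_single_of_ne (by omega), inner_zero_right,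
      hz, zero_comp, map_zero]
  · obtain ⟨k, rfl⟩ := Nat.exists_eq_add_of_le h
    obtain ⟨j, rfl⟩ := Nat.exists_eq_add_of_le h'
    rw [shift_single, shift_single, inner_single]
    by_cases hkj : k = j
    · subst hkj
      rw [coord_single_same, coord_single_same, T.adj_comp, T.comp_assoc, adj_tenPow]
    · rw [coord_single_of_ne (by omega), coord_single_of_ne (by omega), hz, hz, zero_comp,
        zero_comp]

/-- Cauchy–Schwarz applied to `‖shift a ξ‖² = ⟨ξ, shift (a* a) ξ⟩`. -/
theorem norm_shift_sq_le {n r : ℕ} (a : T.Hom n r) (ξ : Fock φ) :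
    ‖shift a ξ‖ ^ 2 ≤ ‖ξ‖ * ‖shift (T.comp (T.adj a) a) ξ‖ := by
  rw [← inner_self_eq_norm_sq (𝕜 := ℂ), inner_shift]
  have := shift_shift (φ := φ) (k := 0) (T.adj a) a
  rw [← LinearMap.comp_apply, ← this]
  exact re_inner_le_norm _ _

/-- Since `ξ` has finitely many components, `c ↦ shift c ξ` has some bound on `T(n, n)`.
`norm_le_of_sq_norm_le` improves the constant to `‖ξ‖`, and a general `a` is reduced to `a* a`. -/
theorem norm_shift_le {n r : ℕ} (a : T.Hom n r) (ξ : Fock φ) : ‖shift a ξ‖ ≤ ‖a‖ * ‖ξ‖ := by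
  have hb : ∃ C : ℝ, ∀ c : T.Hom n n, ‖shift c ξ‖ ≤ C * ‖c‖ := by
    induction ξ using induction with
    | h0 => exact ⟨0, fun c => by rw [map_zero, norm_zero, zero_mul]⟩
    | h1 p x =>
      refine ⟨√‖φ.toFun‖ * ‖x‖, fun c => ?_⟩
      rcases lt_or_ge p n with h | h
      · rw [shift_single_of_lt _ h, norm_zero]; positivity
      · obtain ⟨k, rfl⟩ := Nat.exists_eq_add_of_le h
        rw [shift_single]
        refine (norm_single_le _ _).trans ?_
        rw [mul_assoc, mul_comm ‖x‖]
        refine mul_le_mul_of_nonneg_left ((T.norm_comp_le _ _).trans ?_) (Real.sqrt_nonneg _)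
        exact mul_le_mul_of_nonneg_right (norm_tenPow_le _ _) (norm_nonneg _)
    | h2 ξ η h h' =>
      obtain ⟨C, hC⟩ := h
      obtain ⟨D, hD⟩ := h'
      refine ⟨C + D, fun c => ?_⟩
      rw [map_add, add_mul]
      exact (norm_add_le _ _).trans (add_le_add (hC c) (hD c))
  obtain ⟨C, hC⟩ := hb
  have h1 := norm_le_of_sq_norm_le (A := T.Diag n) (fun c => shift (φ := φ) c ξ) (norm_nonneg ξ) hC
    (fun c => norm_shift_sq_le _ ξ) (show T.Diag n from T.comp (T.adj a) a)
  refine (sq_le_sq₀ (norm_nonneg _) (by positivity)).1 ?_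
  calc _ ≤ ‖ξ‖ * ‖shift (T.comp (T.adj a) a) ξ‖ := norm_shift_sq_le a ξ
    _ ≤ ‖ξ‖ * (‖ξ‖ * ‖T.comp (T.adj a) a‖) := mul_le_mul_of_nonneg_left h1 (norm_nonneg _)
    _ = _ := by rw [T.norm_adj_comp_self]; ring

/-- The operator `shift a` as a bounded operator. -/
def shiftL {n r : ℕ} (a : T.Hom n r) : Fock φ →L[ℂ] Fock φ :=
  (shift a).mkContinuous ‖a‖ (norm_shift_le a)

variable (φ) in
/-- The Fock space. -/
abbrev Space : Type u := UniformSpace.Completion (Fock φ)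

open UniformSpace in
theorem space_ext {f g : Space φ →L[ℂ] Space φ} (h : ∀ ξ : Fock φ, f ξ = g ξ) : f = g := by
  ext ξ
  induction ξ using Completion.induction_on with
  | hp => exact isClosed_eq f.continuous g.continuous
  | ih ξ => exact h ξ

/-- The operator of `a` on the Fock space. -/
def op {n r : ℕ} (a : T.Hom n r) : Space φ →L[ℂ] Space φ := (shiftL a).completion

theorem op_coe {n r : ℕ} (a : T.Hom n r) (ξ : Fock φ) :
    op a (ξ : Space φ) = ((shift a ξ : Fock φ) : Space φ) :=
  UniformSpace.Completion.map_coe (shiftL a).uniformContinuous ξ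

theorem op_comp {l n r k : ℕ} (a : T.Hom n r) (b : T.Hom l (n + k)) :
    (op a * op b : Space φ →L[ℂ] Space φ) = op (T.comp (T.tenPow k a) b) := by
  refine space_ext fun ξ => ?_
  rw [mul_apply_eq_comp, op_coe, op_coe, op_coe, shift_shift, LinearMap.comp_apply]

open UniformSpace in
variable (φ) in
/-- The Fock representation. -/
def rep : TensorRep (⊤ : T.ClosedIdeal) (Space φ →L[ℂ] Space φ) where
  toFun n r :=
    { toFun := fun a => op (a : T.Hom n r)
      map_add' := fun a b => space_ext fun ξ => by
        rw [add_apply, op_coe, op_coe, op_coe, Submodule.coe_add, shift_add,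
          LinearMap.add_apply, Completion.coe_add]
      map_smul' := fun z a => space_ext fun ξ => by
        rw [smul_apply, op_coe, op_coe, Submodule.coe_smul, shift_smul,
          LinearMap.smul_apply, Completion.coe_smul, RingHom.id_apply] }
  map_adj a := by
    change op _ = star (op _)
    rw [ContinuousLinearMap.star_eq_adjoint]
    refine (ContinuousLinearMap.eq_adjoint_iff _ _).2 fun ξ η => ?_
    induction ξ, η using Completion.induction_on₂ with
    | hp => exact isClosed_eq (by fun_prop) (by fun_prop)
    | ih ξ η => rw [op_coe, op_coe, Completion.inner_coe, Completion.inner_coe, inner_shift,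
        T.adj_adj]
  map_comp a b := (op_comp (k := 0) _ _).symm
  map_tenPow_comp a b := op_comp _ _

end Fock

/-- Representations of the whole precategory separate `a` from `a ⊗ 1`. -/
theorem exists_rep_ne_ten {n r : ℕ} {a : T.Hom n r} (ha : a ≠ 0) :
    ∃ (B : Type u) (_ : NonUnitalCStarAlgebra B) (π : TensorRep (⊤ : T.ClosedIdeal) B),
      π.toFun n r ⟨a, Submodule.mem_top⟩ ≠ π.toFun (n + 1) (r + 1) ⟨T.ten a, Submodule.mem_top⟩ := by
  -- There may be no identity arrow, so `c = a* a` is the test vector in degree `n` of the Fock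
  -- space with source `n`. The operator of `a` sends it to `a c`; that of `a ⊗ 1` kills it, because
  -- it acts only on degrees at least `n + 1`.
  let c : T.Hom n n := T.comp (T.adj a) a
  have hc : T.comp a c ≠ 0 := by
    intro h
    have h1 : T.comp (T.adj c) c = 0 := by
      rw [T.adj_comp, T.adj_adj, T.comp_assoc, h, comp_zero]
    have h2 := T.norm_adj_comp_self c
    rw [h1, norm_zero, T.norm_adj_comp_self] at h2
    exact ha (by simpa using h2.symm)
  have hcc : T.comp (T.adj (T.comp a c)) (T.comp a c) ≠ 0 := by
    intro h
    have := T.norm_adj_comp_self (T.comp a c)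
    rw [h, norm_zero] at this
    exact hc (by simpa using this.symm)
  -- Separating functionals are available for endomorphisms only, so `(a c)* (a c)` is rewritten as
  -- `d* d` with `d` in `T(n, n)`.
  obtain ⟨d, hd⟩ := T.adj_comp_self_pos (T.comp a c)
  have hd0 : d ≠ 0 := by
    rintro rfl
    exact hcc (hd.trans (comp_zero _))
  obtain ⟨φ, hφ⟩ := exists_positiveFunctional hd0
  rw [← hd] at hφ
  refine ⟨_, inferInstance, Fock.rep φ, fun h => hφ ?_⟩
  have h1 : Fock.op a ((Fock.single φ n c : Fock φ) : Fock.Space φ) =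
      Fock.op (T.ten a) ((Fock.single φ n c : Fock φ) : Fock.Space φ) :=
    congrArg (fun f : Fock.Space φ →L[ℂ] Fock.Space φ => f (Fock.single φ n c : Fock φ)) h
  rw [Fock.op_coe, Fock.op_coe, Fock.shift_single_of_lt _ (Nat.lt_succ_self n),
    Fock.shift_single_of_heq (p := n) (q := r) a 0 rfl rfl a HEq.rfl] at h1
  have h2 := congrArg norm h1
  rw [UniformSpace.Completion.norm_coe, UniformSpace.Completion.norm_coe, norm_zero] at h2
  have h3 := inner_self_eq_norm_sq_to_K (𝕜 := ℂ) (Fock.single φ r (T.comp a c))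
  rw [h2, Fock.inner_single, Fock.coord_single_same] at h3
  refine h3.trans ?_
  simp

end

end RightTensorCStarPrecategory

/-! ### Fock-faithfulness and injectivity of the universal representation -/

namespace RightTensorCStarPrecategory

variable {T : RightTensorCStarPrecategory.{u}}

theorem eq_zero_of_adj_comp_comp_adj {m n : ℕ} {a : T.Hom m n}
    (h : T.comp (T.adj a) (T.comp a (T.adj a)) = 0) : a = 0 := by
  have h1 : T.comp (T.adj (T.comp (T.adj a) a)) (T.comp (T.adj a) a) = 0 := by
    have : T.comp (T.comp (T.adj a) (T.comp a (T.adj a))) a = 0 := by rw [h, zero_comp]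
    rw [T.adj_comp, T.adj_adj, T.comp_assoc]
    rwa [T.comp_assoc, T.comp_assoc] at this
  have h2 := T.norm_adj_comp_self (T.comp (T.adj a) a)
  rw [h1, norm_zero, T.norm_adj_comp_self] at h2
  simpa using h2.symm

/-- The cutoffs approximate `a` by `(a a*) a g`, which is of the form `c a d`. -/
theorem ClosedIdeal.mem_of_forall_comp_mem (K : T.ClosedIdeal) {m n : ℕ} {a : T.Hom m n}
    (h : ∀ (c : T.Hom n n) (d : T.Hom m m), T.comp c (T.comp a d) ∈ K.carrier m n) :
    a ∈ K.carrier m n := by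
  have : a ∈ closure (K.carrier m n : Set (T.Hom m n)) := by
    rw [Metric.mem_closure_iff]
    intro ε hε
    obtain ⟨g, -, hg, -⟩ := exists_cutoff a (half_pos hε)
    refine ⟨_, ?_, lt_of_le_of_lt (le_of_eq_of_le (dist_eq_norm _ _) hg) (half_lt_self hε)⟩
    have := h (T.comp a (T.adj a)) g
    rw [SetLike.mem_coe]
    simpa only [T.comp_assoc] using this
  rwa [(K.isClosed m n).closure_eq] at this

/-- An injective `*`-homomorphism on the `C*`-algebra `J(m, m)` is isometric; the `C*`-identity
carries this over to `J(m, n)`. -/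
theorem norm_ten_of_injOn {J : T.ClosedIdeal}
    (h : ∀ (m n : ℕ) (a : T.Hom m n), a ∈ J.carrier m n → T.ten a = 0 → a = 0) {m n : ℕ}
    {a : T.Hom m n} (ha : a ∈ J.carrier m n) : ‖T.ten a‖ = ‖a‖ := by
  have : IsClosed (TensorRep.diagSub J m : Set (T.Diag m)) := J.isClosed m m
  let f : TensorRep.diagSub J m →⋆ₙₐ[ℂ] T.Diag (m + 1) :=
    (T.tenDiag m).comp (NonUnitalStarSubalgebraClass.subtype (TensorRep.diagSub J m))
  have hf : Function.Injective f := by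
    rw [injective_iff_map_eq_zero]
    rintro ⟨x, hx⟩ h0
    exact Subtype.ext (h m m x hx h0)
  have hmem : T.comp (T.adj a) a ∈ J.carrier m m := J.comp_mem_left _ ha
  have h1 : ‖T.ten (T.comp (T.adj a) a)‖ = ‖T.comp (T.adj a) a‖ :=
    NonUnitalStarAlgHom.norm_map f hf (⟨show T.Diag m from _, hmem⟩ : TensorRep.diagSub J m)
  rw [T.ten_comp, T.ten_adj, T.norm_adj_comp_self, T.norm_adj_comp_self] at h1
  exact (sq_eq_sq₀ (norm_nonneg _) (norm_nonneg _)).1 h1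

namespace TensorRep

variable {B : Type u} [NonUnitalCStarAlgebra B] (π : TensorRep (⊤ : T.ClosedIdeal) B)

/-- A representation of the whole precategory, on arrows. -/
def arrow {m n : ℕ} : T.Hom m n →ₗ[ℂ] B :=
  π.toFun m n ∘ₗ LinearMap.codRestrict _ LinearMap.id (fun _ => Submodule.mem_top)

/-- The map `a ↦ π(a) - π(a ⊗ 1)`. -/
def diff {m n : ℕ} : T.Hom m n →ₗ[ℂ] B := π.arrow - π.arrow ∘ₗ T.ten

theorem diff_apply {m n : ℕ} (a : T.Hom m n) : π.diff a = π.arrow a - π.arrow (T.ten a) := rfl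

theorem arrow_adj {m n : ℕ} (a : T.Hom m n) : π.arrow (T.adj a) = star (π.arrow a) :=
  π.map_adj ⟨a, Submodule.mem_top⟩

theorem diff_adj {m n : ℕ} (a : T.Hom m n) : π.diff (T.adj a) = star (π.diff a) := by
  rw [diff_apply, diff_apply, T.ten_adj, arrow_adj, arrow_adj, star_sub]

theorem arrow_mul {l m n k : ℕ} (a : T.Hom m n) (b : T.Hom l (m + k)) :
    π.arrow a * π.arrow b = π.arrow (T.comp (T.tenPow k a) b) :=
  π.map_tenPow_comp ⟨a, Submodule.mem_top⟩ ⟨b, Submodule.mem_top⟩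

theorem arrow_mul_of_heq {l m n k p q : ℕ} (hp : p = m + k) (hq : q = n + k) (a : T.Hom m n)
    (b : T.Hom l p) (c : T.Hom p q) (hc : HEq c (T.tenPow k a)) :
    π.arrow a * π.arrow b = π.arrow (T.comp c b) := by
  subst hp hq
  obtain rfl := eq_of_heq hc
  exact π.arrow_mul a b

theorem arrow_mul' {l m n k : ℕ} (a : T.Hom (m + k) n) (b : T.Hom l m) :
    π.arrow a * π.arrow b = π.arrow (T.comp a (T.tenPow k b)) :=
  π.map_comp_tenPow ⟨a, Submodule.mem_top⟩ ⟨b, Submodule.mem_top⟩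

/-- In the Fock representation, `diff a` is multiplication by `a` on degree `m` alone. In general,
`π(a)` and `π(a ⊗ 1)` multiply `π(b)` by the same power `a ⊗ 1^(k + 1)`, where `p = m + 1 + k`. -/
theorem diff_mul_arrow_of_lt {l m n p : ℕ} (h : m < p) (a : T.Hom m n) (b : T.Hom l p) :
    π.diff a * π.arrow b = 0 := by
  obtain ⟨k, rfl⟩ := Nat.exists_eq_add_of_le (Nat.succ_le_of_lt h)
  rw [diff_apply, sub_mul, sub_eq_zero, π.arrow_mul_of_heq (k := k + 1) (Nat.add_right_comm m 1 k)
    (Nat.add_right_comm n 1 k) a b _ (tenPow_ten_heq k a)]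
  exact (π.arrow_mul (T.ten a) b).symm

theorem diff_mul_arrow {l m n k : ℕ} (a : T.Hom (m + k) n) (b : T.Hom l m) :
    π.diff a * π.arrow b = π.diff (T.comp a (T.tenPow k b)) := by
  rw [diff_apply, diff_apply, sub_mul, arrow_mul', T.ten_comp]
  exact congrArg _ (π.arrow_mul' (k := k + 1) (T.ten a) b)

theorem arrow_mul_diff {l m n k : ℕ} (a : T.Hom m n) (b : T.Hom l (m + k)) :
    π.arrow a * π.diff b = π.diff (T.comp (T.tenPow k a) b) := by
  rw [diff_apply, diff_apply, mul_sub, arrow_mul, T.ten_comp]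
  exact congrArg _ (π.arrow_mul (k := k + 1) a (T.ten b))

theorem arrow_mul_diff_of_lt {l m n p : ℕ} (h : p < m) (a : T.Hom m n) (b : T.Hom l p) :
    π.arrow a * π.diff b = 0 := by
  have := π.diff_mul_arrow_of_lt h (T.adj b) (T.adj a)
  rwa [diff_adj, arrow_adj, ← star_mul, star_eq_zero] at this

/-- With `diff_mul_diff_of_ne` this says that the `diff a` multiply like matrix entries indexed by
objects. The term with `b ⊗ 1` drops out because its target `m + 1` exceeds `m`. -/
theorem diff_mul_diff {l m n : ℕ} (a : T.Hom m n) (b : T.Hom l m) :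
    π.diff a * π.diff b = π.diff (T.comp a b) := by
  rw [diff_apply π b, mul_sub, π.diff_mul_arrow_of_lt (Nat.lt_succ_self m), sub_zero]
  exact π.diff_mul_arrow (k := 0) a b

theorem diff_mul_diff_of_ne {l m n p : ℕ} (h : p ≠ m) (a : T.Hom m n) (b : T.Hom l p) :
    π.diff a * π.diff b = 0 := by
  rcases lt_or_gt_of_ne h with h | h
  · rw [diff_apply, sub_mul, π.arrow_mul_diff_of_lt h, π.arrow_mul_diff_of_lt (by omega), sub_zero]
  · rw [diff_apply π b, mul_sub, π.diff_mul_arrow_of_lt h, π.diff_mul_arrow_of_lt (by omega),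
      sub_zero]

/-- The representation is Fock-faithful if `a ↦ π(a) - π(a ⊗ 1)` is injective. -/
def IsFockFaithful : Prop := ∀ (m n : ℕ) (a : T.Hom m n), π.diff a = 0 → a = 0

variable {π}

/-- On each `T(m, m)` the map `diff` is an injective `*`-homomorphism, hence isometric. -/
theorem IsFockFaithful.norm_diff (hπ : π.IsFockFaithful) {m n : ℕ} (a : T.Hom m n) :
    ‖π.diff a‖ = ‖a‖ := by
  let f : T.Diag m →⋆ₙₐ[ℂ] B :=
    { toFun := fun x => π.diff (m := m) (n := m) x
      map_smul' := fun z x => map_smul (π.diff (m := m) (n := m)) z x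
      map_zero' := map_zero (π.diff (m := m) (n := m))
      map_add' := fun x y => map_add (π.diff (m := m) (n := m)) x y
      map_mul' := fun x y => (π.diff_mul_diff (l := m) (m := m) (n := m) x y).symm
      map_star' := fun x => π.diff_adj (m := m) (n := m) x }
  have hf : Function.Injective f := (injective_iff_map_eq_zero f).2 fun x hx => hπ m m x hx
  have h1 : ‖π.diff (T.comp (T.adj a) a)‖ = ‖T.comp (T.adj a) a‖ :=
    NonUnitalStarAlgHom.norm_map f hf (show T.Diag m from T.comp (T.adj a) a)
  rw [← diff_mul_diff, diff_adj, CStarRing.norm_star_mul_self, T.norm_adj_comp_self, ← pow_two]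
    at h1
  exact (sq_eq_sq₀ (norm_nonneg _) (norm_nonneg _)).1 h1

/-- The images of the arrow spaces are linearly independent: linear maps on them may be extended
simultaneously. -/
theorem IsFockFaithful.exists_linearMap (hπ : π.IsFockFaithful) {L : T.ClosedIdeal} {V : Type*}
    [AddCommGroup V] [Module ℂ V] (σ : ∀ m n, L.carrier m n →ₗ[ℂ] V) :
    ∃ s : B →ₗ[ℂ] V, ∀ (m n : ℕ) (a : T.Hom m n) (ha : a ∈ L.carrier m n),
      s (π.arrow a) = σ m n ⟨a, ha⟩ := by
  classical
  let F := Π₀ p : ℕ × ℕ, L.carrier p.1 p.2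
  let τ : F →ₗ[ℂ] B := DFinsupp.lsum ℕ fun p => π.arrow ∘ₗ (L.carrier p.1 p.2).subtype
  have hτ : ∀ f : F, τ f = ∑ p ∈ f.support, π.arrow (f p : T.Hom p.1 p.2) := fun f =>
    DFinsupp.sumAddHom_apply _ _
  have hinj : Function.Injective τ := by
    rw [injective_iff_map_eq_zero]
    intro f hf
    by_contra hne
    have hsupp : f.support.Nonempty := by
      rwa [Finset.nonempty_iff_ne_empty, Ne, DFinsupp.support_eq_empty]
    -- Take a component with minimal source `m`. Multiplying by `diff d` on the right kills the
    -- larger sources, and by `diff c` on the left the other targets, which isolates `c f(m, n) d`.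
    -- The choice `c = d = f(m, n)*` then gives `f(m, n) = 0`.
    obtain ⟨⟨m, n⟩, hp, hmin⟩ := f.support.exists_min_image Prod.fst hsupp
    have key : ∀ (c : T.Hom n m) (d : T.Hom n m), π.diff c * τ f * π.diff d =
        π.diff (T.comp c (T.comp (f (m, n) : T.Hom m n) d)) := by
      intro c d
      rw [hτ, Finset.mul_sum, Finset.sum_mul, Finset.sum_eq_single (m, n)]
      · have h1 := π.arrow_mul_diff (k := 0) (f (m, n) : T.Hom m n) d
        rw [mul_assoc]
        refine (congrArg _ h1).trans ?_
        exact π.diff_mul_diff c (T.comp (f (m, n) : T.Hom m n) d)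
      · rintro ⟨m', n'⟩ hp' hne'
        rcases (hmin _ hp').eq_or_lt with h | h
        · change m = m' at h
          subst h
          have hn : n' ≠ n := fun h => hne' (by rw [h])
          have h1 := π.arrow_mul_diff (k := 0) (f (m, n') : T.Hom m n') d
          rw [mul_assoc]
          refine (congrArg _ h1).trans ?_
          exact π.diff_mul_diff_of_ne hn c _
        · rw [mul_assoc, π.arrow_mul_diff_of_lt h, mul_zero]
      · exact fun h => absurd hp h
    have h0 := key (T.adj (f (m, n) : T.Hom m n)) (T.adj (f (m, n) : T.Hom m n))
    rw [hf, mul_zero, zero_mul] at h0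
    have h1 := eq_zero_of_adj_comp_comp_adj (hπ _ _ _ h0.symm)
    exact (DFinsupp.mem_support_iff.1 hp) (Subtype.ext h1)
  -- A purely algebraic left inverse: no continuity of `s` is claimed.
  obtain ⟨g, hg⟩ := τ.exists_leftInverse_of_injective (LinearMap.ker_eq_bot.2 hinj)
  refine ⟨(DFinsupp.lsum ℕ fun p : ℕ × ℕ => σ p.1 p.2) ∘ₗ g, fun m n a ha => ?_⟩
  have h1 : τ (DFinsupp.single (m, n) ⟨a, ha⟩) = π.arrow a := DFinsupp.lsum_single _ _ _ _
  rw [← h1, LinearMap.comp_apply, ← LinearMap.comp_apply g, hg]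
  exact DFinsupp.lsum_single _ _ _ _

end TensorRep

variable (T) in
/-- The universal algebra of the whole precategory. -/
abbrev FockAlg : Type u := OAlg (⊤ : T.ClosedIdeal) ⊥ (ClosedIdeal.bot_le_tenCore ⊤)

variable (T) in
/-- The universal representation of the whole precategory. -/
noncomputable abbrev fockRep : TensorRep (⊤ : T.ClosedIdeal) (FockAlg T) :=
  univRep ⊤ ⊥ (ClosedIdeal.bot_le_tenCore ⊤)

/-- Every representation of `T` factors through the universal one, which therefore inherits the
separation of `a` from `a ⊗ 1`. -/
theorem fockRep_isFockFaithful : (fockRep T).IsFockFaithful := by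
  intro m n a ha
  by_contra hne
  obtain ⟨B, _, π, hπ⟩ := exists_rep_ne_ten hne
  have hco : π.IsCoisometric (ClosedIdeal.bot_le_tenCore ⊤) := by
    intro p q b hb
    obtain rfl : b = 0 := (Submodule.mem_bot ℂ).1 hb
    refine (map_zero (π.toFun p q)).trans ((map_zero (π.toFun (p + 1) (q + 1))).symm.trans ?_)
    exact congrArg _ (Subtype.ext (map_zero T.ten).symm)
  obtain ⟨Ψ, hΨ⟩ := exists_lift π hco
  refine hπ ?_
  rw [← hΨ, ← hΨ]
  exact congrArg Ψ (sub_eq_zero.1 ha)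

section universal

variable {K J : T.ClosedIdeal} {hJ : J ≤ K.tenCore}

/-- The closed span of all `π(a) - π(a ⊗ 1)` with `a` in `J` is an ideal. -/
theorem fockRep_mul_mem (J : T.ClosedIdeal) (x y : FockAlg T)
    (hy : y ∈ (Submodule.span ℂ {x | ∃ (m n : ℕ) (a : T.Hom m n), a ∈ J.carrier m n ∧
      (fockRep T).diff a = x}).topologicalClosure) :
    x * y ∈ (Submodule.span ℂ {x | ∃ (m n : ℕ) (a : T.Hom m n), a ∈ J.carrier m n ∧
      (fockRep T).diff a = x}).topologicalClosure ∧
    y * x ∈ (Submodule.span ℂ {x | ∃ (m n : ℕ) (a : T.Hom m n), a ∈ J.carrier m n ∧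
      (fockRep T).diff a = x}).topologicalClosure := by
  refine mul_mem_closedSpan
    (span_univImage_topologicalClosure ⊤ ⊥ (ClosedIdeal.bot_le_tenCore ⊤)) ?_ x y hy
  rintro _ ⟨m, n, ⟨a, _⟩, rfl⟩ _ ⟨l, p, b, hb, rfl⟩
  change (fockRep T).arrow a * (fockRep T).diff b ∈ _ ∧ (fockRep T).diff b * (fockRep T).arrow a ∈ _
  constructor
  · rcases lt_or_ge p m with h | h
    · rw [(fockRep T).arrow_mul_diff_of_lt h]
      exact zero_mem _
    · obtain ⟨k, rfl⟩ := Nat.exists_eq_add_of_le h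
      rw [(fockRep T).arrow_mul_diff]
      exact Submodule.le_topologicalClosure _
        (Submodule.subset_span ⟨_, _, _, J.comp_mem_left _ hb, rfl⟩)
  · rcases lt_or_ge l n with h | h
    · rw [(fockRep T).diff_mul_arrow_of_lt h]
      exact zero_mem _
    · obtain ⟨k, rfl⟩ := Nat.exists_eq_add_of_le h
      rw [(fockRep T).diff_mul_arrow]
      exact Submodule.le_topologicalClosure _
        (Submodule.subset_span ⟨_, _, _, J.comp_mem_right _ hb, rfl⟩)

/-- If `⊗1` is injective on `J`, the universal representation is injective. -/
theorem univRep_injective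
    (h : ∀ (m n : ℕ) (a : T.Hom m n), a ∈ J.carrier m n → T.ten a = 0 → a = 0) {m n : ℕ}
    {a : T.Hom m n} (ha : a ∈ K.carrier m n) (h0 : (univRep K J hJ).toFun m n ⟨a, ha⟩ = 0) :
    a = 0 := by
  let ρ := fockRep T
  have hρ : ρ.IsFockFaithful := fockRep_isFockFaithful
  let R : Set (FockAlg T) :=
    {x | ∃ (m n : ℕ) (a : T.Hom m n), a ∈ J.carrier m n ∧ ρ.diff a = x}
  let I := (Submodule.span ℂ R).topologicalClosure
  have hIc : IsClosed (I : Set (FockAlg T)) := Submodule.isClosed_topologicalClosure _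
  -- Modulo `I` the Fock representation becomes coisometric on `J`, so it factors through `𝒪_T(K,
  -- J)`; if the generator of `a` is zero, then `ρ(a) ∈ I`.
  obtain ⟨Q, _, q, hq0, -⟩ := exists_quotientHom I hIc (fockRep_mul_mem J)
  have hco : ((ρ.map q).restrict (L := K) fun _ _ _ _ => Submodule.mem_top).IsCoisometric hJ := by
    intro p r b hb
    change q (ρ.arrow b) = q (ρ.arrow (T.ten b))
    rw [← sub_eq_zero, ← map_sub, hq0]
    exact Submodule.le_topologicalClosure _ (Submodule.subset_span ⟨p, r, b, hb, rfl⟩)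
  obtain ⟨Ψ, hΨ⟩ := exists_lift _ hco
  have haI : ρ.arrow a ∈ I := by
    rw [← hq0]
    have := hΨ m n ⟨a, ha⟩
    rw [h0, map_zero] at this
    exact this.symm
  -- Each corner of `I` consists of elements `diff b` with `b ∈ J`. This is clear for generators and
  -- passes to limits because `diff` is isometric and so has closed image on `J`.
  have hcorner : ∀ x ∈ I, ∀ {p q r s : ℕ} (c : T.Hom q r) (d : T.Hom s p),
      ρ.diff c * x * ρ.diff d ∈ (J.carrier s r).map ρ.diff := by
    intro x hx p q r s c d
    have hcl : IsClosed ((J.carrier s r).map ρ.diff : Set (FockAlg T)) := by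
      have hi : Isometry (ρ.diff : T.Hom s r →ₗ[ℂ] FockAlg T) :=
        AddMonoidHomClass.isometry_of_norm _ hρ.norm_diff
      rw [Submodule.map_coe]
      exact hi.isClosedEmbedding.isClosedMap _ (J.isClosed s r)
    have hle : I ≤ ((J.carrier s r).map ρ.diff).comap
        (LinearMap.mulRight ℂ (ρ.diff d) ∘ₗ LinearMap.mulLeft ℂ (ρ.diff c)) := by
      refine Submodule.topologicalClosure_minimal _ (Submodule.span_le.2 ?_)
        (hcl.preimage ((continuous_mul_const (ρ.diff d)).comp (continuous_const_mul (ρ.diff c))))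
      rintro _ ⟨m', n', b, hb, rfl⟩
      change ρ.diff c * ρ.diff b * ρ.diff d ∈ (J.carrier s r).map ρ.diff
      by_cases h1 : n' = q
      · subst h1
        by_cases h2 : p = m'
        · subst h2
          rw [ρ.diff_mul_diff, ρ.diff_mul_diff]
          exact ⟨_, J.comp_mem_right _ (J.comp_mem_left _ hb), rfl⟩
        · rw [mul_assoc, ρ.diff_mul_diff_of_ne h2, mul_zero]
          exact zero_mem _
      · rw [ρ.diff_mul_diff_of_ne h1, zero_mul]
        exact zero_mem _
    exact hle hx
  -- A finite combination of generators involves finitely many sources, so its products with `diff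
  -- d` vanish in high degrees. Approximation turns this into smallness for `ρ(a)`.
  have hdecay : ∀ ε > 0, ∃ k, ∀ p ≥ k, ∀ (s : ℕ) (d : T.Hom s p),
      ‖ρ.arrow a * ρ.diff d‖ ≤ ε * ‖d‖ := by
    intro ε hε
    have hspan : ∀ x ∈ Submodule.span ℂ R, ∃ k, ∀ p ≥ k, ∀ (s : ℕ) (d : T.Hom s p),
        x * ρ.diff d = 0 := by
      intro x hx
      induction hx using Submodule.span_induction with
      | mem x hx =>
        obtain ⟨m', n', b, -, rfl⟩ := hx
        exact ⟨m' + 1, fun p hp s d => ρ.diff_mul_diff_of_ne (by omega) b d⟩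
      | zero => exact ⟨0, fun p _ s d => zero_mul _⟩
      | add x y _ _ hx hy =>
        obtain ⟨k, hk⟩ := hx
        obtain ⟨j, hj⟩ := hy
        exact ⟨max k j, fun p hp s d => by
          rw [add_mul, hk p (le_of_max_le_left hp), hj p (le_of_max_le_right hp), add_zero]⟩
      | smul z x _ hx =>
        obtain ⟨k, hk⟩ := hx
        exact ⟨k, fun p hp s d => by rw [smul_mul_assoc, hk p hp, smul_zero]⟩
    obtain ⟨y, hy, hy'⟩ := Metric.mem_closure_iff.1 haI ε hε
    obtain ⟨k, hk⟩ := hspan y hy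
    refine ⟨k, fun p hp s d => ?_⟩
    have : ρ.arrow a * ρ.diff d = (ρ.arrow a - y) * ρ.diff d := by
      rw [sub_mul, hk p hp, sub_zero]
    rw [this]
    refine (norm_mul_le _ _).trans ?_
    rw [hρ.norm_diff, ← dist_eq_norm]
    exact mul_le_mul_of_nonneg_right hy'.le (norm_nonneg _)
  -- The corners of `ρ(a)` in degree `m + k` are the elements `diff (c (a ⊗ 1^k) d)`.
  have hmem : ∀ k, T.tenPow k a ∈ J.carrier (m + k) (n + k) := by
    intro k
    refine J.mem_of_forall_comp_mem fun c d => ?_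
    obtain ⟨b, hb, hb'⟩ := hcorner _ haI c d
    rw [mul_assoc, ρ.arrow_mul_diff, ρ.diff_mul_diff, ← sub_eq_zero, ← map_sub] at hb'
    rw [← sub_eq_zero.1 (hρ _ _ _ hb')]
    exact hb
  have hnorm : ∀ k, ‖T.tenPow k a‖ = ‖a‖ := by
    intro k
    induction k with
    | zero => rfl
    | succ k ih => exact (norm_ten_of_injOn h (hmem k)).trans ih
  refine norm_le_zero_iff.1 (le_of_forall_pos_le_add fun ε hε => ?_)
  rw [zero_add]
  obtain ⟨k, hk⟩ := hdecay ε hε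
  -- Testing with `d = (a ⊗ 1^k)*` gives `‖a‖² ≤ ε ‖a‖`.
  have h1 := hk (m + k) (Nat.le_add_left k m) _ (T.adj (T.tenPow k a))
  rw [ρ.arrow_mul_diff, hρ.norm_diff, norm_adj, hnorm] at h1
  have h2 := T.norm_adj_comp_self (T.adj (T.tenPow k a))
  rw [T.adj_adj, norm_adj, hnorm] at h2
  rw [h2] at h1
  nlinarith [norm_nonneg a]

end universal

end RightTensorCStarPrecategory

/-! ### Extension to multipliers, and the embedding of `𝒪_T(K ∩ M, J ∩ M)` -/

namespace RightTensorCStarPrecategory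

variable {T : RightTensorCStarPrecategory.{u}}

/-- The span of the image of an ideal in the universal algebra of the whole precategory. -/
noncomputable def arrowSpan (L : T.ClosedIdeal) : Submodule ℂ (FockAlg T) :=
  Submodule.span ℂ {x | ∃ (m n : ℕ) (a : T.Hom m n), a ∈ L.carrier m n ∧ (fockRep T).arrow a = x}

theorem arrow_mem_arrowSpan {L : T.ClosedIdeal} {m n : ℕ} {a : T.Hom m n}
    (ha : a ∈ L.carrier m n) : (fockRep T).arrow a ∈ arrowSpan L :=
  Submodule.subset_span ⟨m, n, a, ha, rfl⟩

theorem arrowSpan_induction {L : T.ClosedIdeal} {P : ∀ x, x ∈ arrowSpan L → Prop}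
    (harrow : ∀ {m n : ℕ} (a : T.Hom m n) (ha : a ∈ L.carrier m n),
      P ((fockRep T).arrow a) (arrow_mem_arrowSpan ha))
    (h0 : P 0 (zero_mem _))
    (hadd : ∀ x y hx hy, P x hx → P y hy → P (x + y) (add_mem hx hy))
    (hsmul : ∀ (z : ℂ) x hx, P x hx → P (z • x) (Submodule.smul_mem _ z hx))
    {x : FockAlg T} (hx : x ∈ arrowSpan L) : P x hx := by
  induction hx using Submodule.span_induction with
  | mem x hx => obtain ⟨m, n, a, ha, rfl⟩ := hx; exact harrow a ha
  | zero => exact h0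
  | add x y _ _ hx hy => exact hadd x y _ _ hx hy
  | smul z x _ hx => exact hsmul z x _ hx

theorem star_mem_arrowSpan {L : T.ClosedIdeal} {x : FockAlg T} (hx : x ∈ arrowSpan L) :
    star x ∈ arrowSpan L := by
  induction hx using arrowSpan_induction with
  | harrow a ha =>
    rw [← TensorRep.arrow_adj]
    exact arrow_mem_arrowSpan (L.adj_mem ha)
  | h0 => rw [star_zero]; exact zero_mem _
  | hadd x y _ _ hx hy => rw [star_add]; exact add_mem hx hy
  | hsmul z x _ hx => rw [star_smul]; exact Submodule.smul_mem _ _ hx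

section extension

variable {K M : T.ClosedIdeal}

theorem exists_arrow_mul (hM : M.IsInvariant) {m n l p : ℕ} {a : T.Hom m n}
    (ha : a ∈ K.carrier m n) {b : T.Hom l p} (hb : b ∈ (K ⊓ M).carrier l p) :
    ∃ (q r : ℕ) (c : T.Hom q r), c ∈ (K ⊓ M).carrier q r ∧
      (fockRep T).arrow a * (fockRep T).arrow b = (fockRep T).arrow c ∧ ‖c‖ ≤ ‖a‖ * ‖b‖ := by
  rcases le_total m p with h | h
  · obtain ⟨k, rfl⟩ := Nat.exists_eq_add_of_le h
    refine ⟨_, _, _, (K ⊓ M).comp_mem_left _ hb, (fockRep T).arrow_mul a b, ?_⟩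
    exact (T.norm_comp_le _ _).trans
      (mul_le_mul_of_nonneg_right (norm_tenPow_le k a) (norm_nonneg b))
  · obtain ⟨k, rfl⟩ := Nat.exists_eq_add_of_le h
    refine ⟨_, _, _, ⟨K.comp_mem_right _ ha, M.comp_mem_left _ (hM.tenPow_mem k hb.2)⟩,
      (fockRep T).arrow_mul' a b, ?_⟩
    exact (T.norm_comp_le _ _).trans
      (mul_le_mul_of_nonneg_left (norm_tenPow_le k b) (norm_nonneg a))

theorem arrow_mul_mem_arrowSpan (hM : M.IsInvariant) {m n : ℕ} {a : T.Hom m n}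
    (ha : a ∈ K.carrier m n)
    {x : FockAlg T} (hx : x ∈ arrowSpan (K ⊓ M)) :
    (fockRep T).arrow a * x ∈ arrowSpan (K ⊓ M) := by
  induction hx using arrowSpan_induction with
  | harrow b hb =>
    obtain ⟨q, r, c, hc, h, -⟩ := exists_arrow_mul hM ha hb
    rw [h]
    exact arrow_mem_arrowSpan hc
  | h0 => rw [mul_zero]; exact zero_mem _
  | hadd x y _ _ hx hy => rw [mul_add]; exact add_mem hx hy
  | hsmul z x _ hx => rw [mul_smul_comm]; exact Submodule.smul_mem _ _ hx

theorem mul_arrow_mem_arrowSpan (hM : M.IsInvariant) {m n : ℕ} {a : T.Hom m n}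
    (ha : a ∈ K.carrier m n)
    {x : FockAlg T} (hx : x ∈ arrowSpan (K ⊓ M)) :
    x * (fockRep T).arrow a ∈ arrowSpan (K ⊓ M) := by
  have := star_mem_arrowSpan (arrow_mul_mem_arrowSpan hM (K.adj_mem ha) (star_mem_arrowSpan hx))
  rwa [star_mul, star_star, TensorRep.arrow_adj, star_star] at this

variable {B : Type u} [NonUnitalCStarAlgebra B] {σ : TensorRep (K ⊓ M) B} {s : FockAlg T →ₗ[ℂ] B}

/-- The linear map `s` sends the image of `b` in the universal algebra to `σ b`. -/
def TensorRep.IsExtendedBy {L : T.ClosedIdeal} (σ : TensorRep L B) (s : FockAlg T →ₗ[ℂ] B) : Prop :=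
  ∀ (m n : ℕ) (a : T.Hom m n) (ha : a ∈ L.carrier m n),
    s ((fockRep T).arrow a) = σ.toFun m n ⟨a, ha⟩

theorem map_star_arrowSpan (hs : σ.IsExtendedBy s) {x : FockAlg T} (hx : x ∈ arrowSpan (K ⊓ M)) :
    s (star x) = star (s x) := by
  induction hx using arrowSpan_induction with
  | harrow a ha =>
    rw [← TensorRep.arrow_adj, hs _ _ _ ha, ← σ.map_adj]
    exact hs _ _ _ _
  | h0 => rw [star_zero, map_zero, star_zero]
  | hadd x y _ _ hx hy => rw [star_add, map_add, map_add, star_add, hx, hy]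
  | hsmul z x _ hx => rw [star_smul, map_smul, map_smul, star_smul, hx]

/-- Generators multiply by the same formula in the Fock algebra and under `σ`. Nothing is known
about `s` outside `arrowSpan (K ⊓ M)`. -/
theorem map_mul_arrowSpan (hs : σ.IsExtendedBy s) {x y : FockAlg T} (hx : x ∈ arrowSpan (K ⊓ M))
    (hy : y ∈ arrowSpan (K ⊓ M)) : s (x * y) = s x * s y := by
  induction hx using arrowSpan_induction with
  | h0 => rw [zero_mul, map_zero, zero_mul]
  | hadd x x' _ _ hx hx' => rw [add_mul, map_add, map_add, add_mul, hx, hx']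
  | hsmul z x _ hx => rw [smul_mul_assoc, map_smul, map_smul, smul_mul_assoc, hx]
  | @harrow m n a ha =>
  induction hy using arrowSpan_induction with
  | h0 => rw [mul_zero, map_zero, mul_zero]
  | hadd y y' _ _ hy hy' => rw [mul_add, map_add, map_add, mul_add, hy, hy']
  | hsmul z x _ hx => rw [mul_smul_comm, map_smul, map_smul, mul_smul_comm, hx]
  | @harrow l p b hb =>
  rw [hs _ _ _ ha, hs _ _ _ hb]
  rcases le_total m p with h | h
  · obtain ⟨k, rfl⟩ := Nat.exists_eq_add_of_le h
    rw [TensorRep.arrow_mul, σ.map_tenPow_comp]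
    exact hs _ _ _ _
  · obtain ⟨k, rfl⟩ := Nat.exists_eq_add_of_le h
    rw [TensorRep.arrow_mul', σ.map_comp_tenPow]
    exact hs _ _ _ _

/-- As for the Fock operators: a crude bound in `c` exists for each `x`, and `‖s(ρ(c) x)‖² = ‖s(x)*
s(ρ(c* c) x)‖ ≤ ‖s x‖ ‖s(ρ(c* c) x)‖` improves it on `K(m, m)`. In particular `s x = 0` forces
`s(ρ(a) x) = 0`, so `ρ(a)` acts on the image of `s`. -/
theorem norm_arrow_mul_le (hs : σ.IsExtendedBy s) (hM : M.IsInvariant) {m n : ℕ}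
    {a : T.Hom m n} (ha : a ∈ K.carrier m n)
    {x : FockAlg T} (hx : x ∈ arrowSpan (K ⊓ M)) :
    ‖s ((fockRep T).arrow a * x)‖ ≤ ‖a‖ * ‖s x‖ := by
  have hb : ∃ C : ℝ, ∀ c ∈ K.carrier m m, ‖s ((fockRep T).arrow c * x)‖ ≤ C * ‖c‖ := by
    induction hx using arrowSpan_induction with
    | harrow b hb =>
      refine ⟨‖b‖, fun c hc => ?_⟩
      obtain ⟨q, r, d, hd, h, hn⟩ := exists_arrow_mul hM hc hb
      rw [h, hs _ _ _ hd, mul_comm]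
      exact (σ.norm_toFun_le _).trans hn
    | h0 => exact ⟨0, fun c _ => by rw [mul_zero, map_zero, norm_zero, zero_mul]⟩
    | hadd x y _ _ hx hy =>
      obtain ⟨C, hC⟩ := hx
      obtain ⟨D, hD⟩ := hy
      refine ⟨C + D, fun c hc => ?_⟩
      rw [mul_add, map_add, add_mul]
      exact (norm_add_le _ _).trans (add_le_add (hC c hc) (hD c hc))
    | hsmul z x _ hx =>
      obtain ⟨C, hC⟩ := hx
      refine ⟨‖z‖ * C, fun c hc => ?_⟩
      rw [mul_smul_comm, map_smul, norm_smul, mul_assoc]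
      exact mul_le_mul_of_nonneg_left (hC c hc) (norm_nonneg z)
  obtain ⟨C, hC⟩ := hb
  have hsq : ∀ {r : ℕ} (c : T.Hom m r), c ∈ K.carrier m r →
      ‖s ((fockRep T).arrow c * x)‖ ^ 2 ≤
        ‖s x‖ * ‖s ((fockRep T).arrow (T.comp (T.adj c) c) * x)‖ := by
    intro r c hc
    have hcx := arrow_mul_mem_arrowSpan hM hc hx
    have h1 : (fockRep T).arrow (T.comp (T.adj c) c) =
        star ((fockRep T).arrow c) * (fockRep T).arrow c := by
      rw [← TensorRep.arrow_adj]
      exact ((fockRep T).arrow_mul (k := 0) (T.adj c) c).symm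
    rw [pow_two, ← CStarRing.norm_star_mul_self, ← map_star_arrowSpan hs hcx,
      ← map_mul_arrowSpan hs (star_mem_arrowSpan hcx) hcx, star_mul, mul_assoc,
      ← mul_assoc (star ((fockRep T).arrow c)), ← h1,
      map_mul_arrowSpan hs (star_mem_arrowSpan hx)
        (arrow_mul_mem_arrowSpan hM (K.comp_mem_left _ hc) hx), map_star_arrowSpan hs hx]
    exact (norm_mul_le _ _).trans_eq (by rw [norm_star])
  have hcl : IsClosed (TensorRep.diagSub K m : Set (T.Diag m)) := K.isClosed m m
  have hmem : T.comp (T.adj a) a ∈ K.carrier m m := K.comp_mem_left _ ha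
  have h1 : ‖s ((fockRep T).arrow (T.comp (T.adj a) a) * x)‖ ≤ ‖s x‖ * ‖T.comp (T.adj a) a‖ :=
    norm_le_of_sq_norm_le (A := TensorRep.diagSub K m)
      (fun c => s ((fockRep T).arrow (m := m) (n := m) c.1 * x)) (norm_nonneg (s x))
      (fun c => hC c.1 c.2) (fun c => hsq (r := m) c.1 c.2)
      (⟨show T.Diag m from _, hmem⟩ : TensorRep.diagSub K m)
  refine (sq_le_sq₀ (norm_nonneg _) (by positivity)).1 ?_
  calc _ ≤ ‖s x‖ * ‖s ((fockRep T).arrow (T.comp (T.adj a) a) * x)‖ := hsq a ha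
    _ ≤ ‖s x‖ * (‖s x‖ * ‖T.comp (T.adj a) a‖) := mul_le_mul_of_nonneg_left h1 (norm_nonneg _)
    _ = _ := by rw [T.norm_adj_comp_self]; ring

theorem norm_mul_arrow_le (hs : σ.IsExtendedBy s) (hM : M.IsInvariant) {m n : ℕ}
    {a : T.Hom m n} (ha : a ∈ K.carrier m n)
    {x : FockAlg T} (hx : x ∈ arrowSpan (K ⊓ M)) :
    ‖s (x * (fockRep T).arrow a)‖ ≤ ‖a‖ * ‖s x‖ := by
  have hx' := star_mem_arrowSpan hx
  have := norm_arrow_mul_le hs hM (K.adj_mem ha) hx'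
  rwa [norm_adj, TensorRep.arrow_adj, ← star_mul,
    map_star_arrowSpan hs (mul_arrow_mem_arrowSpan hM ha hx), norm_star,
    map_star_arrowSpan hs hx, norm_star] at this

/-- A representation of `K ∩ M` with dense span extends to a representation of `K` in the
multiplier algebra. -/
theorem exists_multiplierRep (hs : σ.IsExtendedBy s) (hM : M.IsInvariant)
    (hd : ∀ y : B, y ∈ closure (s '' (arrowSpan (K ⊓ M) : Set (FockAlg T)))) :
    ∃ π : TensorRep K (DoubleCentralizer ℂ B),
      ∀ (m n : ℕ) (a : T.Hom m n) (ha : a ∈ K.carrier m n), ∀ x ∈ arrowSpan (K ⊓ M),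
        (π.toFun m n ⟨a, ha⟩).fst (s x) = s ((fockRep T).arrow a * x) ∧
        (π.toFun m n ⟨a, ha⟩).snd (s x) = s (x * (fockRep T).arrow a) := by
  let S := arrowSpan (K ⊓ M)
  let e : S →ₗ[ℂ] B := s ∘ₗ S.subtype
  have he : DenseRange e := by
    intro y
    refine closure_mono ?_ (hd y)
    rintro _ ⟨x, hx, rfl⟩
    exact ⟨⟨x, hx⟩, rfl⟩
  have hext : ∀ f g : B →L[ℂ] B, (∀ x ∈ S, f (s x) = g (s x)) → f = g := by
    intro f g h
    refine ContinuousLinearMap.coeFn_injective ?_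
    exact he.equalizer f.continuous g.continuous (funext fun x => h x.1 x.2)
  -- Left multiplication by `ρ(a)`, read through `s`; `r` below is right multiplication. The bounds
  -- by `‖a‖ ‖s x‖` let both descend to the range of `e` and extend to `B`.
  let l : ∀ {m n : ℕ}, K.carrier m n → S →ₗ[ℂ] B := fun a =>
    s ∘ₗ LinearMap.mulLeft ℂ ((fockRep T).arrow a.1) ∘ₗ S.subtype
  let r : ∀ {m n : ℕ}, K.carrier m n → S →ₗ[ℂ] B := fun a =>
    s ∘ₗ LinearMap.mulRight ℂ ((fockRep T).arrow a.1) ∘ₗ S.subtype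
  have hl : ∀ {m n : ℕ} (a : K.carrier m n), ∀ x ∈ S,
      (l a).extendOfNorm e (s x) = s ((fockRep T).arrow (a : T.Hom m n) * x) := fun a x hx =>
    LinearMap.extendOfNorm_eq (f := l a) (e := e) he
      ⟨‖a.1‖, fun x => norm_arrow_mul_le hs hM a.2 x.2⟩ ⟨x, hx⟩
  have hr : ∀ {m n : ℕ} (a : K.carrier m n), ∀ x ∈ S,
      (r a).extendOfNorm e (s x) = s (x * (fockRep T).arrow (a : T.Hom m n)) := fun a x hx =>
    LinearMap.extendOfNorm_eq (f := r a) (e := e) he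
      ⟨‖a.1‖, fun x => norm_mul_arrow_le hs hM a.2 x.2⟩ ⟨x, hx⟩
  have hcentral : ∀ {m n : ℕ} (a : K.carrier m n) (x y : B),
      (r a).extendOfNorm e x * y = x * (l a).extendOfNorm e y := by
    intro m n a x y
    refine he.induction_on₂
      (p := fun x y => (r a).extendOfNorm e x * y = x * (l a).extendOfNorm e y) ?_ ?_ x y
    · exact isClosed_eq (by fun_prop) (by fun_prop)
    · rintro ⟨x, hx⟩ ⟨y, hy⟩
      change (r a).extendOfNorm e (s x) * s y = s x * (l a).extendOfNorm e (s y)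
      rw [hr a x hx, hl a y hy,
        ← map_mul_arrowSpan hs (mul_arrow_mem_arrowSpan hM a.2 hx) hy,
        ← map_mul_arrowSpan hs hx (arrow_mul_mem_arrowSpan hM a.2 hy), mul_assoc]
  let c : ∀ {m n : ℕ}, K.carrier m n → DoubleCentralizer ℂ B := fun a =>
    ⟨((l a).extendOfNorm e, (r a).extendOfNorm e), hcentral a⟩
  have hc1 : ∀ {m n : ℕ} (a : K.carrier m n), ∀ x ∈ S,
      (c a).fst (s x) = s ((fockRep T).arrow (a : T.Hom m n) * x) := hl
  have hc2 : ∀ {m n : ℕ} (a : K.carrier m n), ∀ x ∈ S,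
      (c a).snd (s x) = s (x * (fockRep T).arrow (a : T.Hom m n)) := hr
  have hdc : ∀ f g : DoubleCentralizer ℂ B, (∀ x ∈ S, f.fst (s x) = g.fst (s x)) →
      (∀ x ∈ S, f.snd (s x) = g.snd (s x)) → f = g := fun f g h1 h2 =>
    DoubleCentralizer.ext ℂ B f g (Prod.ext (hext _ _ h1) (hext _ _ h2))
  -- Every relation `ρ(a) ρ(b) = ρ(d)` in the Fock algebra passes to the multipliers; composition
  -- and the tensor relation are both instances.
  have hmul : ∀ {m n m' n' q r : ℕ} (a : K.carrier m n) (b : K.carrier m' n') (d : K.carrier q r),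
      (fockRep T).arrow (a : T.Hom m n) * (fockRep T).arrow (b : T.Hom m' n') =
        (fockRep T).arrow (d : T.Hom q r) → c a * c b = c d := by
    intro m n m' n' q r a b d h
    refine hdc _ _ (fun x hx => ?_) fun x hx => ?_
    · rw [DoubleCentralizer.mul_fst, mul_apply_eq_comp, hc1 b x hx,
        hc1 a _ (arrow_mul_mem_arrowSpan hM b.2 hx), hc1 d x hx, ← mul_assoc, h]
    · rw [DoubleCentralizer.mul_snd, mul_apply_eq_comp, hc2 a x hx,
        hc2 b _ (mul_arrow_mem_arrowSpan hM a.2 hx), hc2 d x hx, mul_assoc, h]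
  refine ⟨{ toFun := fun m n => { toFun := c, map_add' := ?_, map_smul' := ?_ }
            map_adj := ?_, map_comp := ?_, map_tenPow_comp := ?_ },
    fun m n a ha x hx => ⟨hc1 ⟨a, ha⟩ x hx, hc2 ⟨a, ha⟩ x hx⟩⟩
  · intro a b
    refine hdc _ _ (fun x hx => ?_) fun x hx => ?_
    · rw [DoubleCentralizer.add_fst, add_apply, hc1 _ x hx, hc1 _ x hx, hc1 _ x hx,
        Submodule.coe_add, map_add, add_mul, map_add]
    · rw [DoubleCentralizer.add_snd, add_apply, hc2 _ x hx, hc2 _ x hx, hc2 _ x hx,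
        Submodule.coe_add, map_add, mul_add, map_add]
  · intro z a
    refine hdc _ _ (fun x hx => ?_) fun x hx => ?_
    · rw [RingHom.id_apply, DoubleCentralizer.smul_fst, smul_apply, hc1 _ x hx, hc1 _ x hx,
        Submodule.coe_smul, map_smul, smul_mul_assoc, map_smul]
    · rw [RingHom.id_apply, DoubleCentralizer.smul_snd, smul_apply, hc2 _ x hx, hc2 _ x hx,
        Submodule.coe_smul, map_smul, mul_smul_comm, map_smul]
  · intro m n a
    change c _ = star (c a)
    refine hdc _ _ (fun x hx => ?_) fun x hx => ?_
    · rw [DoubleCentralizer.star_fst, hc1 _ x hx, ← map_star_arrowSpan hs hx,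
        hc2 _ _ (star_mem_arrowSpan hx), ← map_star_arrowSpan hs
          (mul_arrow_mem_arrowSpan hM a.2 (star_mem_arrowSpan hx)), star_mul, star_star,
        TensorRep.arrow_adj]
    · rw [DoubleCentralizer.star_snd, hc2 _ x hx, ← map_star_arrowSpan hs hx,
        hc1 _ _ (star_mem_arrowSpan hx), ← map_star_arrowSpan hs
          (arrow_mul_mem_arrowSpan hM a.2 (star_mem_arrowSpan hx)), star_mul, star_star,
        TensorRep.arrow_adj]
  · intro l m n a b
    exact (hmul a b _ ((fockRep T).arrow_mul (k := 0) (a : T.Hom m n) (b : T.Hom l m))).symm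
  · intro l m n k a b
    exact hmul a b _ ((fockRep T).arrow_mul (a : T.Hom m n) (b : T.Hom l (m + k)))

/-- The source of coisometry for the extension. Either `b` has target beyond `m` and the product is
zero, or the product is `diff` of an arrow in `J ∩ M`, where `σ` is coisometric. -/
theorem diff_mul_arrowSpan (hM : M.IsInvariant) {J : T.ClosedIdeal} (hJ : J ≤ K.tenCore)
    (hs : σ.IsExtendedBy s)
    (hσ : σ.IsCoisometric (ClosedIdeal.inf_le_tenCore hJ hM)) {m n : ℕ} {a : T.Hom m n}
    (ha : a ∈ J.carrier m n) {x : FockAlg T} (hx : x ∈ arrowSpan (K ⊓ M)) :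
    s ((fockRep T).diff a * x) = 0 := by
  induction hx using arrowSpan_induction with
  | h0 => rw [mul_zero, map_zero]
  | hadd x y _ _ hx hy => rw [mul_add, map_add, hx, hy, add_zero]
  | hsmul z x _ hx => rw [mul_smul_comm, map_smul, hx, smul_zero]
  | @harrow l p b hb =>
  rcases lt_or_ge m p with h | h
  · rw [(fockRep T).diff_mul_arrow_of_lt h, map_zero]
  · obtain ⟨k, rfl⟩ := Nat.exists_eq_add_of_le h
    rw [(fockRep T).diff_mul_arrow, TensorRep.diff_apply, map_sub, sub_eq_zero]
    have hmem : T.comp a (T.tenPow k b) ∈ (J ⊓ M).carrier (l + k) n :=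
      ⟨J.comp_mem_right _ ha, M.comp_mem_left _ (hM.tenPow_mem k hb.2)⟩
    have hmem' := ClosedIdeal.inf_le_tenCore hJ hM _ _ hmem
    exact (hs _ _ _ hmem'.2).trans ((hσ _ _ _ hmem).trans (hs _ _ _ hmem'.1).symm)

end extension

section universal

variable {K J : T.ClosedIdeal} {hJ : J ≤ K.tenCore}

/-- `𝒪_T(K ∩ M, J ∩ M)` embeds in `𝒪_T(K, J)`. -/
theorem exists_injective_hom {M : T.ClosedIdeal} (hM : M.IsInvariant) :
    ∃ Θ : OAlg (K ⊓ M) (J ⊓ M) (ClosedIdeal.inf_le_tenCore hJ hM) →⋆ₙₐ[ℂ] OAlg K J hJ,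
      Function.Injective Θ ∧
      ∀ (m n : ℕ) (a : T.Hom m n) (ha : a ∈ (K ⊓ M).carrier m n),
        Θ ((univRep (K ⊓ M) (J ⊓ M) (ClosedIdeal.inf_le_tenCore hJ hM)).toFun m n ⟨a, ha⟩) =
          (univRep K J hJ).toFun m n ⟨a, ha.1⟩ := by
  have hJM := ClosedIdeal.inf_le_tenCore hJ hM
  let σ := univRep (K ⊓ M) (J ⊓ M) hJM
  have hσ : σ.IsCoisometric hJM := univRep_isCoisometric _ _ _
  obtain ⟨s, hs⟩ := fockRep_isFockFaithful.exists_linearMap (L := K ⊓ M) σ.toFun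
  have hd : ∀ y, y ∈ closure (s '' (arrowSpan (K ⊓ M) : Set (FockAlg T))) := by
    have hle : (Submodule.span ℂ (univImage (K ⊓ M) (J ⊓ M) hJM)).topologicalClosure ≤
        ((arrowSpan (K ⊓ M)).map s).topologicalClosure := by
      refine Submodule.topologicalClosure_mono (Submodule.span_le.2 ?_)
      rintro _ ⟨m, n, ⟨a, ha⟩, rfl⟩
      exact ⟨_, arrow_mem_arrowSpan ha, hs m n a ha⟩
    rw [span_univImage_topologicalClosure] at hle
    exact fun y => hle (Submodule.mem_top (x := y))
  obtain ⟨π, hπ⟩ := exists_multiplierRep hs hM hd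
  have hext : ∀ f g : DoubleCentralizer ℂ (OAlg (K ⊓ M) (J ⊓ M) hJM),
      (∀ x ∈ arrowSpan (K ⊓ M), f.fst (s x) = g.fst (s x)) →
      (∀ x ∈ arrowSpan (K ⊓ M), f.snd (s x) = g.snd (s x)) → f = g := by
    have : ∀ f g : OAlg (K ⊓ M) (J ⊓ M) hJM →L[ℂ] OAlg (K ⊓ M) (J ⊓ M) hJM,
        (∀ x ∈ arrowSpan (K ⊓ M), f (s x) = g (s x)) → f = g := by
      intro f g h
      ext y
      refine closure_minimal (t := {y | f y = g y}) ?_ (isClosed_eq f.continuous g.continuous)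
        (hd y)
      rintro _ ⟨x, hx, rfl⟩
      exact h x hx
    exact fun f g h1 h2 => DoubleCentralizer.ext _ _ f g (Prod.ext (this _ _ h1) (this _ _ h2))
  have hco : π.IsCoisometric hJ := by
    intro m n a ha
    refine hext _ _ (fun x hx => ?_) fun x hx => ?_
    · refine (hπ m n a (hJ m n ha).2 x hx).1.trans
        (Eq.trans ?_ (hπ _ _ (T.ten a) (hJ m n ha).1 x hx).1.symm)
      rw [← sub_eq_zero, ← map_sub, ← sub_mul]
      exact diff_mul_arrowSpan hM hJ hs hσ ha hx
    · refine (hπ m n a (hJ m n ha).2 x hx).2.trans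
        (Eq.trans ?_ (hπ _ _ (T.ten a) (hJ m n ha).1 x hx).2.symm)
      rw [← sub_eq_zero, ← map_sub, ← mul_sub, ← TensorRep.diff_apply]
      -- Right multiplication is reduced to left multiplication by taking adjoints.
      have h1 := diff_mul_arrowSpan hM hJ hs hσ (J.adj_mem ha) (star_mem_arrowSpan hx)
      have h2 : x * (fockRep T).diff a ∈ arrowSpan (K ⊓ M) := by
        rw [TensorRep.diff_apply, mul_sub]
        exact sub_mem (mul_arrow_mem_arrowSpan hM (hJ m n ha).2 hx)
          (mul_arrow_mem_arrowSpan (K := K) (a := T.ten a) hM (hJ m n ha).1 hx)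
      rwa [TensorRep.diff_adj, ← star_mul, map_star_arrowSpan hs h2, star_eq_zero] at h1
  obtain ⟨Ψ, hΨ⟩ := exists_lift π hco
  have hco' : ((univRep K J hJ).restrict (L := K ⊓ M) fun _ _ _ h => h.1).IsCoisometric hJM :=
    fun m n a ha => univRep_isCoisometric K J hJ m n a ha.1
  obtain ⟨Θ, hΘ⟩ := exists_lift _ hco'
  refine ⟨Θ, ?_, fun m n a ha => hΘ m n ⟨a, ha⟩⟩
  -- On generators, the extension `π` restricted to `K ∩ M` is `σ` followed by the inclusion in the
  -- multipliers.
  have hcomp : Ψ.comp Θ = DoubleCentralizer.coeHom (𝕜 := ℂ) := by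
    refine OAlg.hom_ext fun m n a => ?_
    have h1 : Ψ (Θ (σ.toFun m n a)) = π.toFun m n ⟨a, a.2.1⟩ := by
      rw [hΘ]
      exact hΨ m n ⟨a, a.2.1⟩
    refine h1.trans (hext _ _ (fun x hx => ?_) fun x hx => ?_)
    · rw [(hπ _ _ _ _ x hx).1, map_mul_arrowSpan hs (arrow_mem_arrowSpan a.2) hx, hs _ _ _ a.2]
      rfl
    · rw [(hπ _ _ _ _ x hx).2, map_mul_arrowSpan hs hx (arrow_mem_arrowSpan a.2), hs _ _ _ a.2]
      rfl
  rw [injective_iff_map_eq_zero]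
  intro x hx
  -- The multiplier of `x` sends `x*` to `x x*`, so the inclusion is injective.
  have h1 : (DoubleCentralizer.coeHom (𝕜 := ℂ) x).fst (star x) = 0 := by
    rw [← hcomp, NonUnitalStarAlgHom.comp_apply, hx, map_zero]
    rfl
  exact CStarRing.mul_star_self_eq_zero_iff x |>.1 h1

/-- An injective `*`-homomorphism is isometric, so the range of `Θ` is closed and equals the closed
span of the images of the generators. -/
theorem isNaturallyIsoInf_idealSpan {M : T.ClosedIdeal} (hM : M.IsInvariant) :
    IsNaturallyIsoInf (idealSpan K J hJ M) hM := by
  obtain ⟨Θ, hinj, hΘ⟩ := exists_injective_hom (hJ := hJ) hM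
  have hiso : Isometry Θ := NonUnitalStarAlgHom.isometry Θ hinj
  let f := (Θ : OAlg (K ⊓ M) (J ⊓ M) (ClosedIdeal.inf_le_tenCore hJ hM) →ₗ[ℂ] OAlg K J hJ)
  have hmem : ∀ x, Θ x ∈ idealSpan K J hJ M := by
    intro x
    have hle : (Submodule.span ℂ (univImage (K ⊓ M) (J ⊓ M)
        (ClosedIdeal.inf_le_tenCore hJ hM))).topologicalClosure ≤
        (idealSpan K J hJ M).comap f := by
      refine Submodule.topologicalClosure_minimal _ (Submodule.span_le.2 ?_)
        ((Submodule.isClosed_topologicalClosure _).preimage hiso.continuous)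
      rintro _ ⟨m, n, ⟨a, ha⟩, rfl⟩
      exact Submodule.le_topologicalClosure _ 
        (Submodule.subset_span ⟨m, n, a, ha, (hΘ m n a ha).symm⟩)
    rw [span_univImage_topologicalClosure] at hle
    exact hle (Submodule.mem_top (x := x))
  have hsurj : idealSpan K J hJ M ≤ LinearMap.range f := by
    refine Submodule.topologicalClosure_minimal _ (Submodule.span_le.2 ?_)
      hiso.isClosedEmbedding.isClosed_range
    rintro _ ⟨m, n, a, ha, rfl⟩
    exact ⟨_, hΘ m n a ha⟩
  let F := f.codRestrict (idealSpan K J hJ M) hmem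
  have hF : Function.Surjective F := by
    rintro ⟨y, hy⟩
    obtain ⟨x, hx⟩ := hsurj hy
    exact ⟨x, Subtype.ext hx⟩
  refine ⟨LinearIsometryEquiv.ofSurjective ⟨F, fun x => NonUnitalStarAlgHom.norm_map Θ hinj x⟩ hF,
    fun x y => map_mul Θ x y, fun x => map_star Θ x, hΘ⟩

end universal

end RightTensorCStarPrecategory

/-! ### Saturation and the preimage of `𝒪(N)` -/

namespace RightTensorCStarPrecategory

variable {T : RightTensorCStarPrecategory.{u}}

namespace TensorRep

variable {K : T.ClosedIdeal} {B : Type u} [NonUnitalCStarAlgebra B]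

theorem continuous_toFun (π : TensorRep K B) (m n : ℕ) : Continuous (π.toFun m n) :=
  AddMonoidHomClass.continuous_of_bound (π.toFun m n) 1
    (fun a => by rw [one_mul]; exact π.norm_toFun_le a)

/-- The kernel of a right tensor representation. -/
def ker (π : TensorRep K B) : T.ClosedIdeal where
  carrier m n := (LinearMap.ker (π.toFun m n)).map (K.carrier m n).subtype
  isClosed m n := by
    rw [Submodule.map_coe]
    exact (K.isClosed m n).isClosedEmbedding_subtypeVal.isClosedMap _
      (isClosed_singleton.preimage (π.continuous_toFun m n))
  comp_mem_left := by
    rintro l m n a _ ⟨b, hb, rfl⟩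
    have hb' : π.toFun l m b = 0 := hb
    refine ⟨⟨T.comp a (b : T.Hom l m), K.comp_mem_left a b.2⟩, ?_, rfl⟩
    set x : K.carrier l n := ⟨T.comp a (b : T.Hom l m), K.comp_mem_left a b.2⟩
    change π.toFun l n x = 0
    -- The arrow `a` need not lie in `K`, so `π(a)` has no meaning. But for `x = a b` one has `x* x
    -- = (x* a) b` with `x* a ∈ K`, and `π` is zero on it.
    rw [← CStarRing.star_mul_self_eq_zero_iff, ← π.map_adj, ← π.map_comp]
    refine Eq.trans ?_ ((π.map_comp ⟨T.comp (T.adj (x : T.Hom l n)) a,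
      K.comp_mem_right a (K.adj_mem x.2)⟩ b).trans (by rw [hb', mul_zero]))
    exact congrArg _ (Subtype.ext (T.comp_assoc _ _ _).symm)
  comp_mem_right := by
    rintro l m n _ b ⟨a, ha, rfl⟩
    have ha' : π.toFun m n a = 0 := ha
    refine ⟨⟨T.comp (a : T.Hom m n) b, K.comp_mem_right b a.2⟩, ?_, rfl⟩
    set x : K.carrier l n := ⟨T.comp (a : T.Hom m n) b, K.comp_mem_right b a.2⟩
    change π.toFun l n x = 0
    rw [← CStarRing.mul_star_self_eq_zero_iff, ← π.map_adj, ← π.map_comp]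
    refine Eq.trans ?_ ((π.map_comp a ⟨T.comp b (T.adj (x : T.Hom l n)),
      K.comp_mem_left b (K.adj_mem x.2)⟩).trans (by rw [ha', zero_mul]))
    exact congrArg _ (Subtype.ext (T.comp_assoc _ _ _))

theorem mem_ker {π : TensorRep K B} {m n : ℕ} {a : T.Hom m n} :
    a ∈ π.ker.carrier m n ↔ ∃ ha : a ∈ K.carrier m n, π.toFun m n ⟨a, ha⟩ = 0 := by
  constructor
  · rintro ⟨⟨a, ha⟩, h, rfl⟩
    exact ⟨ha, h⟩
  · rintro ⟨ha, h⟩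
    exact ⟨⟨a, ha⟩, h, rfl⟩

end TensorRep

/-- The largest ideal `M` with `M K ⊆ P`. -/
def ClosedIdeal.residual (P K : T.ClosedIdeal) : T.ClosedIdeal where
  carrier m n := ⨅ (l : ℕ) (d : K.carrier l m), (P.carrier l n).comap (compₗ.flip (d : T.Hom l m))
  isClosed m n := by
    simp only [Submodule.coe_iInf]
    exact isClosed_iInter fun l => isClosed_iInter fun d =>
      (P.isClosed l n).preimage (continuous_comp_right _)
  comp_mem_left := by
    intro l m n a b hb
    simp only [Submodule.mem_iInf, Submodule.mem_comap] at hb ⊢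
    intro k d
    change T.comp (T.comp a b) d.1 ∈ P.carrier k n
    rw [T.comp_assoc]
    exact P.comp_mem_left a (hb k d)
  comp_mem_right := by
    intro l m n a b ha
    simp only [Submodule.mem_iInf, Submodule.mem_comap] at ha ⊢
    intro k d
    change T.comp (T.comp a b) d.1 ∈ P.carrier k n
    rw [T.comp_assoc]
    exact ha k ⟨_, K.comp_mem_left b d.2⟩

theorem ClosedIdeal.mem_residual {P K : T.ClosedIdeal} {m n : ℕ} {a : T.Hom m n} :
    a ∈ (P.residual K).carrier m n ↔
      ∀ (l : ℕ) (d : T.Hom l m), d ∈ K.carrier l m → T.comp a d ∈ P.carrier l n := by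
  simp only [ClosedIdeal.residual, Submodule.mem_iInf, Submodule.mem_comap]
  exact ⟨fun h l d hd => h l ⟨d, hd⟩, fun h l d => h l d d.2⟩

/-- A representation coisometric on `J` which vanishes on `K ∩ N` vanishes on `K ∩ S_J(N)`. -/
theorem TensorRep.IsCoisometric.inf_saturation_le_ker {K J N : T.ClosedIdeal}
    {hJ : J ≤ K.tenCore} {B : Type u} [NonUnitalCStarAlgebra B] {π : TensorRep K B}
    (hπ : π.IsCoisometric hJ) (h : K ⊓ N ≤ π.ker) : K ⊓ J.saturation N ≤ π.ker := by
  -- Testing the residual against `a* ∈ K` gives `π(a) π(a)* = 0`.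
  have key : ∀ {m n : ℕ} (a : T.Hom m n) (ha : a ∈ K.carrier m n),
      a ∈ (π.ker.residual K).carrier m n → π.toFun m n ⟨a, ha⟩ = 0 := by
    intro m n a ha h
    obtain ⟨h1, h2⟩ := TensorRep.mem_ker.1
      (ClosedIdeal.mem_residual.1 h n (T.adj a) (K.adj_mem ha))
    rw [← CStarRing.mul_star_self_eq_zero_iff, ← π.map_adj, ← π.map_comp]
    exact h2
  -- The kernel lies inside `K` and so need not contain `N`; its residual does.
  have hN : N ≤ π.ker.residual K := fun m n a ha => ClosedIdeal.mem_residual.2 fun l d hd =>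
    h l n ⟨K.comp_mem_left a hd, N.comp_mem_right d ha⟩
  -- If `a ∈ J` and `a ⊗ 1` is in the residual, then `π(a) = π(a ⊗ 1) = 0` by coisometry.
  have hsat : J.IsSaturated (π.ker.residual K) := by
    intro m n a ha
    have h0 : a ∈ π.ker.carrier m n :=
      TensorRep.mem_ker.2 ⟨(hJ m n ha.1).2, (hπ m n a ha.1).trans (key _ _ ha.2)⟩
    exact ClosedIdeal.mem_residual.2 fun l d _ => π.ker.comp_mem_right d h0
  exact fun m n a ha => TensorRep.mem_ker.2
    ⟨ha.1, key a ha.1 (ClosedIdeal.saturation_le hN hsat m n ha.2)⟩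

section universal

variable {K J : T.ClosedIdeal} {hJ : J ≤ K.tenCore}

theorem toFun_mem_idealSpan {N : T.ClosedIdeal} {m n : ℕ} {a : T.Hom m n}
    (ha : a ∈ (K ⊓ N).carrier m n) :
    (univRep K J hJ).toFun m n ⟨a, ha.1⟩ ∈ idealSpan K J hJ N :=
  Submodule.le_topologicalClosure _ (Submodule.subset_span ⟨m, n, a, ha, rfl⟩)

theorem idealSpan_mono {N N' : T.ClosedIdeal} (h : N ≤ N') :
    idealSpan K J hJ N ≤ idealSpan K J hJ N' := by
  refine Submodule.topologicalClosure_mono (Submodule.span_mono ?_)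
  rintro _ ⟨m, n, a, ha, rfl⟩
  exact ⟨m, n, a, ⟨ha.1, h m n ha.2⟩, rfl⟩

/-- The universal representation modulo `𝒪(N)` is coisometric on `J` and kills `K ∩ N`, hence also
`K ∩ S_J(N)`. -/
theorem toFun_mem_idealSpan_of_mem_saturation {N : T.ClosedIdeal} (hN : N.IsInvariant) {m n : ℕ}
    {a : T.Hom m n} (ha : a ∈ K.carrier m n) (h : a ∈ (J.saturation N).carrier m n) :
    (univRep K J hJ).toFun m n ⟨a, ha⟩ ∈ idealSpan K J hJ N := by
  obtain ⟨Q, _, q, hq, -⟩ := exists_quotientHom (idealSpan K J hJ N)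
    (Submodule.isClosed_topologicalClosure _) (mul_mem_idealSpan K J hJ hN)
  have hco : ((univRep K J hJ).map q).IsCoisometric hJ := fun m n a ha =>
    congrArg q (univRep_isCoisometric K J hJ m n a ha)
  have hker : K ⊓ N ≤ ((univRep K J hJ).map q).ker := fun m n a ha =>
    TensorRep.mem_ker.2 ⟨ha.1, (hq _).2 (toFun_mem_idealSpan ha)⟩
  obtain ⟨_, h0⟩ := TensorRep.mem_ker.1 (hco.inf_saturation_le_ker hker m n ⟨ha, h⟩)
  exact (hq _).1 h0

/-- Saturation of `S` means that `⊗1` is injective on `J/S`, so the universal representation of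
`K/S` is injective; it kills the class of `a`. -/
theorem mem_of_toFun_mem_idealSpan {S : T.ClosedIdeal} (hS : S.IsInvariant) (hS' : J.IsSaturated S)
    {m n : ℕ} {a : T.Hom m n} (ha : a ∈ K.carrier m n)
    (h : (univRep K J hJ).toFun m n ⟨a, ha⟩ ∈ idealSpan K J hJ S) : a ∈ S.carrier m n := by
  obtain ⟨Φ, -, -, hΦ⟩ := isNaturallyIsoQuot_idealSpan (hJ := hJ) hS
  have h1 := hΦ m n a ha
  rw [(Submodule.Quotient.mk_eq_zero _).2 h, map_zero] at h1
  have hinj : ∀ (p r : ℕ) (x : (quotient S hS).Hom p r), x ∈ (J.quot hS).carrier p r →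
      (quotient S hS).ten x = 0 → x = 0 := by
    rintro p r _ ⟨b, hb, rfl⟩ h0
    have h2 : T.ten b ∈ S.carrier (p + 1) (r + 1) := (quotMk_eq_zero_iff hS).1 h0
    exact (quotMk_eq_zero_iff hS).2 (hS' p r ⟨hb, h2⟩)
  exact (quotMk_eq_zero_iff hS).1 (univRep_injective hinj _ h1.symm)

end universal

end RightTensorCStarPrecategory

theorem mainTheorem3 (T : RightTensorCStarPrecategory.{u}) (K J N : T.ClosedIdeal)
    (hJ : J ≤ K.tenCore) (hN : N.IsInvariant) :
    -- `𝒪(N)` is an ideal in `𝒪_T(K, J)`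
    (∀ x, ∀ y ∈ idealSpan K J hJ N, x * y ∈ idealSpan K J hJ N ∧ y * x ∈ idealSpan K J hJ N) ∧
    -- the natural isomorphisms
    IsNaturallyIsoInf (idealSpan K J hJ N) hN ∧
    IsNaturallyIsoQuot (idealSpan K J hJ N) hN ∧
    -- `K ∩ S_J(N)` is the preimage of `𝒪(N)` under the universal representation
    (∀ (m n : ℕ) (a : T.Hom m n) (ha : a ∈ K.carrier m n),
      a ∈ (J.saturation N).carrier m n ↔
        (univRep K J hJ).toFun m n ⟨a, ha⟩ ∈ idealSpan K J hJ N) ∧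
    -- `N` may be replaced by the invariant and `J`-saturated ideal `S_J(N)`
    ((J.saturation N).IsInvariant ∧ J.IsSaturated (J.saturation N)) ∧
    idealSpan K J hJ (J.saturation N) = idealSpan K J hJ N ∧
    IsNaturallyIsoInf (idealSpan K J hJ N) (hN.saturation J) ∧
    IsNaturallyIsoQuot (idealSpan K J hJ N) (hN.saturation J) := by
  have hle : ∀ {m n : ℕ} (a : T.Hom m n) (ha : a ∈ K.carrier m n),
      a ∈ (J.saturation N).carrier m n →
        (univRep K J hJ).toFun m n ⟨a, ha⟩ ∈ idealSpan K J hJ N :=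
    fun a ha h => toFun_mem_idealSpan_of_mem_saturation hN ha h
  have hmono : idealSpan K J hJ N ≤ idealSpan K J hJ (J.saturation N) :=
    idealSpan_mono (ClosedIdeal.le_saturation J N)
  have heq : idealSpan K J hJ (J.saturation N) = idealSpan K J hJ N := by
    refine le_antisymm ?_ hmono
    refine Submodule.topologicalClosure_minimal _ (Submodule.span_le.2 ?_)
      (Submodule.isClosed_topologicalClosure _)
    rintro _ ⟨m, n, a, ha, rfl⟩
    exact hle a ha.1 ha.2
  refine ⟨mul_mem_idealSpan K J hJ hN, isNaturallyIsoInf_idealSpan hN,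
    isNaturallyIsoQuot_idealSpan hN, fun m n a ha => ⟨hle a ha, fun h => ?_⟩,
    ⟨hN.saturation J, ClosedIdeal.isSaturated_saturation J N⟩, heq, ?_, ?_⟩
  -- The criterion needs a saturated ideal, so it is applied to `S_J(N)` after enlarging `𝒪(N)` to
  -- `𝒪(S_J(N))`.
  · exact mem_of_toFun_mem_idealSpan (hN.saturation J) (ClosedIdeal.isSaturated_saturation J N) ha
      (hmono h)
  · rw [← heq]
    exact isNaturallyIsoInf_idealSpan (hN.saturation J)
  · rw [← heq]
    exact isNaturallyIsoQuot_idealSpan (hN.saturation J)
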